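/- Let $\tau=x+iy\in\mathbb C$ with $0\le x\le\frac12$ and $y\ge\sqrt{1-x^2}$, let $\Lambda\subset\mathbb C$ be the lattice generated by $1$ and $\tau$, and let $T=\mathbb C/\Lambda$ with the conformal structure of the flat metric $|dz|^2$. Put $$r_1=\frac{y^2+x^2-x}{y^2+x^2-x+1},\qquad r_2=\frac{1-x}{y^2+x^2-x+1},\qquad r_3=\frac{x}{y^2+x^2-x+1},$$ and let $f_\tau:T\to S^5\subset\mathbb E^6\cong\mathbb C^3$ be the fundamental homothetic immersion $$f_\tau(u+iv)=\left(\sqrt{r_1}\,e^{2\pi i v/y},\ \sqrt{r_2}\,e^{2\pi i(u-vx/y)},\ \sqrt{r_3}\,e^{2\pi i(u-v(x-1)/y)}\right).$$ For a smooth map $f:T\to S^n$ let $V(f)$ be the area of the (possibly degenerate) metric $f^*g_0$, where $g_0$ is the standard metric of the unit sphere $S^n$, and let $V_c(f)=\sup_\psi V(\psi\circ f)$, where $\psi$ ranges over the conformal automorphisms (smooth conformal diffeomorphisms) of $(S^n,g_0)$. Let $V_c(T,[|dz|^2],n)$ be the infimum of $V_c(f)$ over all branched conformal maps $f:(T,[|dz|^2])\to(S^n,[g_0])$,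 i.e. smooth maps with $f^*g_0=\lambda|dz|^2$, $\lambda\ge0$, that are immersions away from a finite set (the infimum is $+\infty$ if there are none), and let $V_c(T,[|dz|^2])=\lim_{n\to\infty}V_c(T,[|dz|^2],n)$ be the Li--Yau conformal volume. Then $r_1\le\frac23$ if and only if $|\tau-\frac12|\le\frac32$, and if $r_1\le\frac23$, then $$V_c(f_\tau)=V(f_\tau),$$ the limit defining $V_c(T,[|dz|^2])$ exists, and $$V_c(\mathbb C/\Lambda,[|dz|^2])=V(f_\tau)=\frac{4\pi^2y}{y^2+x^2-x+1}.$$ -/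

import Mathlib

open scoped Manifold ContDiff ENNReal Topology
open Filter

noncomputable section

namespace ConformalTorus

/-! ### Round spheres and their conformal automorphisms -/

/-- Euclidean space `𝔼^{n+1}`. -/
abbrev Ambient (n : ℕ) : Type := EuclideanSpace ℝ (Fin (n + 1))

/-- The unit sphere `S^n ⊂ 𝔼^{n+1}`, with the smooth structure that Mathlib puts on it. -/
abbrev Sphere (n : ℕ) : Type := Metric.sphere (0 : Ambient n) 1

/-- The differential at `p` of the inclusion `S^n → 𝔼^{n+1}`. -/
def inclusionDeriv {n : ℕ} (p : Sphere n) : TangentSpace (𝓡 n) p →L[ℝ] Ambient n :=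
  mfderiv (𝓡 n) 𝓘(ℝ, Ambient n) (fun q : Sphere n => (q : Ambient n)) p

/-- The standard metric `g₀` of `S^n`: the metric induced from `𝔼^{n+1}`. -/
def roundMetric {n : ℕ} (p : Sphere n) (v w : TangentSpace (𝓡 n) p) : ℝ :=
  inner ℝ (inclusionDeriv p v) (inclusionDeriv p w)

/-- A smooth diffeomorphism `ψ` of `S^n` is a conformal automorphism of `(S^n, g₀)` if `ψ^* g₀` is
pointwise a positive multiple of `g₀`. -/
def IsConformalAut {n : ℕ} (ψ : Sphere n ≃ₘ^∞⟮𝓡 n, 𝓡 n⟯ Sphere n) : Prop :=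
  ∀ p : Sphere n, ∃ c : ℝ, 0 < c ∧ ∀ v w : TangentSpace (𝓡 n) p,
    roundMetric (ψ p) (mfderiv (𝓡 n) (𝓡 n) ψ p v) (mfderiv (𝓡 n) (𝓡 n) ψ p w) =
      c * roundMetric p v w

/-! ### The torus `ℂ/Λ` -/

/-- The lattice `Λ ⊂ ℂ` generated by `1` and `τ`. -/
def lattice (τ : ℂ) : AddSubgroup ℂ := AddSubgroup.closure {1, τ}

/-- The torus `T = ℂ/Λ`. -/
abbrev Torus (τ : ℂ) : Type := ℂ ⧸ lattice τ

/-- The `Λ`-periodic map `ℂ → 𝔼^{n+1}` that represents a map `T → S^n`. As `ℂ → T` is a covering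
and a local isometry for `|dz|²`, local properties of `f` are read off from this map. -/
def periodicLift {τ : ℂ} {n : ℕ} (f : Torus τ → Sphere n) (z : ℂ) : Ambient n :=
  (f (QuotientAddGroup.mk z) : Ambient n)

/-- The fundamental parallelogram of `Λ` spanned by `1` and `τ`. -/
def fundamentalParallelogram (τ : ℂ) : Set ℂ :=
  {z | ∃ s ∈ Set.Ico (0 : ℝ) 1, ∃ t ∈ Set.Ico (0 : ℝ) 1, z = (s : ℂ) + (t : ℂ) * τ}

/-- The density, with respect to `du dv` (where `z = u + i v`), of the area of the pull-back by
`F : ℂ → 𝔼^{n+1}` of the Euclidean metric: the square root of the Gram determinant of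
`∂F/∂u, ∂F/∂v`. -/
def areaDensity {n : ℕ} (F : ℂ → Ambient n) (z : ℂ) : ℝ :=
  √(‖fderiv ℝ F z 1‖ ^ 2 * ‖fderiv ℝ F z Complex.I‖ ^ 2 -
    (inner ℝ (fderiv ℝ F z 1) (fderiv ℝ F z Complex.I)) ^ 2)

/-- `V(f)`: the area of `T` in the (possibly degenerate) metric `f^* g₀`. -/
def area {τ : ℂ} {n : ℕ} (f : Torus τ → Sphere n) : ℝ≥0∞ :=
  ∫⁻ z in fundamentalParallelogram τ, ENNReal.ofReal (areaDensity (periodicLift f) z)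

/-! ### Conformal volume -/

/-- The conformal volume of a map, `V_c(f) = sup {V(ψ ∘ f)}`, where `ψ` ranges over the conformal
automorphisms of `(S^n, g₀)`. -/
def mapConformalVolume {τ : ℂ} {n : ℕ} (f : Torus τ → Sphere n) : ℝ≥0∞ :=
  ⨆ (ψ : Sphere n ≃ₘ^∞⟮𝓡 n, 𝓡 n⟯ Sphere n) (_ : IsConformalAut ψ), area (fun p => ψ (f p))

/-- Branched conformal maps `(T, [|dz|²]) → (S^n, [g₀])`: smooth maps with `f^* g₀ = λ |dz|²`,
`λ ≥ 0`, such that `f` is an immersion away from a finite set of points. -/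
structure IsBranchedConformal {τ : ℂ} {n : ℕ} (f : Torus τ → Sphere n) : Prop where
  smooth : ContDiff ℝ ∞ (periodicLift f)
  conformal : ∀ z : ℂ, ∃ c : ℝ, 0 ≤ c ∧ ∀ v w : ℂ,
    inner ℝ (fderiv ℝ (periodicLift f) z v) (fderiv ℝ (periodicLift f) z w) = c * inner ℝ v w
  branched : {p : Torus τ | ∃ z : ℂ, QuotientAddGroup.mk z = p ∧
    ¬ Function.Injective (fderiv ℝ (periodicLift f) z)}.Finite

/-- The conformal `n`-volume `V_c(T, [|dz|²], n)` of the torus; it is `∞` if there is no branched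
conformal map to `S^n`. -/
def nConformalVolume (τ : ℂ) (n : ℕ) : ℝ≥0∞ :=
  ⨅ (f : Torus τ → Sphere n) (_ : IsBranchedConformal f), mapConformalVolume f

/-- The conformal volume `V_c(T, [|dz|²]) = lim_{n → ∞} V_c(T, [|dz|²], n)`. -/
def conformalVolume (τ : ℂ) : ℝ≥0∞ := limUnder atTop (nConformalVolume τ)

/-! ### The fundamental homothetic immersion -/

/-- The region `0 ≤ x ≤ 1/2`, `y ≥ √(1 - x²)` of points `τ = x + i y`. -/
structure InFundamentalRegion (τ : ℂ) : Prop where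
  re_nonneg : 0 ≤ τ.re
  re_le_half : τ.re ≤ 1 / 2
  le_im : √(1 - τ.re ^ 2) ≤ τ.im

/-- `y² + x² - x + 1`, for `τ = x + i y`. -/
def den (τ : ℂ) : ℝ := τ.im ^ 2 + τ.re ^ 2 - τ.re + 1

/-- `r₁ = (y² + x² - x) / (y² + x² - x + 1)`. -/
def r₁ (τ : ℂ) : ℝ := (τ.im ^ 2 + τ.re ^ 2 - τ.re) / den τ

/-- `r₂ = (1 - x) / (y² + x² - x + 1)`. -/
def r₂ (τ : ℂ) : ℝ := (1 - τ.re) / den τ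

/-- `r₃ = x / (y² + x² - x + 1)`. -/
def r₃ (τ : ℂ) : ℝ := τ.re / den τ

/-- The vector `f_τ(u + i v)` of `𝔼^6`. -/
def fundamentalVector (τ z : ℂ) : Ambient 5 :=
  !₂[√(r₁ τ) * Real.cos (2 * Real.pi * (z.im / τ.im)),
     √(r₁ τ) * Real.sin (2 * Real.pi * (z.im / τ.im)),
     √(r₂ τ) * Real.cos (2 * Real.pi * (z.re - z.im * τ.re / τ.im)),
     √(r₂ τ) * Real.sin (2 * Real.pi * (z.re - z.im * τ.re / τ.im)),
     √(r₃ τ) * Real.cos (2 * Real.pi * (z.re - z.im * (τ.re - 1) / τ.im)),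
     √(r₃ τ) * Real.sin (2 * Real.pi * (z.re - z.im * (τ.re - 1) / τ.im))]

theorem InFundamentalRegion.im_sq {τ : ℂ} (h : InFundamentalRegion τ) :
    1 ≤ τ.im ^ 2 + τ.re ^ 2 := by
  have h1 := h.re_nonneg
  have h2 := h.re_le_half
  have h3 : (0 : ℝ) ≤ 1 - τ.re ^ 2 := by nlinarith
  have h4 := Real.sq_sqrt h3
  have h5 := pow_le_pow_left₀ (Real.sqrt_nonneg _) h.le_im 2
  linarith

theorem InFundamentalRegion.im_ne_zero {τ : ℂ} (h : InFundamentalRegion τ) : τ.im ≠ 0 := by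
  intro h0
  have h1 := h.re_nonneg
  have h2 := h.re_le_half
  have h3 := h.im_sq
  rw [h0] at h3
  nlinarith

theorem InFundamentalRegion.den_pos {τ : ℂ} (h : InFundamentalRegion τ) : 0 < den τ := by
  have h2 := h.re_le_half
  have h3 := h.im_sq
  unfold den
  linarith

theorem fundamentalVector_mem {τ : ℂ} (h : InFundamentalRegion τ) (z : ℂ) :
    fundamentalVector τ z ∈ Metric.sphere (0 : Ambient 5) 1 := by
  have hd := h.den_pos
  have h1 : 0 ≤ r₁ τ := div_nonneg (by linarith [h.im_sq, h.re_le_half]) hd.le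
  have h2 : 0 ≤ r₂ τ := div_nonneg (by linarith [h.re_le_half]) hd.le
  have h3 : 0 ≤ r₃ τ := div_nonneg h.re_nonneg hd.le
  have hs : r₁ τ + r₂ τ + r₃ τ = 1 := by
    unfold r₁ r₂ r₃
    rw [← add_div, ← add_div, div_eq_one_iff_eq hd.ne']
    unfold den
    ring
  rw [mem_sphere_zero_iff_norm, EuclideanSpace.norm_eq, Real.sqrt_eq_one]
  simp only [Fin.sum_univ_succ, fundamentalVector, Real.norm_eq_abs, sq_abs]
  simp [mul_pow, Real.sq_sqrt h1, Real.sq_sqrt h2, Real.sq_sqrt h3]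
  linear_combination hs + r₁ τ * Real.sin_sq_add_cos_sq (2 * Real.pi * (z.im / τ.im)) +
    r₂ τ * Real.sin_sq_add_cos_sq (2 * Real.pi * (z.re - z.im * τ.re / τ.im)) +
    r₃ τ * Real.sin_sq_add_cos_sq (2 * Real.pi * (z.re - z.im * (τ.re - 1) / τ.im))

theorem fundamentalVector_periodic {τ : ℂ} (h : InFundamentalRegion τ) {z w : ℂ}
    (hzw : -z + w ∈ lattice τ) : fundamentalVector τ z = fundamentalVector τ w := by
  have hy := h.im_ne_zero
  obtain ⟨m, n, hmn⟩ := AddSubgroup.mem_closure_pair.1 hzw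
  have hw : w = z + (m + n * τ) := by
    simp only [zsmul_eq_mul, mul_one] at hmn
    linear_combination -hmn
  have e1 : 2 * Real.pi * (w.im / τ.im) = 2 * Real.pi * (z.im / τ.im) + n * (2 * Real.pi) := by
    rw [hw]; simp; field_simp
  have e2 : 2 * Real.pi * (w.re - w.im * τ.re / τ.im) =
      2 * Real.pi * (z.re - z.im * τ.re / τ.im) + m * (2 * Real.pi) := by
    rw [hw]; simp; field_simp; ring
  have e3 : 2 * Real.pi * (w.re - w.im * (τ.re - 1) / τ.im) =
      2 * Real.pi * (z.re - z.im * (τ.re - 1) / τ.im) + (m + n : ℤ) * (2 * Real.pi) := by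
    rw [hw]; simp; field_simp; ring
  unfold fundamentalVector
  rw [e1, e2, e3]
  simp only [Real.cos_add_int_mul_two_pi, Real.sin_add_int_mul_two_pi]

/-- The fundamental homothetic immersion `f_τ : T → S^5`. -/
def fundamentalImmersion {τ : ℂ} (h : InFundamentalRegion τ) : Torus τ → Sphere 5 :=
  Quotient.lift (fun z : ℂ => (⟨fundamentalVector τ z, fundamentalVector_mem h z⟩ : Sphere 5))
    (fun _ _ hzw => Subtype.ext
      (fundamentalVector_periodic h (QuotientAddGroup.leftRel_apply.1 hzw)))

end ConformalTorus

end

open ConformalTorus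

namespace ConformalTorus

/-! ### A binomial estimate -/

/-! Write V₀ = 4π²y / (y² + x² - x + 1). Two inequalities meet at V₀, for every target dimension n ≥
5.

Lower bound (`conformalVolume_lower_bound`). Composing a branched conformal map with a suitable
conformal dilation gives a map G with mean zero: this is Hersch's balancing trick, here obtained by
minimizing an averaged Busemann function (`exists_balancing_point`). In the coordinates z = s + tτ,
the form |∂₁G|² + |∂_τG|² + |∂₁G - ∂_τG|² is the Dirichlet energy of the hexagonal torus, whatever τ
is. Its first eigenvalue is 8π² (`hexagonal_poincare`). For a conformal map with factor c the same
form equals 2(y² + x² - x + 1)c, because |1|² + |τ|² + |1 - τ|² has that value. Since |G| = 1,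
integrating bounds the area below by V₀. The components of f_τ are characters of frequencies (0,1),
(1,0), (1,1) in (s,t), which all belong to this first eigenvalue.

Upper bound (`area_conformalAut_comp_le`). By Liouville's theorem in dimension at least 3, an
automorphism of the sphere rescales the metric by (A + ⟨B,p⟩)⁻² with A² - |B|² = 1
(`IsConformalAut.exists_affine_factor`). It is proved on the light cone: the lift of a conformal
parametrization is a quadratic polynomial. As f_τ is homothetic, it remains to see that the average
of (A + ⟨b,f_τ⟩)⁻² is at most 1 when A² - |b|² ≥ 1. This is `three_angle_average_le`. A convexity
argument merges the second and third circles into one circle of weight r₂ + r₃. The remaining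
integral is expanded in even moments, and each moment is controlled by `binomial_estimate` with the
weights r₁ and 1 - r₁. Already its case k = 1 says that both weights are at most 2/3, and this is
where r₁ ≤ 2/3 enters; r₁ ≥ 1/3 is automatic.

Hence the conformal n-volume is constant from n = 5 on. -/

theorem pow_mul_pow_mul_add_pow_le {r q : ℝ} (hr : 0 ≤ r) (hq : 0 ≤ q) (hrq : r + q = 1)
    (i j : ℕ) : r ^ i * q ^ j * ((i + j : ℕ) : ℝ) ^ (i + j) ≤ (i : ℝ) ^ i * (j : ℝ) ^ j := by
  rcases Nat.eq_zero_or_pos i with rfl | hi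
  · simp only [pow_zero, one_mul, zero_add]
    exact mul_le_of_le_one_left (by positivity) (pow_le_one₀ hq (by linarith))
  rcases Nat.eq_zero_or_pos j with rfl | hj
  · simp only [pow_zero, mul_one, add_zero]
    exact mul_le_of_le_one_left (by positivity) (pow_le_one₀ hr (by linarith))
  have hi' : (0 : ℝ) < i := by exact_mod_cast hi
  have hj' : (0 : ℝ) < j := by exact_mod_cast hj
  have hk : (0 : ℝ) < (i : ℝ) + j := by positivity
  -- Weighted AM-GM for r(i+j)/i and q(i+j)/j, whose weighted mean is r + q = 1: the product r^i q^j
  -- is largest at r = i/(i+j).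
  have h := Real.geom_mean_le_arith_mean2_weighted (w₁ := i / (i + j)) (w₂ := j / (i + j))
    (p₁ := r * (i + j) / i) (p₂ := q * (i + j) / j) (by positivity) (by positivity)
    (by positivity) (by positivity) (by field_simp)
  have h1 : (i : ℝ) / (i + j) * (r * (i + j) / i) + j / (i + j) * (q * (i + j) / j) = 1 := by
    field_simp; linarith
  rw [h1] at h
  have h2 := pow_le_one₀ (n := i + j) (by positivity) h
  rw [mul_pow, ← Real.rpow_natCast, ← Real.rpow_natCast, ← Real.rpow_mul (by positivity),
    ← Real.rpow_mul (by positivity)] at h2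
  push_cast at h2
  rw [div_mul_cancel₀ _ hk.ne', div_mul_cancel₀ _ hk.ne', Real.rpow_natCast,
    Real.rpow_natCast, div_pow, div_pow, mul_pow, mul_pow, div_mul_div_comm,
    div_le_one (by positivity)] at h2
  calc _ = _ := ?_
    _ ≤ _ := h2
  push_cast; ring

theorem factorial_eq_stirlingSeq_mul (n : ℕ) (hn : n ≠ 0) :
    (n.factorial : ℝ) = Stirling.stirlingSeq n * (√(2 * n) * (n / Real.exp 1) ^ n) := by
  have : (0 : ℝ) < n := by exact_mod_cast Nat.pos_of_ne_zero hn
  rw [Stirling.stirlingSeq, div_mul_cancel₀]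
  positivity

/-- Stirling: the powers of e and of the integers match exactly, the Stirling factors are compared
by monotonicity and the lower bound √π, and only the square roots are left. -/
theorem factorial_estimate_of_large (i j : ℕ) (hij : i ≤ 2 * j) (hji : j ≤ 2 * i)
    (hk : 11 ≤ i + j) :
    ((2 * (i + j) + 1 : ℕ) : ℝ) * (2 * (i + j)).factorial * ((i : ℝ) ^ i * (j : ℝ) ^ j) ≤
      4 ^ (i + j) * ((i + j : ℕ) : ℝ) ^ (i + j) *
        ((i + j).factorial * (i.factorial * j.factorial)) := by
  obtain ⟨k, hkk⟩ : ∃ k, k = i + j := ⟨_, rfl⟩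
  rw [← hkk]
  have hk0 : k ≠ 0 := by omega
  have hi0 : i ≠ 0 := by omega
  have hj0 : j ≠ 0 := by omega
  rw [factorial_eq_stirlingSeq_mul (2 * k) (by omega), factorial_eq_stirlingSeq_mul k hk0,
    factorial_eq_stirlingSeq_mul i hi0, factorial_eq_stirlingSeq_mul j hj0]
  have hS : Stirling.stirlingSeq (2 * k) ≤ Stirling.stirlingSeq k := by
    have := Stirling.stirlingSeq'_antitone (show k - 1 ≤ 2 * k - 1 by omega)
    simpa [show k - 1 + 1 = k by omega, show 2 * k - 1 + 1 = 2 * k by omega] using this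
  have hSi := Stirling.sqrt_pi_le_stirlingSeq hi0
  have hSj := Stirling.sqrt_pi_le_stirlingSeq hj0
  have hSk := Stirling.sqrt_pi_le_stirlingSeq hk0
  have hpi : (0 : ℝ) < √Real.pi := by positivity
  have hi' : (0 : ℝ) < i := by exact_mod_cast Nat.pos_of_ne_zero hi0
  have hj' : (0 : ℝ) < j := by exact_mod_cast Nat.pos_of_ne_zero hj0
  have hk' : (0 : ℝ) < k := by exact_mod_cast Nat.pos_of_ne_zero hk0
  have hkij : (k : ℝ) = i + j := by exact_mod_cast hkk
  set Si := Stirling.stirlingSeq i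
  set Sj := Stirling.stirlingSeq j
  set Sk := Stirling.stirlingSeq k
  set S2 := Stirling.stirlingSeq (2 * k)
  have hSi0 : 0 ≤ Si := hpi.le.trans hSi
  have hprod : Real.pi ≤ Si * Sj := by
    calc Real.pi = √Real.pi * √Real.pi := (Real.mul_self_sqrt Real.pi_pos.le).symm
      _ ≤ _ := by gcongr
  have hroot : √(2 * (2 * k : ℕ)) * √(2 * i * j) = √(2 * k) * (√(2 * i) * √(2 * j)) := by
    rw [← Real.sqrt_mul (by positivity), ← Real.sqrt_mul (by positivity),
      ← Real.sqrt_mul (by positivity)]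
    congr 1; push_cast; ring
  -- The constraints give (2i - j)(2j - i) ≥ 0, that is √(2ij) ≥ 2k/3. With π > 3.14 the claim then
  -- holds from k = 11 on, which fixes the threshold; the remaining pairs are checked by computation
  -- in `factorial_estimate`.
  have hR : (2 * k + 1 : ℝ) ≤ Real.pi * √(2 * i * j) := by
    have h1 : (2 * k / 3 : ℝ) ≤ √(2 * i * j) := by
      apply Real.le_sqrt_of_sq_le
      have a : (i : ℝ) ≤ 2 * j := by exact_mod_cast hij
      have b : (j : ℝ) ≤ 2 * i := by exact_mod_cast hji
      rw [hkij]
      nlinarith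
    have h2 := Real.pi_gt_d2
    have h3 : (11 : ℝ) ≤ k := by exact_mod_cast hkk ▸ hk
    nlinarith
  have hpow : ((2 * k : ℕ) / Real.exp 1) ^ (2 * k) * ((i : ℝ) ^ i * (j : ℝ) ^ j) =
      4 ^ k * (k : ℝ) ^ k *
        ((k / Real.exp 1) ^ k * ((i / Real.exp 1) ^ i * (j / Real.exp 1) ^ j)) := by
    simp only [div_pow]
    have he : Real.exp 1 ^ (2 * k) = Real.exp 1 ^ k * (Real.exp 1 ^ i * Real.exp 1 ^ j) := by
      rw [← pow_add, ← pow_add]; congr 1; omega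
    rw [he]
    field_simp
    push_cast
    rw [mul_pow, pow_mul, pow_mul, show ((2 : ℝ) ^ 2) = 4 by norm_num, ← pow_mul]
    ring
  have hs : (0 : ℝ) < √(2 * i * j) := by positivity
  rw [← mul_le_mul_iff_left₀ hs]
  have key : ((2 * k + 1 : ℕ) : ℝ) * S2 ≤ Sk * (Si * Sj) * √(2 * i * j) := by
    push_cast
    have h0 : 0 < Sk := lt_of_lt_of_le hpi hSk
    calc (2 * k + 1 : ℝ) * S2 ≤ (2 * k + 1 : ℝ) * Sk := by gcongr
      _ ≤ (Real.pi * √(2 * i * j)) * Sk := by gcongr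
      _ ≤ ((Si * Sj) * √(2 * i * j)) * Sk := by gcongr
      _ = _ := by ring
  calc _ = (((2 * k + 1 : ℕ) : ℝ) * S2) * ((√(2 * (2 * k : ℕ)) * √(2 * i * j)) *
        (((2 * k : ℕ) / Real.exp 1) ^ (2 * k) * ((i : ℝ) ^ i * (j : ℝ) ^ j))) := by ring
    _ ≤ (Sk * (Si * Sj) * √(2 * i * j)) * ((√(2 * (2 * k : ℕ)) * √(2 * i * j)) *
        (((2 * k : ℕ) / Real.exp 1) ^ (2 * k) * ((i : ℝ) ^ i * (j : ℝ) ^ j))) := by gcongr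
    _ = _ := by rw [hroot, hpow]; ring

theorem factorial_estimate (i j : ℕ) (hij : i ≤ 2 * j) (hji : j ≤ 2 * i) :
    ((2 * (i + j) + 1 : ℕ) : ℝ) * (2 * (i + j)).factorial * ((i : ℝ) ^ i * (j : ℝ) ^ j) ≤
      4 ^ (i + j) * ((i + j : ℕ) : ℝ) ^ (i + j) *
        ((i + j).factorial * (i.factorial * j.factorial)) := by
  rcases le_or_gt 11 (i + j) with h | h
  · exact factorial_estimate_of_large i j hij hji h
  · have : ∀ a < 11, ∀ b < 11, a + b < 11 → a ≤ 2 * b → b ≤ 2 * a →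
        (2 * (a + b) + 1) * (2 * (a + b)).factorial * (a ^ a * b ^ b) ≤
          4 ^ (a + b) * (a + b) ^ (a + b) *
            ((a + b).factorial * (a.factorial * b.factorial)) := by
      decide +kernel
    exact_mod_cast this i (by omega) j (by omega) h hij hji

theorem centralBinom_mul_choose_mul (i j : ℕ) :
    (i + j).centralBinom * (i + j).choose i * ((i + j).factorial * (i.factorial * j.factorial)) =
      (2 * (i + j)).factorial := by
  have h1 := Nat.choose_mul_factorial_mul_factorial (show i ≤ i + j by omega)
  have h2 := Nat.choose_mul_factorial_mul_factorial (show i + j ≤ 2 * (i + j) by omega)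
  rw [show i + j - i = j by omega] at h1
  rw [show 2 * (i + j) - (i + j) = i + j by omega] at h2
  rw [Nat.centralBinom_eq_two_mul_choose, ← h2]
  conv_rhs => rw [← h1]
  rw [← h1]; ring

theorem centralBinom_choose_estimate (i j : ℕ) (hij : i ≤ 2 * j) (hji : j ≤ 2 * i) :
    ((2 * (i + j) + 1 : ℕ) : ℝ) * (i + j).centralBinom * (i + j).choose i *
      ((i : ℝ) ^ i * (j : ℝ) ^ j) ≤ 4 ^ (i + j) * ((i + j : ℕ) : ℝ) ^ (i + j) := by
  have h1 := factorial_estimate i j hij hji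
  rw [← centralBinom_mul_choose_mul i j] at h1
  have h2 : (0 : ℝ) < (i + j).factorial * (i.factorial * j.factorial) := by positivity
  rw [← mul_le_mul_iff_left₀ h2]
  refine le_trans (le_of_eq ?_) h1
  push_cast; ring

/-- Induction on i + j. Lowering i or j by one is harmless as long as the ratio of consecutive terms
is at most 4. If neither step is possible, i : j is so close to r : q that the estimate follows from
AM-GM and the Stirling bound. -/
theorem binomial_estimate {r q : ℝ} (hr : 1 / 3 ≤ r) (hq : 1 / 3 ≤ q) (hrq : r + q = 1)
    (k : ℕ) : ∀ i j : ℕ, i + j = k →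
    (2 * (i + j : ℕ) + 1 : ℝ) * (i + j).centralBinom * (i + j).choose i * (r ^ i * q ^ j) ≤
      4 ^ (i + j) := by
  induction k with
  | zero => intro i j h; obtain ⟨rfl, rfl⟩ : i = 0 ∧ j = 0 := by omega
            simp
  | succ k ih =>
    intro i j h
    have hcb : ((k : ℝ) + 1) * (k + 1).centralBinom = 2 * (2 * k + 1) * k.centralBinom := by
      exact_mod_cast Nat.succ_mul_centralBinom_succ k
    -- The terms at (i, j) and (i - 1, j) have ratio 2(2k + 3)r / i, so this is exactly the
    -- condition that it be at most 4.
    by_cases h1 : (2 * (k + 1 : ℝ) + 1) * r ≤ 2 * i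
    · obtain ⟨i, rfl⟩ : ∃ i', i = i' + 1 := by
        refine ⟨i - 1, ?_⟩
        rcases Nat.eq_zero_or_pos i with rfl | hi
        · push_cast at h1; nlinarith
        · omega
      have hk : i + j = k := by omega
      have := ih i j hk
      rw [show i + 1 + j = k + 1 by omega]
      rw [hk] at this
      have hch : ((k : ℝ) + 1) * k.choose i = (k + 1).choose (i + 1) * (i + 1) := by
        exact_mod_cast Nat.add_one_mul_choose_eq k i
      push_cast at h1 ⊢
      have e : ((2 * (k + 1 : ℝ) + 1) * (k + 1).centralBinom * (k + 1).choose (i + 1) *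
          (r ^ (i + 1) * q ^ j)) * (i + 1) = ((2 * (k + 1 : ℝ) + 1) * r) *
          (2 * ((2 * k + 1 : ℝ) * k.centralBinom * k.choose i * (r ^ i * q ^ j))) := by
        have hk1 : ((k : ℝ) + 1) ≠ 0 := by positivity
        apply mul_left_cancel₀ hk1
        linear_combination ((2 * (k + 1 : ℝ) + 1) * (r ^ (i + 1) * q ^ j)) *
          ((k + 1).choose (i + 1) * (i + 1) * hcb - 2 * (2 * k + 1) * k.centralBinom * hch)
      have hi : (0 : ℝ) < i + 1 := by positivity
      rw [← mul_le_mul_iff_left₀ hi, e]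
      calc _ ≤ (2 * (i + 1 : ℝ)) * (2 * 4 ^ k) := by gcongr
        _ = _ := by ring
    by_cases h2 : (2 * (k + 1 : ℝ) + 1) * q ≤ 2 * j
    · obtain ⟨j, rfl⟩ : ∃ i', j = i' + 1 := by
        refine ⟨j - 1, ?_⟩
        rcases Nat.eq_zero_or_pos j with rfl | hi
        · push_cast at h2; nlinarith
        · omega
      have hk : i + j = k := by omega
      have := ih i j hk
      rw [show i + (j + 1) = k + 1 by omega]
      rw [hk] at this
      have hch : ((k : ℝ) + 1) * k.choose i = (k + 1).choose i * (j + 1) := by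
        have a := Nat.add_one_mul_choose_eq k j
        rw [← Nat.choose_symm_of_eq_add (show k = i + j by omega),
          ← Nat.choose_symm_of_eq_add (show k + 1 = i + (j + 1) by omega)] at a
        exact_mod_cast a
      push_cast at h2 ⊢
      have e : ((2 * (k + 1 : ℝ) + 1) * (k + 1).centralBinom * (k + 1).choose i *
          (r ^ i * q ^ (j + 1))) * (j + 1) = ((2 * (k + 1 : ℝ) + 1) * q) *
          (2 * ((2 * k + 1 : ℝ) * k.centralBinom * k.choose i * (r ^ i * q ^ j))) := by
        have hk1 : ((k : ℝ) + 1) ≠ 0 := by positivity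
        apply mul_left_cancel₀ hk1
        linear_combination ((2 * (k + 1 : ℝ) + 1) * (r ^ i * q ^ (j + 1))) *
          ((k + 1).choose i * (j + 1) * hcb - 2 * (2 * k + 1) * k.centralBinom * hch)
      have hi : (0 : ℝ) < j + 1 := by positivity
      rw [← mul_le_mul_iff_left₀ hi, e]
      calc _ ≤ (2 * (j + 1 : ℝ)) * (2 * 4 ^ k) := by gcongr
        _ = _ := by ring
    -- Both tests fail. Since r and q are at most 2/3, this forces i < 2j + 1 and j < 2i + 1, which
    -- for integers are the hypotheses of `centralBinom_choose_estimate`.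
    · have hkr : (k : ℝ) + 1 = i + j := by exact_mod_cast h.symm
      rw [hkr] at h1 h2
      push Not at h1 h2
      have hji : j < 2 * i + 1 := by
        have : (j : ℝ) < 2 * i + 1 := by nlinarith
        exact_mod_cast this
      have hij : i < 2 * j + 1 := by
        have : (i : ℝ) < 2 * j + 1 := by nlinarith
        exact_mod_cast this
      have c := centralBinom_choose_estimate i j (by omega) (by omega)
      have d := pow_mul_pow_mul_add_pow_le (by linarith : 0 ≤ r) (by linarith : 0 ≤ q) hrq i j
      have hp : (0 : ℝ) < ((i + j : ℕ) : ℝ) ^ (i + j) := by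
        have : 0 < i + j := by omega
        positivity
      rw [← mul_le_mul_iff_left₀ hp]
      push_cast at c d ⊢
      calc _ = (2 * (i + j : ℝ) + 1) * (i + j).centralBinom * (i + j).choose i *
            (r ^ i * q ^ j * (i + j : ℝ) ^ (i + j)) := by ring
        _ ≤ (2 * (i + j : ℝ) + 1) * (i + j).centralBinom * (i + j).choose i *
            ((i : ℝ) ^ i * (j : ℝ) ^ j) := by gcongr
        _ ≤ _ := c

/-! ### Averages of inverse squares of trigonometric polynomials -/

theorem integral_cos_two_pi_pow_add_two (n : ℕ) :
    ∫ t in (0 : ℝ)..1, Real.cos (2 * Real.pi * t) ^ (n + 2) =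
      (n + 1) / (n + 2) * ∫ t in (0 : ℝ)..1, Real.cos (2 * Real.pi * t) ^ n := by
  have h (m : ℕ) : ∫ t in (0 : ℝ)..1, Real.cos (2 * Real.pi * t) ^ m =
      (2 * Real.pi)⁻¹ * ∫ x in (0 : ℝ)..(2 * Real.pi), Real.cos x ^ m := by
    rw [intervalIntegral.integral_comp_mul_left (fun x => Real.cos x ^ m) Real.two_pi_pos.ne']
    simp
  rw [h, h, integral_cos_pow]
  simp
  ring

theorem integral_cos_two_pi_pow_odd (k : ℕ) :
    ∫ t in (0 : ℝ)..1, Real.cos (2 * Real.pi * t) ^ (2 * k + 1) = 0 := by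
  induction k with
  | zero => simp
  | succ k ih => rw [show 2 * (k + 1) + 1 = 2 * k + 1 + 2 by ring,
      integral_cos_two_pi_pow_add_two, ih, mul_zero]

theorem integral_cos_two_pi_pow_even (k : ℕ) :
    ∫ t in (0 : ℝ)..1, Real.cos (2 * Real.pi * t) ^ (2 * k) = k.centralBinom / 4 ^ k := by
  induction k with
  | zero => simp
  | succ k ih =>
    rw [show 2 * (k + 1) = 2 * k + 2 by ring, integral_cos_two_pi_pow_add_two, ih]
    have hcb : ((k : ℝ) + 1) * (k + 1).centralBinom = 2 * (2 * k + 1) * k.centralBinom := by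
      exact_mod_cast Nat.succ_mul_centralBinom_succ k
    push_cast
    rw [pow_succ]
    field_simp
    linear_combination -2 * hcb

theorem sum_range_of_odd_eq_zero {g : ℕ → ℝ} (hg : ∀ i, g (2 * i + 1) = 0) (k : ℕ) :
    ∑ m ∈ Finset.range (2 * k + 1), g m = ∑ i ∈ Finset.range (k + 1), g (2 * i) := by
  induction k with
  | zero => simp
  | succ k ih =>
    rw [Finset.sum_range_succ _ (k + 1), ← ih, show 2 * (k + 1) + 1 = 2 * k + 1 + 1 + 1 by ring,
      Finset.sum_range_succ _ (2 * k + 1 + 1), Finset.sum_range_succ _ (2 * k + 1), hg]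
    simp [mul_add]

theorem integral_integral_add_pow (β γ : ℝ) (n : ℕ) :
    ∫ t in (0 : ℝ)..1, ∫ s in (0 : ℝ)..1,
      (β * Real.cos (2 * Real.pi * t) + γ * Real.cos (2 * Real.pi * s)) ^ n =
    ∑ m ∈ Finset.range (n + 1), β ^ m * γ ^ (n - m) * n.choose m *
      ((∫ t in (0 : ℝ)..1, Real.cos (2 * Real.pi * t) ^ m) *
        ∫ t in (0 : ℝ)..1, Real.cos (2 * Real.pi * t) ^ (n - m)) := by
  have h1 (t : ℝ) : ∫ s in (0 : ℝ)..1,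
      (β * Real.cos (2 * Real.pi * t) + γ * Real.cos (2 * Real.pi * s)) ^ n =
      ∑ m ∈ Finset.range (n + 1), (β ^ m * γ ^ (n - m) * n.choose m *
        ∫ t in (0 : ℝ)..1, Real.cos (2 * Real.pi * t) ^ (n - m)) *
          Real.cos (2 * Real.pi * t) ^ m := by
    simp_rw [add_pow]
    rw [intervalIntegral.integral_finsetSum]
    · refine Finset.sum_congr rfl fun m _ => ?_
      rw [← intervalIntegral.integral_const_mul, ← intervalIntegral.integral_mul_const]
      congr 1; ext s; ring
    · intro m _
      exact Continuous.intervalIntegrable (by fun_prop) _ _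
  simp_rw [h1]
  rw [intervalIntegral.integral_finsetSum]
  · refine Finset.sum_congr rfl fun m _ => ?_
    rw [intervalIntegral.integral_const_mul]
    ring
  · intro m _
    exact Continuous.intervalIntegrable (by fun_prop) _ _

/-- The left side is the coefficient in an even moment of β cos + γ cos. On the right one factor `(i
+ j).choose i` is kept to rebuild (s₁ + s₂)^k, and the rest is bounded by `binomial_estimate`. -/
theorem choose_two_mul_mul_centralBinom (i j : ℕ) :
    (2 * (i + j)).choose (2 * i) * (i.centralBinom * j.centralBinom) =
      (i + j).centralBinom * (i + j).choose i * (i + j).choose i := by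
  have h (m : ℕ) := Nat.choose_mul_factorial_mul_factorial (show m ≤ 2 * m by omega)
  have hc := Nat.choose_mul_factorial_mul_factorial (show 2 * i ≤ 2 * (i + j) by omega)
  have hd := Nat.choose_mul_factorial_mul_factorial (show i ≤ i + j by omega)
  have hi := h i
  have hj := h j
  have hij := h (i + j)
  rw [show 2 * (i + j) - 2 * i = 2 * j by omega] at hc
  rw [show i + j - i = j by omega] at hd
  rw [show 2 * i - i = i by omega, ← Nat.centralBinom_eq_two_mul_choose] at hi
  rw [show 2 * j - j = j by omega, ← Nat.centralBinom_eq_two_mul_choose] at hj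
  rw [show 2 * (i + j) - (i + j) = i + j by omega, ← Nat.centralBinom_eq_two_mul_choose] at hij
  have hp : 0 < i.factorial ^ 2 * j.factorial ^ 2 := by positivity
  apply Nat.eq_of_mul_eq_mul_right hp
  calc _ = (2 * (i + j)).choose (2 * i) * (i.centralBinom * i.factorial * i.factorial) *
        (j.centralBinom * j.factorial * j.factorial) := by ring
    _ = (i + j).centralBinom * ((i + j).choose i * i.factorial * j.factorial) *
        ((i + j).choose i * i.factorial * j.factorial) := by rw [hi, hj, hc, hd, hij]
    _ = _ := by ring

theorem integral_integral_add_pow_odd (β γ : ℝ) (k : ℕ) :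
    ∫ t in (0 : ℝ)..1, ∫ s in (0 : ℝ)..1,
      (β * Real.cos (2 * Real.pi * t) + γ * Real.cos (2 * Real.pi * s)) ^ (2 * k + 1) = 0 := by
  rw [integral_integral_add_pow]
  refine Finset.sum_eq_zero fun m hm => ?_
  rw [Finset.mem_range] at hm
  rcases Nat.even_or_odd' m with ⟨i, rfl | rfl⟩
  · rw [show 2 * k + 1 - 2 * i = 2 * (k - i) + 1 by omega, integral_cos_two_pi_pow_odd]
    ring
  · rw [integral_cos_two_pi_pow_odd]
    ring

/-- The comparison is made term by term between two binomial expansions. The factor 2k + 1 is the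
coefficient of X^(2k) in (1 + X)⁻². -/
theorem integral_integral_add_pow_even_le {r q s₁ s₂ β γ : ℝ} (hr : 1 / 3 ≤ r) (hq : 1 / 3 ≤ q)
    (hrq : r + q = 1) (hs₁ : 0 ≤ s₁) (hs₂ : 0 ≤ s₂) (hβ : β ^ 2 = r * s₁) (hγ : γ ^ 2 = q * s₂)
    (k : ℕ) :
    (2 * k + 1) * ∫ t in (0 : ℝ)..1, ∫ s in (0 : ℝ)..1,
      (β * Real.cos (2 * Real.pi * t) + γ * Real.cos (2 * Real.pi * s)) ^ (2 * k) ≤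
    (s₁ + s₂) ^ k := by
  rw [integral_integral_add_pow, sum_range_of_odd_eq_zero, add_pow, Finset.mul_sum]
  · refine Finset.sum_le_sum fun i hi => ?_
    rw [Finset.mem_range] at hi
    obtain ⟨j, rfl⟩ : ∃ j, k = i + j := ⟨k - i, by omega⟩
    rw [show 2 * (i + j) - 2 * i = 2 * j by omega, show i + j - i = j by omega,
      integral_cos_two_pi_pow_even, integral_cos_two_pi_pow_even, pow_mul, pow_mul, hβ, hγ]
    have hb := binomial_estimate hr hq hrq (i + j) i j rfl
    have hc : ((2 * (i + j)).choose (2 * i) : ℝ) * (i.centralBinom * j.centralBinom) =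
      (i + j).centralBinom * (i + j).choose i * (i + j).choose i := by
      exact_mod_cast choose_two_mul_mul_centralBinom i j
    calc _ = s₁ ^ i * s₂ ^ j * (r ^ i * q ^ j) * (2 * (i + j : ℕ) + 1) *
          (((2 * (i + j)).choose (2 * i) : ℝ) * (i.centralBinom * j.centralBinom)) /
            4 ^ (i + j) := by
            rw [mul_pow, mul_pow, pow_add]; push_cast; field_simp
      _ = s₁ ^ i * s₂ ^ j * (i + j).choose i * ((2 * (i + j : ℕ) + 1 : ℝ) *
          (i + j).centralBinom * (i + j).choose i * (r ^ i * q ^ j)) / 4 ^ (i + j) := by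
          rw [hc]; ring
      _ ≤ s₁ ^ i * s₂ ^ j * (i + j).choose i * 4 ^ (i + j) / 4 ^ (i + j) := by gcongr
      _ = _ := by field_simp
  · intro i
    rw [integral_cos_two_pi_pow_odd]; ring

theorem hasSum_integral_unitInterval {f : ℕ → ℝ → ℝ} {g : ℝ → ℝ} {b : ℕ → ℝ}
    (hf : ∀ n, Continuous (f n)) (hb : ∀ n x, |f n x| ≤ b n) (hs : Summable b)
    (hg : ∀ x, HasSum (fun n => f n x) (g x)) :
    HasSum (fun n => ∫ x in (0 : ℝ)..1, f n x) (∫ x in (0 : ℝ)..1, g x) :=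
  intervalIntegral.hasSum_integral_of_dominated_convergence (fun n _ => b n)
    (fun n => (hf n).aestronglyMeasurable) (fun n => .of_forall fun x _ => hb n x)
    (.of_forall fun _ _ => hs) (by simp) (.of_forall fun x _ => hg x)

theorem hasSum_inv_one_add_sq {x : ℝ} (hx : |x| < 1) :
    HasSum (fun n : ℕ => (n + 1) * (-x) ^ n) (((1 + x) ^ 2)⁻¹) := by
  have h := hasSum_choose_mul_geometric_of_norm_lt_one 1 (r := -x) (by simpa using hx)
  simpa using h

theorem abs_le_sqrt_of_mul_self_le {x y r q s₁ s₂ : ℝ} (hr : 0 ≤ r) (hq : 0 ≤ q)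
    (hrq : r + q = 1) (hs₁ : 0 ≤ s₁) (hs₂ : 0 ≤ s₂)
    (hx : x ^ 2 ≤ r * s₁) (hy : y ^ 2 ≤ q * s₂) : |x + y| ≤ √(s₁ + s₂) := by
  apply Real.abs_le_sqrt
  have h1 : |x| ≤ √r * √s₁ := by rw [← Real.sqrt_mul hr]; exact Real.abs_le_sqrt hx
  have h2 : |y| ≤ √q * √s₂ := by rw [← Real.sqrt_mul hq]; exact Real.abs_le_sqrt hy
  have e1 := Real.sq_sqrt hr
  have e2 := Real.sq_sqrt hq
  have e3 := Real.sq_sqrt hs₁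
  have e4 := Real.sq_sqrt hs₂
  calc (x + y) ^ 2 = |x + y| ^ 2 := (sq_abs _).symm
    _ ≤ (√r * √s₁ + √q * √s₂) ^ 2 := by
      gcongr
      exact (abs_add_le _ _).trans (add_le_add h1 h2)
    _ ≤ (√r ^ 2 + √q ^ 2) * (√s₁ ^ 2 + √s₂ ^ 2) := by
      nlinarith [sq_nonneg (√r * √s₂ - √q * √s₁)]
    _ = s₁ + s₂ := by rw [e1, e2, e3, e4, hrq, one_mul]

/-- Expand (1 + X)⁻² = ∑ (n + 1)(-X)^n, where |X| ≤ √(s₁ + s₂) < 1 by Cauchy-Schwarz. Odd moments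
vanish, and the even ones are dominated by the geometric series of s₁ + s₂. -/
theorem two_angle_average_le {r q s₁ s₂ β γ : ℝ} (hr : 1 / 3 ≤ r) (hq : 1 / 3 ≤ q)
    (hrq : r + q = 1) (hs₁ : 0 ≤ s₁) (hs₂ : 0 ≤ s₂) (hβ : β ^ 2 = r * s₁) (hγ : γ ^ 2 = q * s₂)
    (hs : s₁ + s₂ < 1) :
    ∫ t in (0 : ℝ)..1, ∫ s in (0 : ℝ)..1,
      ((1 + (β * Real.cos (2 * Real.pi * t) + γ * Real.cos (2 * Real.pi * s))) ^ 2)⁻¹ ≤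
    (1 - (s₁ + s₂))⁻¹ := by
  set ρ := √(s₁ + s₂)
  have hρ0 : 0 ≤ ρ := Real.sqrt_nonneg _
  have hρ1 : ρ < 1 := by
    rw [Real.sqrt_lt' one_pos]; simpa using hs
  have hX (t s : ℝ) :
      |β * Real.cos (2 * Real.pi * t) + γ * Real.cos (2 * Real.pi * s)| ≤ ρ := by
    apply abs_le_sqrt_of_mul_self_le (by linarith) (by linarith) hrq hs₁ hs₂
    · rw [mul_pow, hβ]
      exact mul_le_of_le_one_right (by positivity) (Real.cos_sq_le_one _)
    · rw [mul_pow, hγ]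
      exact mul_le_of_le_one_right (by positivity) (Real.cos_sq_le_one _)
  have hsum : Summable fun n : ℕ => ((n : ℝ) + 1) * ρ ^ n := by
    have := (hasSum_inv_one_add_sq (x := -ρ) (by rwa [abs_neg, abs_of_nonneg hρ0])).summable
    simpa using this
  have hbound (n : ℕ) (t s : ℝ) : |((n : ℝ) + 1) * (-(β * Real.cos (2 * Real.pi * t) +
      γ * Real.cos (2 * Real.pi * s))) ^ n| ≤ ((n : ℝ) + 1) * ρ ^ n := by
    rw [abs_mul, abs_pow, abs_neg, abs_of_nonneg (by positivity : (0 : ℝ) ≤ n + 1)]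
    gcongr
    exact hX t s
  have hmain := hasSum_integral_unitInterval
    (f := fun n t => ∫ s in (0 : ℝ)..1, ((n : ℝ) + 1) * (-(β * Real.cos (2 * Real.pi * t) +
      γ * Real.cos (2 * Real.pi * s))) ^ n) (b := fun n => ((n : ℝ) + 1) * ρ ^ n)
    (g := fun t => ∫ s in (0 : ℝ)..1,
      ((1 + (β * Real.cos (2 * Real.pi * t) + γ * Real.cos (2 * Real.pi * s))) ^ 2)⁻¹)
    (fun n => intervalIntegral.continuous_parametric_intervalIntegral_of_continuous'
      (by fun_prop) _ _)
    (fun n t => by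
      have := intervalIntegral.norm_integral_le_of_norm_le_const (a := 0) (b := 1)
        (f := fun s => ((n : ℝ) + 1) * (-(β * Real.cos (2 * Real.pi * t) +
          γ * Real.cos (2 * Real.pi * s))) ^ n) (C := ((n : ℝ) + 1) * ρ ^ n)
        (fun s _ => hbound n t s)
      simpa using this)
    hsum
    (fun t => hasSum_integral_unitInterval (fun n => by fun_prop) (fun n s => hbound n t s) hsum
      (fun s => hasSum_inv_one_add_sq ((hX t s).trans_lt hρ1)))
  have heven := (Function.Injective.hasSum_iff (g := fun k : ℕ => 2 * k)
    (fun a b h => by simpa using h) (f := fun n : ℕ => ∫ t in (0 : ℝ)..1, ∫ s in (0 : ℝ)..1,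
      ((n : ℝ) + 1) * (-(β * Real.cos (2 * Real.pi * t) +
        γ * Real.cos (2 * Real.pi * s))) ^ n) (by
      intro n hn
      obtain ⟨k, rfl | rfl⟩ := Nat.even_or_odd' n
      · exact absurd ⟨k, rfl⟩ hn
      · simp only [intervalIntegral.integral_const_mul, Odd.neg_pow (odd_two_mul_add_one k),
          intervalIntegral.integral_neg, integral_integral_add_pow_odd]
        simp)).2 hmain
  have hgeo := hasSum_geometric_of_lt_one (by positivity : 0 ≤ s₁ + s₂) hs
  refine hasSum_le (fun k => ?_) heven hgeo
  have := integral_integral_add_pow_even_le hr hq hrq hs₁ hs₂ hβ hγ k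
  simpa only [Function.comp_apply, intervalIntegral.integral_const_mul,
    Even.neg_pow (even_two_mul k), Nat.cast_mul, Nat.cast_ofNat] using this

/-- A combination of cosine and sine is a shifted cosine, and the shift disappears over a full
period. -/
theorem integral_comp_cos_sin (h : ℝ → ℝ) (C D : ℝ) :
    ∫ s in (0 : ℝ)..1, h (C * Real.cos (2 * Real.pi * s) + D * Real.sin (2 * Real.pi * s)) =
      ∫ s in (0 : ℝ)..1, h (√(C ^ 2 + D ^ 2) * Real.cos (2 * Real.pi * s)) := by
  obtain ⟨χ, hC, hD⟩ : ∃ χ, C = √(C ^ 2 + D ^ 2) * Real.cos χ ∧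
      D = √(C ^ 2 + D ^ 2) * Real.sin χ := by
    refine ⟨Complex.arg ⟨C, D⟩, ?_, ?_⟩
    · have := Complex.norm_mul_cos_arg ⟨C, D⟩
      rw [Complex.norm_eq_sqrt_sq_add_sq] at this
      exact this.symm
    · have := Complex.norm_mul_sin_arg ⟨C, D⟩
      rw [Complex.norm_eq_sqrt_sq_add_sq] at this
      exact this.symm
  set R := √(C ^ 2 + D ^ 2)
  have hper : Function.Periodic (fun s : ℝ => h (R * Real.cos (2 * Real.pi * s))) 1 := by
    intro s
    simp [mul_add]
  have h1 (s : ℝ) : C * Real.cos (2 * Real.pi * s) + D * Real.sin (2 * Real.pi * s) =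
      R * Real.cos (2 * Real.pi * (s - χ / (2 * Real.pi))) := by
    rw [mul_sub, mul_div_cancel₀ _ Real.two_pi_pos.ne', Real.cos_sub]
    rw [hC, hD]
    ring
  simp_rw [h1]
  rw [intervalIntegral.integral_comp_sub_right
    (fun s => h (R * Real.cos (2 * Real.pi * s)))]
  have := hper.intervalIntegral_add_eq (0 - χ / (2 * Real.pi)) 0
  rw [zero_add] at this
  rw [← this]
  congr 1
  ring

/-- P + R cos is a convex combination of P + R' cos and P - R' cos, which have equal averages after
inversion and squaring; x ↦ x⁻² is convex on the positive axis. -/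
theorem average_inv_sq_mono {P R R' : ℝ} (hR : 0 ≤ R) (hRR' : R ≤ R') (hP : R' < P) :
    ∫ s in (0 : ℝ)..1, ((P + R * Real.cos (2 * Real.pi * s)) ^ 2)⁻¹ ≤
      ∫ s in (0 : ℝ)..1, ((P + R' * Real.cos (2 * Real.pi * s)) ^ 2)⁻¹ := by
  rcases hR.trans hRR' |>.eq_or_lt with h0 | h0
  · have : R = R' := by linarith
    rw [this]
  have hpos (a : ℝ) (ha : |a| ≤ R') (s : ℝ) : 0 < P + a * Real.cos (2 * Real.pi * s) := by
    have h1 := Real.abs_cos_le_one (2 * Real.pi * s)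
    have h2 : |a * Real.cos (2 * Real.pi * s)| ≤ R' := by
      rw [abs_mul]
      calc _ ≤ R' * 1 := by gcongr
        _ = _ := mul_one _
    linarith [neg_abs_le (a * Real.cos (2 * Real.pi * s))]
  have hcont (a : ℝ) (ha : |a| ≤ R') :
      Continuous fun s : ℝ => ((P + a * Real.cos (2 * Real.pi * s)) ^ 2)⁻¹ :=
    Continuous.inv₀ (by fun_prop) fun s => (pow_pos (hpos a ha s) 2).ne'
  have a1 : |R| ≤ R' := by rwa [abs_of_nonneg hR]
  have a2 : |R'| ≤ R' := by rw [abs_of_pos h0]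
  have a3 : |-R'| ≤ R' := by rw [abs_neg, abs_of_pos h0]
  have hneg : ∫ s in (0 : ℝ)..1, ((P + -R' * Real.cos (2 * Real.pi * s)) ^ 2)⁻¹ =
      ∫ s in (0 : ℝ)..1, ((P + R' * Real.cos (2 * Real.pi * s)) ^ 2)⁻¹ := by
    have := integral_comp_cos_sin (fun x => ((P + x) ^ 2)⁻¹) (-R') 0
    simpa [Real.sqrt_sq h0.le] using this
  set l := (R + R') / (2 * R') with hl
  have hl0 : 0 ≤ l := by positivity
  have hl1 : l ≤ 1 := by rw [hl, div_le_one (by positivity)]; linarith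
  calc _ ≤ ∫ s in (0 : ℝ)..1, (l * ((P + R' * Real.cos (2 * Real.pi * s)) ^ 2)⁻¹ +
        (1 - l) * ((P + -R' * Real.cos (2 * Real.pi * s)) ^ 2)⁻¹) := by
        refine intervalIntegral.integral_mono_on zero_le_one
          ((hcont _ a1).intervalIntegrable _ _)
          (((hcont _ a2).const_mul _ |>.add ((hcont _ a3).const_mul _)).intervalIntegrable _ _)
          fun s _ => ?_
        have := (convexOn_zpow (𝕜 := ℝ) (-2)).2 (hpos _ a2 s) (hpos _ a3 s) hl0
          (sub_nonneg.2 hl1) (by ring)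
        have e (x : ℝ) : x ^ (-2 : ℤ) = (x ^ 2)⁻¹ := by
          rw [zpow_neg]; norm_cast
        simp only [e, smul_eq_mul] at this
        have e2 : l * (P + R' * Real.cos (2 * Real.pi * s)) +
            (1 - l) * (P + -R' * Real.cos (2 * Real.pi * s)) =
            P + R * Real.cos (2 * Real.pi * s) := by
          rw [hl]; field_simp; ring
        rwa [e2] at this
    _ = _ := by
      rw [intervalIntegral.integral_add (((hcont _ a2).const_mul _).intervalIntegrable _ _)
        (((hcont _ a3).const_mul _).intervalIntegrable _ _),
        intervalIntegral.integral_const_mul, intervalIntegral.integral_const_mul, hneg]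
      ring

theorem continuous_average_inv_sq {P : ℝ → ℝ} {X : ℝ → ℝ → ℝ} (hP : Continuous P)
    (hX : Continuous (Function.uncurry X)) (h : ∀ t s, 0 < P t + X t s) :
    Continuous fun t => ∫ s in (0 : ℝ)..1, ((P t + X t s) ^ 2)⁻¹ := by
  apply intervalIntegral.continuous_parametric_intervalIntegral_of_continuous'
  refine Continuous.inv₀ ?_ fun p => (pow_pos (h p.1 p.2) 2).ne'
  exact ((hP.comp continuous_fst).add hX).pow 2

/-- For fixed t, the last two waves combine into a single wave in s. Replacing its amplitude by the
largest possible one, γ, increases the average and removes the coupling through s + t, so that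
`two_angle_average_le` applies with weights p₁ and p₂ + p₃. -/
theorem three_angle_average_le {p₁ p₂ p₃ : ℝ} (h₁ : 1 / 3 ≤ p₁) (h₁' : p₁ ≤ 2 / 3)
    (h₂ : 0 ≤ p₂) (h₃ : 0 ≤ p₃) (hp : p₁ + p₂ + p₃ = 1) (a₁ b₁ a₂ b₂ a₃ b₃ : ℝ)
    (hS : (a₁ ^ 2 + b₁ ^ 2) + (a₂ ^ 2 + b₂ ^ 2 + a₃ ^ 2 + b₃ ^ 2) < 1) :
    ∫ t in (0 : ℝ)..1, ∫ s in (0 : ℝ)..1,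
      ((1 + (√p₁ * (a₁ * Real.cos (2 * Real.pi * t) + b₁ * Real.sin (2 * Real.pi * t)) +
        √p₂ * (a₂ * Real.cos (2 * Real.pi * s) + b₂ * Real.sin (2 * Real.pi * s)) +
        √p₃ * (a₃ * Real.cos (2 * Real.pi * (s + t)) + b₃ * Real.sin (2 * Real.pi * (s + t)))))
          ^ 2)⁻¹ ≤
    (1 - ((a₁ ^ 2 + b₁ ^ 2) + (a₂ ^ 2 + b₂ ^ 2 + a₃ ^ 2 + b₃ ^ 2)))⁻¹ := by
  set s₁ := a₁ ^ 2 + b₁ ^ 2 with hs₁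
  set s₂ := a₂ ^ 2 + b₂ ^ 2 + a₃ ^ 2 + b₃ ^ 2 with hs₂
  have hs₁0 : 0 ≤ s₁ := by positivity
  have hs₂0 : 0 ≤ s₂ := by positivity
  have e1 := Real.sq_sqrt (by linarith : 0 ≤ p₁)
  have e2 := Real.sq_sqrt h₂
  have e3 := Real.sq_sqrt h₃
  have hq0 : 0 ≤ p₂ + p₃ := by linarith
  set γ := √((p₂ + p₃) * s₂) with hγ
  have hγ0 : 0 ≤ γ := Real.sqrt_nonneg _
  have hγ2 : γ ^ 2 = (p₂ + p₃) * s₂ := Real.sq_sqrt (by positivity)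
  set P : ℝ → ℝ := fun x => 1 + √p₁ * x with hP
  have hρ1 : √(s₁ + s₂) < 1 := by rw [Real.sqrt_lt' one_pos]; simpa using hS
  -- Cauchy-Schwarz with the weights p₁ and p₂ + p₃: enlarging the amplitude to γ keeps the
  -- denominators positive.
  have hPγ (x : ℝ) (hx : x ^ 2 ≤ s₁) : γ < P x := by
    have := abs_le_sqrt_of_mul_self_le (x := √p₁ * x) (y := -γ) (by linarith : 0 ≤ p₁) hq0
      (by linarith) hs₁0 hs₂0 (by rw [mul_pow, e1]; gcongr) (by rw [neg_sq, hγ2])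
    have h2 := (abs_le.1 (this.trans hρ1.le)).1
    have h3 := (abs_lt.1 (this.trans_lt hρ1)).1
    simp only [hP]; linarith
  have hcs (t : ℝ) : (a₁ * Real.cos (2 * Real.pi * t) + b₁ * Real.sin (2 * Real.pi * t)) ^ 2 ≤
      s₁ := by
    have := Real.sin_sq_add_cos_sq (2 * Real.pi * t)
    calc _ ≤ (a₁ ^ 2 + b₁ ^ 2) * (Real.sin (2 * Real.pi * t) ^ 2 +
        Real.cos (2 * Real.pi * t) ^ 2) := by
          nlinarith [sq_nonneg (a₁ * Real.sin (2 * Real.pi * t) - b₁ * Real.cos (2 * Real.pi * t))]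
      _ = s₁ := by rw [this, mul_one]
  -- R is the length of √p₂ (a₂, b₂) plus √p₃ times (a₃, b₃) rotated by the angle 2πt.
  -- Cauchy-Schwarz bounds it by γ independently of t.
  have hfib (t : ℝ) : ∃ R, 0 ≤ R ∧ R ≤ γ ∧ ∀ h : ℝ → ℝ, ∫ s in (0 : ℝ)..1,
      h (√p₂ * (a₂ * Real.cos (2 * Real.pi * s) + b₂ * Real.sin (2 * Real.pi * s)) +
        √p₃ * (a₃ * Real.cos (2 * Real.pi * (s + t)) + b₃ * Real.sin (2 * Real.pi * (s + t)))) =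
      ∫ s in (0 : ℝ)..1, h (R * Real.cos (2 * Real.pi * s)) := by
    set u := Real.cos (2 * Real.pi * t)
    set v := Real.sin (2 * Real.pi * t)
    have huv : v ^ 2 + u ^ 2 = 1 := Real.sin_sq_add_cos_sq (2 * Real.pi * t)
    refine ⟨√((√p₂ * a₂ + √p₃ * (a₃ * u + b₃ * v)) ^ 2 +
      (√p₂ * b₂ + √p₃ * (b₃ * u - a₃ * v)) ^ 2), Real.sqrt_nonneg _, ?_, fun h => ?_⟩
    · apply Real.sqrt_le_sqrt
      have h4 : (a₃ * u + b₃ * v) ^ 2 + (b₃ * u - a₃ * v) ^ 2 = a₃ ^ 2 + b₃ ^ 2 := by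
        linear_combination (a₃ ^ 2 + b₃ ^ 2) * huv
      have h5 : s₂ = a₂ ^ 2 + b₂ ^ 2 + ((a₃ * u + b₃ * v) ^ 2 + (b₃ * u - a₃ * v) ^ 2) := by
        rw [h4]; ring
      rw [h5]
      conv_rhs => rw [← e2, ← e3]
      nlinarith [sq_nonneg (√p₃ * a₂ - √p₂ * (a₃ * u + b₃ * v)),
        sq_nonneg (√p₃ * b₂ - √p₂ * (b₃ * u - a₃ * v))]
    · rw [← integral_comp_cos_sin]
      congr 1
      ext s
      congr 1
      rw [show 2 * Real.pi * (s + t) = 2 * Real.pi * s + 2 * Real.pi * t by ring,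
        Real.cos_add, Real.sin_add]
      ring
  have hleft : ∀ t : ℝ, ∫ s in (0 : ℝ)..1,
      ((1 + (√p₁ * (a₁ * Real.cos (2 * Real.pi * t) + b₁ * Real.sin (2 * Real.pi * t)) +
        √p₂ * (a₂ * Real.cos (2 * Real.pi * s) + b₂ * Real.sin (2 * Real.pi * s)) +
        √p₃ * (a₃ * Real.cos (2 * Real.pi * (s + t)) + b₃ * Real.sin (2 * Real.pi * (s + t)))))
          ^ 2)⁻¹ ≤ ∫ s in (0 : ℝ)..1, ((P (a₁ * Real.cos (2 * Real.pi * t) +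
            b₁ * Real.sin (2 * Real.pi * t)) + γ * Real.cos (2 * Real.pi * s)) ^ 2)⁻¹ := by
    intro t
    obtain ⟨R, hR0, hRγ, hR⟩ := hfib t
    have := hR fun x => ((P (a₁ * Real.cos (2 * Real.pi * t) +
      b₁ * Real.sin (2 * Real.pi * t)) + x) ^ 2)⁻¹
    simp only [hP, ← add_assoc] at this ⊢
    rw [this]
    exact average_inv_sq_mono hR0 hRγ (hPγ _ (hcs t))
  have hposl (t s : ℝ) : 0 < P (a₁ * Real.cos (2 * Real.pi * t) +
      b₁ * Real.sin (2 * Real.pi * t)) + γ * Real.cos (2 * Real.pi * s) := by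
    have h1 := hPγ _ (hcs t)
    have h2 := mul_le_mul_of_nonneg_left (Real.neg_one_le_cos (2 * Real.pi * s)) hγ0
    linarith
  -- A non-integrable function has integral 0 by convention, and the right side is nonnegative; so
  -- integrability need not be proved.
  by_cases hint : IntervalIntegrable (fun t => ∫ s in (0 : ℝ)..1,
      ((1 + (√p₁ * (a₁ * Real.cos (2 * Real.pi * t) + b₁ * Real.sin (2 * Real.pi * t)) +
        √p₂ * (a₂ * Real.cos (2 * Real.pi * s) + b₂ * Real.sin (2 * Real.pi * s)) +
        √p₃ * (a₃ * Real.cos (2 * Real.pi * (s + t)) + b₃ * Real.sin (2 * Real.pi * (s + t)))))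
          ^ 2)⁻¹) MeasureTheory.volume 0 1
  swap
  · rw [intervalIntegral.integral_undef hint]
    exact inv_nonneg.2 (by linarith)
  calc _ ≤ ∫ t in (0 : ℝ)..1, ∫ s in (0 : ℝ)..1, ((P (a₁ * Real.cos (2 * Real.pi * t) +
            b₁ * Real.sin (2 * Real.pi * t)) + γ * Real.cos (2 * Real.pi * s)) ^ 2)⁻¹ := by
        refine intervalIntegral.integral_mono_on zero_le_one hint ?_ fun t _ => hleft t
        exact (continuous_average_inv_sq (by fun_prop) (by fun_prop) hposl).intervalIntegrable _ _
    _ = ∫ t in (0 : ℝ)..1, ∫ s in (0 : ℝ)..1, ((P (√s₁ * Real.cos (2 * Real.pi * t)) +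
          γ * Real.cos (2 * Real.pi * s)) ^ 2)⁻¹ :=
        integral_comp_cos_sin (fun x => ∫ s in (0 : ℝ)..1,
          ((P x + γ * Real.cos (2 * Real.pi * s)) ^ 2)⁻¹) a₁ b₁
    _ ≤ _ := by
        have := two_angle_average_le (r := p₁) (q := p₂ + p₃) (s₁ := s₁) (s₂ := s₂)
          (β := √p₁ * √s₁) (γ := γ) h₁ (by linarith) (by linarith) hs₁0 hs₂0
          (by rw [mul_pow, e1, Real.sq_sqrt hs₁0]) hγ2 hS
        simpa only [hP, mul_assoc, add_assoc] using this

/-! ### A Poincaré inequality on the hexagonal torus -/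

/-- The character `x ↦ e^{-2πi n x}`. -/
noncomputable def negChar (n : ℤ) (x : ℝ) : ℂ := Complex.exp (-(2 * Real.pi * Complex.I * n * x))

theorem continuous_negChar (n : ℤ) : Continuous (negChar n) := by
  unfold negChar; fun_prop

theorem hasDerivAt_negChar (n : ℤ) (x : ℝ) :
    HasDerivAt (negChar n) (-(2 * Real.pi * Complex.I * n) * negChar n x) x := by
  have h : HasDerivAt (fun x : ℝ => -(2 * Real.pi * Complex.I * n * (x : ℂ)))
      (-(2 * Real.pi * Complex.I * n * 1)) x :=
    ((Complex.ofRealCLM.hasDerivAt (x := x)).const_mul _).neg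
  refine HasDerivAt.congr_deriv (f := negChar n) h.cexp ?_
  simp only [negChar]; ring

theorem negChar_zero_right (n : ℤ) : negChar n 0 = 1 := by simp [negChar]

theorem negChar_one_right (n : ℤ) : negChar n 1 = 1 := by
  have := Complex.exp_int_mul_two_pi_mul_I (-n)
  rw [negChar, ← this]
  congr 1; push_cast; ring

theorem integral_negChar_mul_deriv {f f' : ℝ → ℂ} (hf : ∀ x, HasDerivAt f (f' x) x)
    (hf' : Continuous f') (h01 : f 1 = f 0) (n : ℤ) :
    ∫ x in (0 : ℝ)..1, negChar n x * f' x =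
      2 * Real.pi * Complex.I * n * ∫ x in (0 : ℝ)..1, negChar n x * f x := by
  rw [intervalIntegral.integral_mul_deriv_eq_deriv_mul (fun x _ => hasDerivAt_negChar n x)
    (fun x _ => hf x) ((continuous_const.mul (continuous_negChar n)).intervalIntegrable _ _)
    (hf'.intervalIntegrable _ _), ← intervalIntegral.integral_const_mul, negChar_one_right,
    negChar_zero_right, h01, sub_self, zero_sub, ← intervalIntegral.integral_neg]
  congr 1; ext x; ring

/-- Parseval's identity, stated in `ℝ≥0∞` so that iterating it over two variables needs no
summability argument. -/
theorem tsum_enorm_sq_integral_negChar_mul {f : ℝ → ℂ} (hf : Continuous f) :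
    ∑' n : ℤ, ‖∫ x in (0 : ℝ)..1, negChar n x * f x‖ₑ ^ 2 =
      ∫⁻ x in Set.Ioc (0 : ℝ) 1, ‖f x‖ₑ ^ 2 := by
  have hL2 : MeasureTheory.MemLp f 2 (MeasureTheory.volume.restrict (Set.Ioc (0 : ℝ) 1)) := by
    obtain ⟨C, hC⟩ := (isCompact_Icc (a := (0 : ℝ)) (b := 1)).exists_bound_of_continuousOn
      hf.continuousOn
    refine MeasureTheory.MemLp.of_bound hf.aestronglyMeasurable C ?_
    filter_upwards [MeasureTheory.ae_restrict_mem measurableSet_Ioc] with x hx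
    exact hC x ⟨hx.1.le, hx.2⟩
  have h := hasSum_sq_fourierCoeffOn zero_lt_one hL2
  have hc (n : ℤ) : fourierCoeffOn zero_lt_one f n = ∫ x in (0 : ℝ)..1, negChar n x * f x := by
    rw [fourierCoeffOn_eq_integral]
    simp only [sub_zero, div_one, one_smul, smul_eq_mul]
    congr 1; ext x
    rw [fourier_coe_apply, negChar]
    congr 2; push_cast; ring
  simp only [hc, sub_zero, inv_one, one_smul] at h
  have e (z : ℂ) : ‖z‖ₑ ^ 2 = ENNReal.ofReal (‖z‖ ^ 2) := by
    rw [ENNReal.ofReal_pow (norm_nonneg _), ofReal_norm]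
  simp_rw [e]
  rw [← ENNReal.ofReal_tsum_of_nonneg (fun n => by positivity) h.summable, h.tsum_eq,
    intervalIntegral.integral_of_le zero_le_one,
    ← MeasureTheory.ofReal_integral_eq_lintegral_ofReal]
  · exact ((hf.norm.pow 2).integrableOn_Icc (a := 0) (b := 1)).mono_set Set.Ioc_subset_Icc_self
  · exact .of_forall fun x => by positivity

theorem integral_unitSquare_swap {F : ℝ → ℝ → ℂ} (hF : Continuous (Function.uncurry F)) :
    ∫ t in (0 : ℝ)..1, ∫ s in (0 : ℝ)..1, F s t = ∫ s in (0 : ℝ)..1, ∫ t in (0 : ℝ)..1, F s t := by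
  simp_rw [intervalIntegral.integral_of_le (zero_le_one (α := ℝ))]
  refine MeasureTheory.integral_integral_swap ?_
  rw [MeasureTheory.Measure.prod_restrict]
  have : Continuous (Function.uncurry fun t s => F s t) := hF.comp continuous_swap
  exact (this.continuousOn.integrableOn_compact (isCompact_Icc.prod isCompact_Icc)).mono_set
    (Set.prod_mono Set.Ioc_subset_Icc_self Set.Ioc_subset_Icc_self)

/-- The Fourier coefficients of a function on the square `[0,1]²`. -/
noncomputable def squareCoeff (g : ℝ → ℝ → ℂ) (n m : ℤ) : ℂ :=
  ∫ t in (0 : ℝ)..1, negChar m t * ∫ s in (0 : ℝ)..1, negChar n s * g s t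

theorem continuous_integral_negChar_mul {g : ℝ → ℝ → ℂ} (hg : Continuous (Function.uncurry g))
    (n : ℤ) : Continuous fun t => ∫ s in (0 : ℝ)..1, negChar n s * g s t := by
  apply intervalIntegral.continuous_parametric_intervalIntegral_of_continuous'
  exact ((continuous_negChar n).comp continuous_snd).mul (hg.comp continuous_swap)

theorem squareCoeff_swap {g : ℝ → ℝ → ℂ} (hg : Continuous (Function.uncurry g)) (n m : ℤ) :
    squareCoeff g n m = squareCoeff (fun s t => g t s) m n := by
  have h (g : ℝ → ℝ → ℂ) (n m : ℤ) : squareCoeff g n m =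
      ∫ t in (0 : ℝ)..1, ∫ s in (0 : ℝ)..1, negChar m t * (negChar n s * g s t) := by
    simp only [squareCoeff, intervalIntegral.integral_const_mul]
  rw [h, h, integral_unitSquare_swap]
  · congr 1; ext s; congr 1; ext t; ring
  · exact ((continuous_negChar m).comp continuous_snd).mul
      (((continuous_negChar n).comp continuous_fst).mul hg)

theorem tsum_enorm_sq_squareCoeff {g : ℝ → ℝ → ℂ} (hg : Continuous (Function.uncurry g)) :
    ∑' n : ℤ, ∑' m : ℤ, ‖squareCoeff g n m‖ₑ ^ 2 =
      ∫⁻ t in Set.Ioc (0 : ℝ) 1, ∫⁻ s in Set.Ioc (0 : ℝ) 1, ‖g s t‖ₑ ^ 2 := by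
  simp_rw [squareCoeff,
    tsum_enorm_sq_integral_negChar_mul (continuous_integral_negChar_mul hg _)]
  rw [← MeasureTheory.lintegral_tsum]
  · congr 1; ext t
    exact tsum_enorm_sq_integral_negChar_mul (f := fun s => g s t)
      (hg.comp (continuous_id.prodMk continuous_const))
  · intro n
    exact ((continuous_integral_negChar_mul hg n).enorm.measurable.pow_const 2).aemeasurable

theorem squareCoeff_deriv_left {g g' : ℝ → ℝ → ℂ}
    (hg : ∀ s t, HasDerivAt (fun s => g s t) (g' s t) s)
    (hg' : Continuous (Function.uncurry g')) (h01 : ∀ t, g 1 t = g 0 t) (n m : ℤ) :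
    squareCoeff g' n m = 2 * Real.pi * Complex.I * n * squareCoeff g n m := by
  have h (t : ℝ) := integral_negChar_mul_deriv (hg · t)
    (hg'.comp (continuous_id.prodMk continuous_const)) (h01 t) n
  unfold squareCoeff
  simp_rw [h]
  rw [← intervalIntegral.integral_const_mul]
  congr 1; ext t; ring

theorem squareCoeff_sub {g h : ℝ → ℝ → ℂ} (hg : Continuous (Function.uncurry g))
    (hh : Continuous (Function.uncurry h)) (n m : ℤ) :
    squareCoeff (fun s t => g s t - h s t) n m = squareCoeff g n m - squareCoeff h n m := by
  have hi {g : ℝ → ℝ → ℂ} (hg : Continuous (Function.uncurry g)) (t : ℝ) :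
      IntervalIntegrable (fun s => negChar n s * g s t) MeasureTheory.volume 0 1 :=
    Continuous.intervalIntegrable ((continuous_negChar n).mul
      (hg.comp (continuous_id.prodMk continuous_const))) _ _
  simp only [squareCoeff, mul_sub]
  rw [← intervalIntegral.integral_sub]
  · congr 1; ext t
    rw [intervalIntegral.integral_sub (hi hg t) (hi hh t), mul_sub]
  · exact ((continuous_negChar m).mul (continuous_integral_negChar_mul hg n)).intervalIntegrable _ _
  · exact ((continuous_negChar m).mul (continuous_integral_negChar_mul hh n)).intervalIntegrable _ _

/-- By Parseval in both variables, the frequency (n, m) enters the energy with weight 4π²(n² + m² +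
(n - m)²). The zero frequency is absent by the mean condition, and at all others the weight is at
least 8π². -/
theorem hexagonal_poincare {g g₁ g₂ : ℝ → ℝ → ℂ} (hg : Continuous (Function.uncurry g))
    (hg₁ : Continuous (Function.uncurry g₁)) (hg₂ : Continuous (Function.uncurry g₂))
    (hd₁ : ∀ s t, HasDerivAt (fun s => g s t) (g₁ s t) s)
    (hd₂ : ∀ s t, HasDerivAt (fun t => g s t) (g₂ s t) t)
    (hp₁ : ∀ t, g 1 t = g 0 t) (hp₂ : ∀ s, g s 1 = g s 0)
    (hmean : ∫ t in (0 : ℝ)..1, ∫ s in (0 : ℝ)..1, g s t = 0) :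
    ENNReal.ofReal (8 * Real.pi ^ 2) *
        ∫⁻ t in Set.Ioc (0 : ℝ) 1, ∫⁻ s in Set.Ioc (0 : ℝ) 1, ‖g s t‖ₑ ^ 2 ≤
      ∫⁻ t in Set.Ioc (0 : ℝ) 1, ∫⁻ s in Set.Ioc (0 : ℝ) 1,
        (‖g₁ s t‖ₑ ^ 2 + ‖g₂ s t‖ₑ ^ 2 + ‖g₁ s t - g₂ s t‖ₑ ^ 2) := by
  have hm {h : ℝ → ℝ → ℂ} (hh : Continuous (Function.uncurry h)) :
      Measurable fun p : ℝ × ℝ => ‖h p.2 p.1‖ₑ ^ 2 :=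
    (hh.comp continuous_swap).enorm.measurable.pow_const 2
  have hm1 {h : ℝ → ℝ → ℂ} (hh : Continuous (Function.uncurry h)) (t : ℝ) :
      Measurable fun s : ℝ => ‖h s t‖ₑ ^ 2 :=
    (hm hh).comp (measurable_const.prodMk measurable_id)
  have hm2 {h : ℝ → ℝ → ℂ} (hh : Continuous (Function.uncurry h)) :
      Measurable fun t : ℝ => ∫⁻ s in Set.Ioc (0 : ℝ) 1, ‖h s t‖ₑ ^ 2 :=
    (hm hh).lintegral_prod_right'
  have hg₁₂ : Continuous (Function.uncurry fun s t => g₁ s t - g₂ s t) := hg₁.sub hg₂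
  have hrhs : ∫⁻ t in Set.Ioc (0 : ℝ) 1, ∫⁻ s in Set.Ioc (0 : ℝ) 1,
        (‖g₁ s t‖ₑ ^ 2 + ‖g₂ s t‖ₑ ^ 2 + ‖g₁ s t - g₂ s t‖ₑ ^ 2) =
      (∫⁻ t in Set.Ioc (0 : ℝ) 1, ∫⁻ s in Set.Ioc (0 : ℝ) 1, ‖g₁ s t‖ₑ ^ 2) +
      (∫⁻ t in Set.Ioc (0 : ℝ) 1, ∫⁻ s in Set.Ioc (0 : ℝ) 1, ‖g₂ s t‖ₑ ^ 2) +
      ∫⁻ t in Set.Ioc (0 : ℝ) 1, ∫⁻ s in Set.Ioc (0 : ℝ) 1, ‖g₁ s t - g₂ s t‖ₑ ^ 2 := by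
    rw [← MeasureTheory.lintegral_add_left (hm2 hg₁),
      ← MeasureTheory.lintegral_add_right _ (hm2 hg₁₂)]
    congr 1; ext t
    rw [← MeasureTheory.lintegral_add_left (hm1 hg₁ t),
      ← MeasureTheory.lintegral_add_right _ (hm1 hg₁₂ t)]
  have hc₁ (n m : ℤ) := squareCoeff_deriv_left hd₁ hg₁ hp₁ n m
  have hc₂ (n m : ℤ) : squareCoeff g₂ n m = 2 * Real.pi * Complex.I * m * squareCoeff g n m := by
    rw [squareCoeff_swap hg₂, squareCoeff_swap hg]
    exact squareCoeff_deriv_left (g := fun s t => g t s) (g' := fun s t => g₂ t s)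
      (fun s t => hd₂ t s) (hg₂.comp continuous_swap) hp₂ m n
  rw [hrhs, ← tsum_enorm_sq_squareCoeff hg, ← tsum_enorm_sq_squareCoeff hg₁,
    ← tsum_enorm_sq_squareCoeff hg₂, ← tsum_enorm_sq_squareCoeff hg₁₂, ← ENNReal.tsum_add,
    ← ENNReal.tsum_add, ← ENNReal.tsum_mul_left]
  refine ENNReal.tsum_le_tsum fun n => ?_
  rw [← ENNReal.tsum_add, ← ENNReal.tsum_add, ← ENNReal.tsum_mul_left]
  refine ENNReal.tsum_le_tsum fun m => ?_
  rw [squareCoeff_sub hg₁ hg₂, hc₁, hc₂, ← sub_mul]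
  have e (z : ℂ) : ‖z‖ₑ ^ 2 = ENNReal.ofReal (‖z‖ ^ 2) := by
    rw [ENNReal.ofReal_pow (norm_nonneg _), ofReal_norm]
  simp only [e]
  rw [← ENNReal.ofReal_add (by positivity) (by positivity),
    ← ENNReal.ofReal_add (by positivity) (by positivity), ← ENNReal.ofReal_mul (by positivity)]
  apply ENNReal.ofReal_le_ofReal
  rcases eq_or_ne (squareCoeff g n m) 0 with h0 | h0
  · simp [h0]
  have hnm : (n, m) ≠ (0, 0) := by
    intro hnm
    obtain ⟨rfl, rfl⟩ := Prod.mk.inj hnm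
    apply h0
    simpa [squareCoeff, negChar] using hmean
  -- The minimum 2 is attained exactly at ±(1,0), ±(0,1), ±(1,1), the shortest vectors of the
  -- hexagonal lattice.
  have hint : 2 ≤ n ^ 2 + m ^ 2 + (n - m) ^ 2 := by
    by_contra hlt
    apply hnm
    rcases eq_or_ne n 0 with rfl | hn
    · rcases eq_or_ne m 0 with rfl | hm
      · rfl
      · have := Int.one_le_abs hm
        nlinarith [sq_abs m]
    · have hn' := Int.one_le_abs hn
      rcases eq_or_ne m 0 with rfl | hm
      · nlinarith [sq_abs n]
      · have := Int.one_le_abs hm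
        nlinarith [sq_abs n, sq_abs m, sq_nonneg (n - m)]
  have hreal : (2 : ℝ) ≤ n ^ 2 + m ^ 2 + (n - m) ^ 2 := by exact_mod_cast hint
  rw [← mul_sub]
  simp only [norm_mul, Complex.norm_I, Complex.norm_intCast, Complex.norm_real, Complex.norm_ofNat,
    mul_pow, ← Int.cast_sub, sq_abs, Real.norm_eq_abs]
  push_cast
  have hz : 0 ≤ ‖squareCoeff g n m‖ ^ 2 := by positivity
  have hpi : 0 ≤ Real.pi ^ 2 := by positivity
  nlinarith [mul_le_mul_of_nonneg_left hreal (mul_nonneg hpi hz)]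

/-! ### Balancing a measure on the sphere by a conformal dilation -/

section Balance

open MeasureTheory

variable {E : Type*} [NormedAddCommGroup E]

theorem one_sub_norm_le_norm_sub {a p : E} (hp : ‖p‖ = 1) : 1 - ‖a‖ ≤ ‖p - a‖ := by
  rw [← hp]; exact norm_sub_norm_le p a

theorem sq_one_sub_norm_le {a p : E} (hp : ‖p‖ = 1) (ha : ‖a‖ < 1) :
    (1 - ‖a‖) ^ 2 ≤ ‖p - a‖ ^ 2 :=
  pow_le_pow_left₀ (by linarith) (one_sub_norm_le_norm_sub hp) 2

theorem norm_sub_sq_pos {a p : E} (hp : ‖p‖ = 1) (ha : ‖a‖ < 1) : 0 < ‖p - a‖ ^ 2 :=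
  lt_of_lt_of_le (pow_pos (by linarith) 2) (sq_one_sub_norm_le hp ha)

variable {Ω : Type*} [MeasurableSpace Ω] {μ : Measure Ω} {g : Ω → E}

theorem abs_log_norm_sub_sq_le {a p : E} {ρ : ℝ} (hp : ‖p‖ = 1) (ha : ‖a‖ ≤ ρ) (hρ : ρ < 1) :
    |Real.log (‖p - a‖ ^ 2)| ≤ Real.log 4 - Real.log ((1 - ρ) ^ 2) := by
  have ha1 := ha.trans_lt hρ
  have h0 : 0 < (1 - ρ) ^ 2 := pow_pos (by linarith) 2
  have hρ0 : 0 ≤ ρ := (norm_nonneg a).trans ha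
  have h1 : (1 - ρ) ^ 2 ≤ ‖p - a‖ ^ 2 :=
    (pow_le_pow_left₀ (by linarith) (by linarith) 2).trans (sq_one_sub_norm_le hp ha1)
  have h2 : ‖p - a‖ ^ 2 ≤ 4 := by
    have : ‖p - a‖ ≤ 2 := (norm_sub_le p a).trans (by linarith)
    nlinarith [norm_nonneg (p - a)]
  have l1 := Real.log_le_log h0 h1
  have l2 := Real.log_le_log (norm_sub_sq_pos hp ha1) h2
  have l3 : Real.log ((1 - ρ) ^ 2) ≤ 0 := Real.log_nonpos h0.le (by nlinarith)
  have l4 : 0 ≤ Real.log 4 := Real.log_nonneg (by norm_num)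
  rw [abs_le]
  constructor <;> linarith

/-- The averaged Busemann function of the image of `μ` under `g : Ω → S(E)`. -/
noncomputable def busemann (μ : Measure Ω) (g : Ω → E) (a : E) : ℝ :=
  ∫ z, Real.log (‖g z - a‖ ^ 2) ∂μ - Real.log (1 - ‖a‖ ^ 2)

theorem busemann_zero (hg1 : ∀ z, ‖g z‖ = 1) : busemann μ g 0 = 0 := by
  simp [busemann, hg1]

variable [MeasurableSpace E] [BorelSpace E]

theorem aestronglyMeasurable_log_norm_sub_sq (hg : Measurable g) (a : E) :
    AEStronglyMeasurable (fun z => Real.log (‖g z - a‖ ^ 2)) μ :=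
  (Real.measurable_log.comp ((hg.sub_const a).norm.pow_const 2)).aestronglyMeasurable

theorem integrable_log_norm_sub_sq [IsProbabilityMeasure μ] (hg : Measurable g)
    (hg1 : ∀ z, ‖g z‖ = 1) {a : E} (ha : ‖a‖ < 1) :
    Integrable (fun z => Real.log (‖g z - a‖ ^ 2)) μ :=
  .of_bound (aestronglyMeasurable_log_norm_sub_sq hg a) _
    (.of_forall fun z => abs_log_norm_sub_sq_le (hg1 z) le_rfl ha)

theorem continuousOn_busemann [IsProbabilityMeasure μ] (hg : Measurable g)
    (hg1 : ∀ z, ‖g z‖ = 1) {ρ : ℝ} (hρ0 : 0 ≤ ρ) (hρ : ρ < 1) :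
    ContinuousOn (busemann μ g) (Metric.closedBall 0 ρ) := by
  refine ContinuousOn.sub ?_ ?_
  · refine continuousOn_of_dominated (bound := fun _ => Real.log 4 - Real.log ((1 - ρ) ^ 2))
      (fun a _ => aestronglyMeasurable_log_norm_sub_sq hg a)
      (fun a ha => .of_forall fun z =>
        abs_log_norm_sub_sq_le (hg1 z) (by simpa using ha) hρ)
      (integrable_const _) (.of_forall fun z => ?_)
    refine ContinuousOn.log (by fun_prop) fun a ha => ?_
    exact (norm_sub_sq_pos (hg1 z) ((by simpa using ha : ‖a‖ ≤ ρ).trans_lt hρ)).ne'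
  · refine ContinuousOn.log (by fun_prop) fun a ha => ?_
    have : ‖a‖ ≤ ρ := by simpa using ha
    nlinarith [norm_nonneg a]

/-- Away from p the logarithm is at least 2 log δ. Near p it is at least 2 log(1 - |a|), but on mass
at most 1/4, which costs only half of the divergent term -log(1 - |a|²). So the function still tends
to infinity at the boundary. -/
theorem busemann_lower_bound [IsProbabilityMeasure μ] (hg : Measurable g)
    (hg1 : ∀ z, ‖g z‖ = 1) {a p : E} (ha : ‖a‖ < 1) {δ : ℝ} (hδ : 0 < δ) (hδ1 : δ ≤ 1)
    (hap : ‖a - p‖ < δ) (hμ : μ.real {z | ‖g z - p‖ < 2 * δ} ≤ 1 / 4) :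
    2 * Real.log δ - Real.log 2 - Real.log (1 - ‖a‖) / 2 ≤ busemann μ g a := by
  set A := {z | ‖g z - p‖ < 2 * δ} with hA
  have hAm : MeasurableSet A := measurableSet_lt (hg.sub_const p).norm measurable_const
  have hl : Real.log (1 - ‖a‖) ≤ 0 := Real.log_nonpos (by linarith) (by linarith [norm_nonneg a])
  have hlδ : Real.log δ ≤ 0 := Real.log_nonpos hδ.le hδ1
  have hpt (z : Ω) : 2 * Real.log δ + A.indicator (fun _ => 2 * Real.log (1 - ‖a‖)) z ≤
      Real.log (‖g z - a‖ ^ 2) := by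
    rw [Real.log_pow]
    push_cast
    by_cases hz : z ∈ A
    · rw [Set.indicator_of_mem hz]
      have := Real.log_le_log (by linarith) (one_sub_norm_le_norm_sub (a := a) (hg1 z))
      linarith
    · rw [Set.indicator_of_notMem hz]
      have h1 : 2 * δ ≤ ‖g z - p‖ := not_lt.1 hz
      have h2 : ‖g z - p‖ ≤ ‖g z - a‖ + ‖a - p‖ := by
        simpa using norm_add_le (g z - a) (a - p)
      have := Real.log_le_log hδ (show δ ≤ ‖g z - a‖ by linarith)
      linarith
  have hint := integral_mono ((integrable_const (2 * Real.log δ)).add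
    ((integrable_const (2 * Real.log (1 - ‖a‖))).indicator hAm))
    (integrable_log_norm_sub_sq (μ := μ) hg hg1 ha) hpt
  simp only [Pi.add_apply] at hint
  rw [integral_add (integrable_const _) ((integrable_const _).indicator hAm),
    integral_indicator hAm] at hint
  simp only [integral_const, smul_eq_mul, probReal_univ, one_mul,
    measureReal_restrict_apply_univ] at hint
  have h1 : Real.log (1 - ‖a‖ ^ 2) ≤ Real.log (1 - ‖a‖) + Real.log 2 := by
    rw [← Real.log_mul (by linarith) two_ne_zero]
    apply Real.log_le_log <;> nlinarith [norm_nonneg a]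
  unfold busemann
  nlinarith

/-- Outer regularity of the image measure at a point of measure zero. -/
theorem exists_measure_ball_le [IsProbabilityMeasure μ] (hg : Measurable g)
    (hatom : ∀ p, μ {z | g z = p} = 0) (p : E) :
    ∃ δ, 0 < δ ∧ δ ≤ 1 ∧ μ.real {z | ‖g z - p‖ < 2 * δ} ≤ 1 / 4 := by
  have hν : (μ.map g) {p} < ENNReal.ofReal (1 / 4) := by
    rw [Measure.map_apply hg (measurableSet_singleton p)]
    refine lt_of_eq_of_lt (hatom p) (by simp)
  have := Measure.isProbabilityMeasure_map (μ := μ) hg.aemeasurable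
  obtain ⟨U, hpU, hU, hlt⟩ := Set.exists_isOpen_lt_of_lt _ _ hν
  obtain ⟨r, hr, hrU⟩ := Metric.isOpen_iff.1 hU p (hpU rfl)
  refine ⟨min 1 (r / 2), by positivity, min_le_left _ _, ?_⟩
  apply ENNReal.toReal_le_of_le_ofReal (by norm_num)
  refine le_trans (measure_mono ?_) ((Measure.map_apply hg hU.measurableSet).ge.trans hlt.le)
  intro z hz
  apply hrU
  rw [Metric.mem_ball, dist_eq_norm]
  have := min_le_right 1 (r / 2)
  simp only [Set.mem_ofPred_eq] at hz
  linarith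

variable [ProperSpace E]

/-- Otherwise a sequence tending to the sphere with nonpositive values would accumulate at some p,
against `busemann_lower_bound` at p. -/
theorem exists_busemann_pos_near_boundary [IsProbabilityMeasure μ] (hg : Measurable g)
    (hg1 : ∀ z, ‖g z‖ = 1) (hatom : ∀ p, μ {z | g z = p} = 0) :
    ∃ ρ, 0 ≤ ρ ∧ ρ < 1 ∧ ∀ a : E, ρ < ‖a‖ → ‖a‖ < 1 → 0 < busemann μ g a := by
  by_contra! hcon
  have hk (k : ℕ) : (0 : ℝ) ≤ 1 - 1 / (k + 1) ∧ (1 - 1 / (k + 1) : ℝ) < 1 := by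
    constructor
    · rw [sub_nonneg, div_le_one (by positivity)]; linarith [k.cast_nonneg (α := ℝ)]
    · have : (0 : ℝ) < 1 / (k + 1) := by positivity
      linarith
  choose a ha using fun k : ℕ => hcon _ (hk k).1 (hk k).2
  obtain ⟨p, -, ψ, hψ, hlim⟩ := (isCompact_closedBall (0 : E) 1).tendsto_subseq
    (x := a) (fun k => by simpa using (ha k).2.1.le)
  obtain ⟨δ, hδ, hδ1, hμ⟩ := exists_measure_ball_le hg hatom p
  have hnear : ∀ᶠ k in atTop, ‖a (ψ k) - p‖ < δ := by
    have := (Metric.tendsto_nhds.1 hlim) δ hδ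
    simpa [dist_eq_norm] using this
  have hlog : Tendsto (fun k : ℕ => Real.log ((ψ k : ℝ) + 1)) atTop atTop :=
    Real.tendsto_log_atTop.comp (tendsto_atTop_add_const_right _ _
      (tendsto_natCast_atTop_atTop.comp hψ.tendsto_atTop))
  obtain ⟨k, hk1, hk2⟩ := (hnear.and (hlog.eventually_gt_atTop
    (2 * (Real.log 2 - 2 * Real.log δ)))).exists
  have h1 := busemann_lower_bound hg hg1 (ha (ψ k)).2.1 hδ hδ1 hk1 hμ
  have h2 : Real.log (1 - ‖a (ψ k)‖) ≤ -Real.log ((ψ k : ℝ) + 1) := by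
    rw [← Real.log_inv]
    apply Real.log_le_log (by linarith [(ha (ψ k)).2.1])
    have := (ha (ψ k)).1
    rw [one_div] at this
    linarith
  linarith [(ha (ψ k)).2.2]

/-- The value at the origin is 0 and the values near the boundary are positive, so a minimum over a
smaller closed ball is global. -/
theorem exists_isMin_busemann [IsProbabilityMeasure μ] (hg : Measurable g)
    (hg1 : ∀ z, ‖g z‖ = 1) (hatom : ∀ p, μ {z | g z = p} = 0) :
    ∃ a : E, ‖a‖ < 1 ∧ ∀ b : E, ‖b‖ < 1 → busemann μ g a ≤ busemann μ g b := by
  obtain ⟨ρ, hρ0, hρ, hpos⟩ := exists_busemann_pos_near_boundary hg hg1 hatom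
  obtain ⟨a, ha, hmin⟩ := (isCompact_closedBall (0 : E) ρ).exists_isMinOn
    ⟨0, by simpa using hρ0⟩ (continuousOn_busemann (μ := μ) hg hg1 hρ0 hρ)
  have ha' : ‖a‖ ≤ ρ := by simpa using ha
  refine ⟨a, ha'.trans_lt hρ, fun b hb => ?_⟩
  rcases le_or_gt ‖b‖ ρ with h | h
  · exact hmin (by simpa using h)
  · have h0 := hmin (by simpa using hρ0 : (0 : E) ∈ Metric.closedBall 0 ρ)
    rw [Set.mem_ofPred_eq, busemann_zero hg1] at h0
    exact h0.trans (hpos b h hb).le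

variable [InnerProductSpace ℝ E]

theorem integrable_inv_norm_sub_sq_smul [IsProbabilityMeasure μ] (hg : Measurable g)
    (hg1 : ∀ z, ‖g z‖ = 1) {a : E} (ha : ‖a‖ < 1) :
    Integrable (fun z => (‖g z - a‖ ^ 2)⁻¹ • (g z - a)) μ := by
  refine .of_bound (C := ((1 - ‖a‖) ^ 2)⁻¹ * 2) ?_ (.of_forall fun z => ?_)
  · exact (((hg.sub_const a).norm.pow_const 2).inv.smul (hg.sub_const a)).aestronglyMeasurable
  · rw [norm_smul, norm_inv, Real.norm_eq_abs, abs_of_nonneg (by positivity)]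
    have h1 := sq_one_sub_norm_le (hg1 z) ha
    have h2 : 0 < (1 - ‖a‖) ^ 2 := pow_pos (by linarith) 2
    have h3 : ‖g z - a‖ ≤ 2 := (norm_sub_le _ _).trans (by linarith [hg1 z])
    gcongr

/-- Both logarithmic differences are bounded by log u ≤ u - 1. This one-sided first-order estimate
replaces differentiation under the integral, and it is enough at a minimum. -/
theorem busemann_add_sub_le [IsProbabilityMeasure μ] (hg : Measurable g)
    (hg1 : ∀ z, ‖g z‖ = 1) {a h : E} (ha : ‖a‖ < 1) {ε : ℝ} (hah : ‖a + ε • h‖ < 1) :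
    busemann μ g (a + ε • h) - busemann μ g a ≤
      ε * (-2 * inner ℝ (∫ z, (‖g z - a‖ ^ 2)⁻¹ • (g z - a) ∂μ) h +
        ε * ‖h‖ ^ 2 * ((1 - ‖a‖) ^ 2)⁻¹ +
        (2 * inner ℝ a h + ε * ‖h‖ ^ 2) / (1 - ‖a + ε • h‖ ^ 2)) := by
  have hI := integrable_inv_norm_sub_sq_smul (μ := μ) hg hg1 ha
  have hpt (z : Ω) : Real.log (‖g z - (a + ε • h)‖ ^ 2) - Real.log (‖g z - a‖ ^ 2) ≤
      (-2 * ε) * inner ℝ ((‖g z - a‖ ^ 2)⁻¹ • (g z - a)) h +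
        ε ^ 2 * ‖h‖ ^ 2 * ((1 - ‖a‖) ^ 2)⁻¹ := by
    have p1 := norm_sub_sq_pos (hg1 z) hah
    have p2 := norm_sub_sq_pos (hg1 z) ha
    rw [← Real.log_div p1.ne' p2.ne']
    refine (Real.log_le_sub_one_of_pos (div_pos p1 p2)).trans ?_
    rw [inner_smul_left, ← sub_sub, norm_sub_sq_real (g z - a), inner_smul_right, norm_smul,
      mul_pow, Real.norm_eq_abs, sq_abs]
    have h2 : 0 < (1 - ‖a‖) ^ 2 := pow_pos (by linarith) 2
    have h3 : ε ^ 2 * ‖h‖ ^ 2 * (‖g z - a‖ ^ 2)⁻¹ ≤ ε ^ 2 * ‖h‖ ^ 2 * ((1 - ‖a‖) ^ 2)⁻¹ := by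
      have := sq_one_sub_norm_le (hg1 z) ha
      gcongr
    refine le_trans (le_of_eq ?_) (add_le_add_right h3 _)
    simp only [RCLike.conj_to_real]
    have p3 := p2.ne'
    generalize ‖g z - a‖ ^ 2 = D at p3
    field_simp
    ring
  have hinner : ∫ z, inner ℝ ((‖g z - a‖ ^ 2)⁻¹ • (g z - a)) h ∂μ =
      inner ℝ (∫ z, (‖g z - a‖ ^ 2)⁻¹ • (g z - a) ∂μ) h := by
    rw [real_inner_comm, ← integral_inner hI]
    exact integral_congr_ae (.of_forall fun z => real_inner_comm _ _)
  have hint := integral_mono ((integrable_log_norm_sub_sq (μ := μ) hg hg1 hah).sub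
    (integrable_log_norm_sub_sq hg hg1 ha))
    (((hI.inner_const h).const_mul (-2 * ε)).add (integrable_const _)) hpt
  simp only [Pi.add_apply, Pi.sub_apply] at hint
  rw [integral_sub (integrable_log_norm_sub_sq hg hg1 hah) (integrable_log_norm_sub_sq hg hg1 ha),
    integral_add ((hI.inner_const h).const_mul _) (integrable_const _), integral_const_mul,
    integral_const, probReal_univ, one_smul, hinner] at hint
  have q1 : 0 < 1 - ‖a + ε • h‖ ^ 2 := by nlinarith [norm_nonneg (a + ε • h)]
  have q2 : 0 < 1 - ‖a‖ ^ 2 := by nlinarith [norm_nonneg a]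
  have hlog : Real.log (1 - ‖a‖ ^ 2) - Real.log (1 - ‖a + ε • h‖ ^ 2) ≤
      ε * ((2 * inner ℝ a h + ε * ‖h‖ ^ 2) / (1 - ‖a + ε • h‖ ^ 2)) := by
    rw [← Real.log_div q2.ne' q1.ne']
    refine (Real.log_le_sub_one_of_pos (div_pos q2 q1)).trans (le_of_eq ?_)
    have e : ‖a‖ ^ 2 = ‖a + ε • h‖ ^ 2 - ε * (2 * inner ℝ a h + ε * ‖h‖ ^ 2) := by
      rw [norm_add_sq_real a, inner_smul_right, norm_smul, mul_pow, Real.norm_eq_abs, sq_abs]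
      ring
    rw [e]
    field_simp
    ring
  unfold busemann
  linarith

/-- The balancing equation is the Euler-Lagrange equation of the Busemann function: its integrand is
the dilation `dilationAux` applied to g z. -/
theorem exists_balancing_point [IsProbabilityMeasure μ] (hg : Measurable g)
    (hg1 : ∀ z, ‖g z‖ = 1) (hatom : ∀ p, μ {z | g z = p} = 0) :
    ∃ a : E, ‖a‖ < 1 ∧ ∫ z, (((1 - ‖a‖ ^ 2) / ‖g z - a‖ ^ 2) • (g z - a) - a) ∂μ = 0 := by
  obtain ⟨a, ha, hmin⟩ := exists_isMin_busemann hg hg1 hatom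
  refine ⟨a, ha, ?_⟩
  have q2 : 0 < 1 - ‖a‖ ^ 2 := by nlinarith [norm_nonneg a]
  set J := ∫ z, (‖g z - a‖ ^ 2)⁻¹ • (g z - a) ∂μ with hJ
  have hineq (h : E) : 0 ≤ -2 * inner ℝ J h + 2 * inner ℝ a h / (1 - ‖a‖ ^ 2) := by
    have hlim : Tendsto (fun ε : ℝ => -2 * inner ℝ J h + ε * ‖h‖ ^ 2 * ((1 - ‖a‖) ^ 2)⁻¹ +
        (2 * inner ℝ a h + ε * ‖h‖ ^ 2) / (1 - ‖a + ε • h‖ ^ 2)) (𝓝[>] 0)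
        (𝓝 (-2 * inner ℝ J h + 0 * ‖h‖ ^ 2 * ((1 - ‖a‖) ^ 2)⁻¹ +
        (2 * inner ℝ a h + 0 * ‖h‖ ^ 2) / (1 - ‖a + (0 : ℝ) • h‖ ^ 2))) := by
      apply tendsto_nhdsWithin_of_tendsto_nhds
      have : ContinuousAt (fun ε : ℝ => -2 * inner ℝ J h + ε * ‖h‖ ^ 2 * ((1 - ‖a‖) ^ 2)⁻¹ +
        (2 * inner ℝ a h + ε * ‖h‖ ^ 2) / (1 - ‖a + ε • h‖ ^ 2)) 0 := by
        refine ContinuousAt.add (by fun_prop) (ContinuousAt.div (by fun_prop) (by fun_prop) ?_)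
        simpa using q2.ne'
      exact this
    simp only [zero_mul, add_zero, zero_smul] at hlim
    refine ge_of_tendsto hlim ?_
    have hsmall : ∀ᶠ ε : ℝ in 𝓝[>] 0, ‖a + ε • h‖ < 1 := by
      apply eventually_nhdsWithin_of_eventually_nhds
      have : ContinuousAt (fun ε : ℝ => ‖a + ε • h‖) 0 := by fun_prop
      exact this.eventually_lt continuousAt_const (by simpa using ha)
    filter_upwards [hsmall, self_mem_nhdsWithin] with ε h1 h2
    have h3 := busemann_add_sub_le (μ := μ) hg hg1 ha h1
    have h4 := hmin _ h1
    have h5 : 0 < ε := h2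
    by_contra hneg
    have := mul_neg_of_pos_of_neg h5 (not_le.1 hneg)
    linarith
  -- The first variation is linear in h. Taking for h the difference of the two sides makes it
  -- -2|h|², and it is nonnegative, so h = 0.
  have hzero : J = (1 - ‖a‖ ^ 2)⁻¹ • a := by
    rw [← sub_eq_zero, ← inner_self_eq_zero (𝕜 := ℝ)]
    have h1 := hineq (J - (1 - ‖a‖ ^ 2)⁻¹ • a)
    have h2 : -2 * inner ℝ J (J - (1 - ‖a‖ ^ 2)⁻¹ • a) +
        2 * inner ℝ a (J - (1 - ‖a‖ ^ 2)⁻¹ • a) / (1 - ‖a‖ ^ 2) =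
        -2 * inner ℝ (J - (1 - ‖a‖ ^ 2)⁻¹ • a) (J - (1 - ‖a‖ ^ 2)⁻¹ • a) := by
      conv_rhs => rw [inner_sub_left, inner_smul_left]
      simp only [RCLike.conj_to_real]
      field_simp
      ring
    rw [h2] at h1
    have h3 := real_inner_self_nonneg (x := J - (1 - ‖a‖ ^ 2)⁻¹ • a)
    linarith
  have e (z : Ω) : ((1 - ‖a‖ ^ 2) / ‖g z - a‖ ^ 2) • (g z - a) =
      (1 - ‖a‖ ^ 2) • ((‖g z - a‖ ^ 2)⁻¹ • (g z - a)) := by rw [smul_smul, div_eq_mul_inv]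
  simp_rw [e]
  have hI : Integrable (fun z => (1 - ‖a‖ ^ 2) • ((‖g z - a‖ ^ 2)⁻¹ • (g z - a))) μ :=
    (integrable_inv_norm_sub_sq_smul hg hg1 ha).smul _
  rw [integral_sub hI (integrable_const _), integral_smul, ← hJ, hzero, smul_smul,
    mul_inv_cancel₀ q2.ne',
    one_smul, integral_const,
    probReal_univ, one_smul, sub_self]

end Balance

/-! ### Calculus on the sphere and conformal dilations -/

section SphereCalculus

variable {n : ℕ} {X : Type*} [NormedAddCommGroup X] [NormedSpace ℝ X]

theorem contMDiff_coe_unitSphere {m : ℕ∞ω} :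
    ContMDiff (𝓡 n) 𝓘(ℝ, Ambient n) m fun q : Sphere n => (q : Ambient n) :=
  haveI := Fact.mk (finrank_euclideanSpace_fin (𝕜 := ℝ) (n := n + 1))
  contMDiff_coe_sphere

theorem contMDiff_codRestrict_unitSphere {F H M : Type*} [NormedAddCommGroup F] [NormedSpace ℝ F]
    [TopologicalSpace H] {I : ModelWithCorners ℝ F H} [TopologicalSpace M] [ChartedSpace H M]
    {m : ℕ∞ω} [IsManifold I m M] {g : M → Sphere n}
    (hg : ContMDiff I 𝓘(ℝ, Ambient n) m fun x => (g x : Ambient n)) :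
    ContMDiff I (𝓡 n) m g :=
  haveI := Fact.mk (finrank_euclideanSpace_fin (𝕜 := ℝ) (n := n + 1))
  ContMDiff.codRestrict_sphere hg fun x => (g x).2

theorem mdifferentiableAt_coe_unitSphere (p : Sphere n) :
    MDifferentiableAt (𝓡 n) 𝓘(ℝ, Ambient n) (fun q : Sphere n => (q : Ambient n)) p :=
  (contMDiff_coe_unitSphere (m := 1)).mdifferentiableAt one_ne_zero

theorem fderiv_coe_eq_inclusionDeriv {g : X → Sphere n} {x : X}
    (hg : MDifferentiableAt 𝓘(ℝ, X) (𝓡 n) g x) (h : X) :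
    fderiv ℝ (fun x => (g x : Ambient n)) x h =
      inclusionDeriv (g x) (mfderiv 𝓘(ℝ, X) (𝓡 n) g x h) := by
  have h2 := mfderiv_comp x (mdifferentiableAt_coe_unitSphere (g x)) hg
  rw [← mfderiv_eq_fderiv]
  exact congrArg (fun L => L h) h2

theorem contMDiff_of_contDiff_coe {m : ℕ∞ω} {g : X → Sphere n}
    (hg : ContDiff ℝ m fun x => (g x : Ambient n)) : ContMDiff 𝓘(ℝ, X) (𝓡 n) m g :=
  contMDiff_codRestrict_unitSphere hg.contMDiff

theorem contDiff_coe_comp {m : ℕ∞ω} {g : X → Sphere n} (hg : ContMDiff 𝓘(ℝ, X) (𝓡 n) m g) :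
    ContDiff ℝ m fun x => (g x : Ambient n) :=
  (contMDiff_coe_unitSphere.comp hg).contDiff

/-- The conformal factor of a conformal automorphism rescales the pull-back metrics of all maps
into the sphere. -/
theorem IsConformalAut.exists_factor {ψ : Sphere n ≃ₘ^∞⟮𝓡 n, 𝓡 n⟯ Sphere n}
    (hψ : IsConformalAut ψ) : ∃ c : Sphere n → ℝ, (∀ p, 0 < c p) ∧
      ∀ (X : Type) [NormedAddCommGroup X] [NormedSpace ℝ X] (g : X → Sphere n),
        (ContDiff ℝ ∞ fun x => (g x : Ambient n)) → ∀ x h k : X,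
        inner ℝ (fderiv ℝ (fun x => (ψ (g x) : Ambient n)) x h)
          (fderiv ℝ (fun x => (ψ (g x) : Ambient n)) x k) =
        c (g x) * inner ℝ (fderiv ℝ (fun x => (g x : Ambient n)) x h)
          (fderiv ℝ (fun x => (g x : Ambient n)) x k) := by
  choose c hc0 hc using hψ
  refine ⟨c, hc0, fun X _ _ g hg x h k => ?_⟩
  have hgm := (contMDiff_of_contDiff_coe hg).mdifferentiableAt (x := x) (by simp)
  have hψm := ψ.contMDiff.mdifferentiableAt (x := g x) (by simp)
  have hcomp := mfderiv_comp x hψm hgm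
  rw [fderiv_coe_eq_inclusionDeriv (g := fun x => ψ (g x)) (hψm.comp x hgm),
    fderiv_coe_eq_inclusionDeriv (g := fun x => ψ (g x)) (hψm.comp x hgm),
    fderiv_coe_eq_inclusionDeriv hgm, fderiv_coe_eq_inclusionDeriv hgm]
  have := hc (g x) (mfderiv 𝓘(ℝ, X) (𝓡 n) g x h) (mfderiv 𝓘(ℝ, X) (𝓡 n) g x k)
  unfold roundMetric at this
  rw [← this]
  have e : mfderiv 𝓘(ℝ, X) (𝓡 n) (fun x => ψ (g x)) x = _ := hcomp
  rw [e]
  rfl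

theorem contDiff_coe_diffeomorph_comp (ψ : Sphere n ≃ₘ^∞⟮𝓡 n, 𝓡 n⟯ Sphere n) {g : X → Sphere n}
    (hg : ContDiff ℝ ∞ fun x => (g x : Ambient n)) :
    ContDiff ℝ ∞ fun x => (ψ (g x) : Ambient n) :=
  contDiff_coe_comp (ψ.contMDiff.comp (contMDiff_of_contDiff_coe hg))

/-- The conformal dilation of `𝔼^{n+1}` that maps the unit sphere to itself and `a` to `∞`. -/
noncomputable def dilationAux (a x : Ambient n) : Ambient n :=
  ((1 - ‖a‖ ^ 2) / ‖x - a‖ ^ 2) • (x - a) - a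

theorem norm_dilationAux {a p : Ambient n} (ha : ‖a‖ < 1) (hp : ‖p‖ = 1) :
    ‖dilationAux a p‖ = 1 := by
  have hw := norm_sub_sq_pos hp ha
  have e : ‖p‖ ^ 2 = ‖p - a‖ ^ 2 + 2 * inner ℝ (p - a) a + ‖a‖ ^ 2 := by
    rw [← norm_add_sq_real, sub_add_cancel]
  rw [hp] at e
  have h2 : ‖dilationAux a p‖ ^ 2 = 1 := by
    rw [dilationAux, norm_sub_sq_real, norm_smul, inner_smul_left, mul_pow, Real.norm_eq_abs,
      sq_abs]
    simp only [RCLike.conj_to_real]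
    generalize ‖p - a‖ ^ 2 = D at hw e
    have := hw.ne'
    field_simp
    linear_combination (1 - ‖a‖ ^ 2) * e
  exact (pow_eq_one_iff_of_nonneg (norm_nonneg _) two_ne_zero).1 h2

theorem dilationAux_neg_dilationAux {a p : Ambient n} (ha : ‖a‖ < 1) (hp : ‖p‖ = 1) :
    dilationAux (-a) (dilationAux a p) = p := by
  have hw := norm_sub_sq_pos hp ha
  have hs : 0 < 1 - ‖a‖ ^ 2 := by nlinarith [norm_nonneg a]
  have e : dilationAux a p - -a = ((1 - ‖a‖ ^ 2) / ‖p - a‖ ^ 2) • (p - a) := by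
    simp [dilationAux]
  rw [dilationAux, e, norm_neg, norm_smul, smul_smul, mul_pow, Real.norm_eq_abs, sq_abs]
  generalize ‖p - a‖ ^ 2 = D at hw
  have : (1 - ‖a‖ ^ 2) / (((1 - ‖a‖ ^ 2) / D) ^ 2 * D) * ((1 - ‖a‖ ^ 2) / D) = 1 := by
    have := hw.ne'
    field_simp
  rw [this]; simp

theorem dilationAux_eq_inversion {a : Ambient n} (ha : ‖a‖ < 1) (x : Ambient n) :
    dilationAux a x = EuclideanGeometry.inversion a (√(1 - ‖a‖ ^ 2)) x - (2 : ℝ) • a := by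
  have hs : 0 ≤ 1 - ‖a‖ ^ 2 := by nlinarith [norm_nonneg a]
  rw [dilationAux, EuclideanGeometry.inversion, dist_eq_norm, div_pow, Real.sq_sqrt hs, two_smul]
  simp only [vsub_eq_sub, vadd_eq_add]
  abel

/-- The derivative of an inversion is a positive multiple of a reflection, hence conformal. -/
theorem inner_fderiv_dilationAux {a p : Ambient n} (ha : ‖a‖ < 1) (hp : ‖p‖ = 1)
    (u v : Ambient n) :
    inner ℝ (fderiv ℝ (dilationAux a) p u) (fderiv ℝ (dilationAux a) p v) =
      ((1 - ‖a‖ ^ 2) / ‖p - a‖ ^ 2) ^ 2 * inner ℝ u v := by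
  have hs : 0 ≤ 1 - ‖a‖ ^ 2 := by nlinarith [norm_nonneg a]
  have hpa : p ≠ a := by rintro rfl; linarith
  have h := (EuclideanGeometry.hasFDerivAt_inversion (c := a) (R := √(1 - ‖a‖ ^ 2)) hpa).sub_const
    ((2 : ℝ) • a)
  have h' : HasFDerivAt (dilationAux a) _ p := h.congr_of_eventuallyEq
    (.of_forall fun x => dilationAux_eq_inversion ha x)
  rw [h'.fderiv]
  simp only [smul_apply, inner_smul_left, inner_smul_right,
    RCLike.conj_to_real, dist_eq_norm, div_pow, Real.sq_sqrt hs]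
  have : inner ℝ (((ℝ ∙ (p - a))ᗮ.reflection : Ambient n →L[ℝ] Ambient n) u)
      (((ℝ ∙ (p - a))ᗮ.reflection : Ambient n →L[ℝ] Ambient n) v) = inner ℝ u v :=
    LinearIsometryEquiv.inner_map_map _ u v
  rw [this]
  ring

theorem contDiffAt_dilationAux {a p : Ambient n} (ha : ‖a‖ < 1) (hp : ‖p‖ = 1) :
    ContDiffAt ℝ ∞ (dilationAux a) p := by
  have hw := norm_sub_sq_pos hp ha
  have h1 : ContDiffAt ℝ ∞ (fun x : Ambient n => x - a) p := contDiffAt_id.sub contDiffAt_const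
  exact ((contDiffAt_const.div (h1.norm_sq ℝ) hw.ne').smul h1).sub contDiffAt_const

/-- The map of the unit sphere to itself induced by `dilationAux`. -/
noncomputable def dilationFun {a : Ambient n} (ha : ‖a‖ < 1) (p : Sphere n) : Sphere n :=
  ⟨dilationAux a p, mem_sphere_zero_iff_norm.2
    (norm_dilationAux ha (mem_sphere_zero_iff_norm.1 p.2))⟩

theorem contMDiff_dilationFun {a : Ambient n} (ha : ‖a‖ < 1) :
    ContMDiff (𝓡 n) (𝓡 n) ∞ (dilationFun ha) := by
  have h : ContMDiff (𝓡 n) 𝓘(ℝ, Ambient n) ∞ fun p : Sphere n => dilationAux a p := fun p =>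
    (contDiffAt_dilationAux ha (mem_sphere_zero_iff_norm.1 p.2)).contMDiffAt.comp p
      (contMDiff_coe_unitSphere p)
  exact contMDiff_codRestrict_unitSphere h

/-- The conformal dilations of the unit sphere. -/
noncomputable def dilation {a : Ambient n} (ha : ‖a‖ < 1) : Sphere n ≃ₘ^∞⟮𝓡 n, 𝓡 n⟯ Sphere n where
  toFun := dilationFun ha
  invFun := dilationFun (a := -a) ((norm_neg a).trans_lt ha)
  left_inv p := Subtype.ext
    (dilationAux_neg_dilationAux ha (mem_sphere_zero_iff_norm.1 p.2))
  right_inv p := Subtype.ext (by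
    have := dilationAux_neg_dilationAux (a := -a) (by rwa [norm_neg])
      (mem_sphere_zero_iff_norm.1 p.2)
    rwa [neg_neg] at this)
  contMDiff_toFun := contMDiff_dilationFun ha
  contMDiff_invFun := contMDiff_dilationFun ((norm_neg a).trans_lt ha)

theorem isConformalAut_dilation {a : Ambient n} (ha : ‖a‖ < 1) :
    IsConformalAut (dilation ha) := by
  intro p
  have hp := mem_sphere_zero_iff_norm.1 p.2
  have hs : 0 < 1 - ‖a‖ ^ 2 := by nlinarith [norm_nonneg a]
  refine ⟨((1 - ‖a‖ ^ 2) / ‖(p : Ambient n) - a‖ ^ 2) ^ 2,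
    pow_pos (div_pos hs (norm_sub_sq_pos hp ha)) 2, fun v w => ?_⟩
  have hi := mdifferentiableAt_coe_unitSphere (n := n)
  have hd := (dilation ha).contMDiff.mdifferentiableAt (x := p) (by simp)
  have hD : MDifferentiableAt 𝓘(ℝ, Ambient n) 𝓘(ℝ, Ambient n) (dilationAux a) (p : Ambient n) :=
    ((contDiffAt_dilationAux ha hp).differentiableAt (by simp)).mdifferentiableAt
  have h1 := mfderiv_comp p (hi (dilation ha p)) hd
  have h2 := mfderiv_comp p hD (hi p)
  have key (v : TangentSpace (𝓡 n) p) :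
      inclusionDeriv (dilation ha p) (mfderiv (𝓡 n) (𝓡 n) (dilation ha) p v) =
      fderiv ℝ (dilationAux a) p (inclusionDeriv p v) := by
    rw [← mfderiv_eq_fderiv]
    exact congrArg (fun L => L v) (h1.symm.trans h2 : _)
  unfold roundMetric
  rw [key, key, inner_fderiv_dilationAux ha hp]

end SphereCalculus

/-! ### Liouville's theorem: the conformal factor of a conformal automorphism -/

section DirectionalDerivative

variable {H V : Type*} [NormedAddCommGroup H] [NormedSpace ℝ H] [NormedAddCommGroup V]
  [NormedSpace ℝ V]

/-- The derivative of `f` in the direction `v`. -/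
noncomputable def dirDeriv (v : H) (f : H → V) (x : H) : V := fderiv ℝ f x v

theorem contDiff_dirDeriv {f : H → V} (hf : ContDiff ℝ ∞ f) (v : H) :
    ContDiff ℝ ∞ (dirDeriv v f) :=
  (hf.fderiv_right (m := ∞) (by simp)).clm_apply contDiff_const

theorem dirDeriv_dirDeriv {f : H → V} (hf : ContDiff ℝ ∞ f) (u v x : H) :
    dirDeriv u (dirDeriv v f) x = fderiv ℝ (fderiv ℝ f) x u v := by
  have h : DifferentiableAt ℝ (fderiv ℝ f) x :=
    (hf.fderiv_right (m := ∞) (by simp)).differentiable (by simp) x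
  unfold dirDeriv
  rw [fderiv_clm_apply h (differentiableAt_const v)]
  simp

/-- Symmetry of second derivatives, which drives all the index permutations below. -/
theorem dirDeriv_comm {f : H → V} (hf : ContDiff ℝ ∞ f) (u v : H) :
    dirDeriv u (dirDeriv v f) = dirDeriv v (dirDeriv u f) := by
  ext x
  rw [dirDeriv_dirDeriv hf, dirDeriv_dirDeriv hf]
  exact (hf.contDiffAt.isSymmSndFDerivAt (by
    simpa using (WithTop.coe_le_coe.2 le_top : ((2 : ℕ∞) : ℕ∞ω) ≤ ((⊤ : ℕ∞) : ℕ∞ω)))) u v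

theorem dirDeriv_const (v : H) (c : V) : dirDeriv v (fun _ : H => c) = 0 := by
  ext x; simp [dirDeriv]

end DirectionalDerivative

/-! ### The Lorentz form and its product rule. -/

section LorentzForm

variable {H E : Type*} [NormedAddCommGroup H] [NormedSpace ℝ H] [NormedAddCommGroup E]
  [InnerProductSpace ℝ E]

/-- The Lorentz form on `ℝ × E`. -/
noncomputable def lorentz (p q : ℝ × E) : ℝ := inner ℝ p.2 q.2 - p.1 * q.1

theorem lorentz_comm (p q : ℝ × E) : lorentz p q = lorentz q p := by
  rw [lorentz, lorentz, real_inner_comm, mul_comm]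

theorem lorentz_smul_left (t : ℝ) (p q : ℝ × E) : lorentz (t • p) q = t * lorentz p q := by
  simp only [lorentz, Prod.smul_fst, Prod.smul_snd, inner_smul_left, smul_eq_mul,
    RCLike.conj_to_real]
  ring

theorem lorentz_smul_right (t : ℝ) (p q : ℝ × E) : lorentz p (t • q) = t * lorentz p q := by
  rw [lorentz_comm, lorentz_smul_left, lorentz_comm]

theorem lorentz_sub_left (p p' q : ℝ × E) : lorentz (p - p') q = lorentz p q - lorentz p' q := by
  simp only [lorentz, Prod.fst_sub, Prod.snd_sub, inner_sub_left]
  ring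

theorem lorentz_sub_right (p q q' : ℝ × E) : lorentz p (q - q') = lorentz p q - lorentz p q' := by
  rw [lorentz_comm, lorentz_sub_left, lorentz_comm, lorentz_comm q']

theorem lorentz_add_left (p p' q : ℝ × E) : lorentz (p + p') q = lorentz p q + lorentz p' q := by
  simp only [lorentz, Prod.fst_add, Prod.snd_add, inner_add_left]
  ring

theorem lorentz_sum_left {ι : Type*} (s : Finset ι) (p : ι → ℝ × E) (q : ℝ × E) :
    lorentz (∑ i ∈ s, p i) q = ∑ i ∈ s, lorentz (p i) q := by
  simp only [lorentz, Prod.fst_sum, Prod.snd_sum, sum_inner, Finset.sum_mul,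
    Finset.sum_sub_distrib]

theorem lorentz_zero_left (q : ℝ × E) : lorentz 0 q = 0 := by simp [lorentz]

theorem dirDeriv_lorentz {f g : H → ℝ × E} (hf : ContDiff ℝ ∞ f) (hg : ContDiff ℝ ∞ g) (v x : H) :
    dirDeriv v (fun x => lorentz (f x) (g x)) x =
      lorentz (dirDeriv v f x) (g x) + lorentz (f x) (dirDeriv v g x) := by
  have hf' := (hf.differentiable (by simp) x).hasFDerivAt
  have hg' := (hg.differentiable (by simp) x).hasFDerivAt
  have h : HasFDerivAt (fun x => lorentz (f x) (g x)) _ x :=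
    (hf'.snd.inner ℝ hg'.snd).sub (hf'.fst.mul hg'.fst)
  unfold dirDeriv
  rw [h.fderiv]
  simp [lorentz]
  ring

end LorentzForm

/-! ### Rigidity of flat lifts to the light cone. -/

section LightConeLift

variable {n : ℕ} {H : Type*} [NormedAddCommGroup H] [InnerProductSpace ℝ H]
  (b : OrthonormalBasis (Fin n) ℝ H)

theorem fderiv_eq_zero_of_dirDeriv {V : Type*} [NormedAddCommGroup V] [NormedSpace ℝ V]
    {f : H → V} {x : H} (h : ∀ i, dirDeriv (b i) f x = 0) : fderiv ℝ f x = 0 := by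
  apply ContinuousLinearMap.coe_injective
  apply b.toBasis.ext
  intro i
  simpa [dirDeriv] using h i

theorem eq_const_of_dirDeriv_dirDeriv_eq_zero {f : H → ℝ} (hf : ContDiff ℝ ∞ f)
    (h : ∀ i j x, dirDeriv (b i) (dirDeriv (b j) f) x = 0) (h0 : ∀ i, dirDeriv (b i) f 0 = 0)
    (x : H) : f x = f 0 := by
  have h1 (j : Fin n) (x : H) : dirDeriv (b j) f x = 0 := by
    rw [← h0 j]
    exact is_const_of_fderiv_eq_zero ((contDiff_dirDeriv hf _).differentiable (by simp))
      (fun x => fderiv_eq_zero_of_dirDeriv b fun i => h i j x) x 0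
  exact is_const_of_fderiv_eq_zero (hf.differentiable (by simp))
    (fun x => fderiv_eq_zero_of_dirDeriv b fun i => h1 i x) x 0

/-- If u were nonzero, u, f and the d i would be n + 2 orthogonal nonzero vectors in dimension n +
1. -/
theorem eq_zero_of_inner_eq_zero {f u : Ambient n} {d : Fin n → Ambient n} (hf : f ≠ 0)
    (hd : ∀ i, d i ≠ 0) (hfd : ∀ i, inner ℝ f (d i) = 0)
    (hdd : ∀ i j, i ≠ j → inner ℝ (d i) (d j) = 0) (huf : inner ℝ u f = 0)
    (hud : ∀ i, inner ℝ u (d i) = 0) : u = 0 := by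
  by_contra hu
  let v : Option (Option (Fin n)) → Ambient n := fun i => i.elim u fun j => j.elim f d
  have hli : LinearIndependent ℝ v := by
    apply linearIndependent_of_ne_zero_of_inner_eq_zero (𝕜 := ℝ)
    · rintro (_ | _ | i)
      exacts [hu, hf, hd i]
    · rintro (_ | _ | i) (_ | _ | j) hij
      · exact absurd rfl hij
      · exact huf
      · exact hud j
      · exact (real_inner_comm _ _).trans huf
      · exact absurd rfl hij
      · exact hfd j
      · exact (real_inner_comm _ _).trans (hud i)
      · exact (real_inner_comm _ _).trans (hfd i)
      · exact hdd i j fun h => hij (by rw [h])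
  have := hli.fintype_card_le_finrank
  rw [finrank_euclideanSpace_fin] at this
  simp at this

/-- The light cone lift of an isothermal parametrization of the sphere: a map `N` into the light
cone of `ℝ × 𝔼^{n+1}` that induces the flat metric. -/
structure IsFlatLift (N : H → ℝ × Ambient n) : Prop where
  smooth : ContDiff ℝ ∞ N
  null : ∀ x, lorentz (N x) (N x) = 0
  flat : ∀ i j x, lorentz (dirDeriv (b i) N x) (dirDeriv (b j) N x) = if i = j then 1 else 0
  span : ∀ x v, lorentz v (N x) = 0 → (∀ i, lorentz v (dirDeriv (b i) N x) = 0) →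
    ∃ t : ℝ, v = t • N x

namespace IsFlatLift

variable {b} {N : H → ℝ × Ambient n}

theorem lorentz_dirDeriv (hN : IsFlatLift b N) (i : Fin n) (x : H) :
    lorentz (N x) (dirDeriv (b i) N x) = 0 := by
  have h := dirDeriv_lorentz hN.smooth hN.smooth (b i) x
  have e : (fun x => lorentz (N x) (N x)) = fun _ => 0 := funext hN.null
  rw [e, dirDeriv_const, lorentz_comm, ← two_mul] at h
  simpa using h

theorem lorentz_dirDeriv_dirDeriv (hN : IsFlatLift b N) (i j : Fin n) (x : H) :
    lorentz (N x) (dirDeriv (b i) (dirDeriv (b j) N) x) = -if i = j then 1 else 0 := by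
  have h := dirDeriv_lorentz hN.smooth (contDiff_dirDeriv hN.smooth (b j)) (b i) x
  have e : (fun x => lorentz (N x) (dirDeriv (b j) N x)) = fun _ => 0 :=
    funext (hN.lorentz_dirDeriv j)
  rw [e, dirDeriv_const, hN.flat] at h
  simp only [Pi.zero_apply] at h
  linarith

/-- The Koszul argument: the expression is symmetric in i, j and, since the metric is constant,
antisymmetric in j, k. -/
theorem christoffel (hN : IsFlatLift b N) (i j k : Fin n) (x : H) :
    lorentz (dirDeriv (b i) (dirDeriv (b j) N) x) (dirDeriv (b k) N x) = 0 := by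
  have hs (j : Fin n) := contDiff_dirDeriv hN.smooth (b j)
  have h (i j k : Fin n) :
      lorentz (dirDeriv (b i) (dirDeriv (b j) N) x) (dirDeriv (b k) N x) =
      -lorentz (dirDeriv (b i) (dirDeriv (b k) N) x) (dirDeriv (b j) N x) := by
    have h := dirDeriv_lorentz (hs j) (hs k) (b i) x
    have e : (fun x => lorentz (dirDeriv (b j) N x) (dirDeriv (b k) N x)) =
      fun _ => if j = k then 1 else 0 := funext (hN.flat j k)
    rw [e, dirDeriv_const, Pi.zero_apply] at h
    rw [lorentz_comm (dirDeriv (b i) (dirDeriv (b k) N) x)]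
    linarith
  have c (i j : Fin n) := dirDeriv_comm hN.smooth (b i) (b j)
  have h1 := h i j k
  rw [c i k] at h1
  have h2 := h k i j
  rw [c k j] at h2
  have h3 := h j k i
  rw [c j i] at h3
  linarith

/-- The Lorentz products of the second derivatives. -/
theorem gauss (hN : IsFlatLift b N) (i j k l : Fin n) (x : H) :
    lorentz (dirDeriv (b i) (dirDeriv (b j) N) x) (dirDeriv (b k) (dirDeriv (b l) N) x) =
    lorentz (dirDeriv (b k) (dirDeriv (b j) N) x) (dirDeriv (b i) (dirDeriv (b l) N) x) := by
  have hs (j : Fin n) := contDiff_dirDeriv hN.smooth (b j)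
  -- Differentiating the vanishing Christoffel symbols turns the product into one third derivative
  -- paired with a first derivative, where i and k may be exchanged.
  have h (i j k l : Fin n) :
      lorentz (dirDeriv (b i) (dirDeriv (b j) N) x) (dirDeriv (b k) (dirDeriv (b l) N) x) =
      -lorentz (dirDeriv (b k) (dirDeriv (b i) (dirDeriv (b j) N)) x) (dirDeriv (b l) N x) := by
    have h := dirDeriv_lorentz (contDiff_dirDeriv (hs j) (b i)) (hs l) (b k) x
    have e : (fun x => lorentz (dirDeriv (b i) (dirDeriv (b j) N) x) (dirDeriv (b l) N x)) =
      fun _ => 0 := funext (hN.christoffel i j l)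
    rw [e, dirDeriv_const, Pi.zero_apply] at h
    linarith
  rw [h i j k l, h k j i l, dirDeriv_comm (hs j)]

/-- A mixed derivative is orthogonal to N and to its first derivatives, so it is tN. A third index
k, available because n ≥ 3, gives t = 0: in the Gauss identity one side is -t and the other pairs
two multiples of the null vector N. -/
theorem dirDeriv_dirDeriv_of_ne (hN : IsFlatLift b N) (hn : 3 ≤ n) {i j : Fin n}
    (hij : i ≠ j) (x : H) :
    dirDeriv (b i) (dirDeriv (b j) N) x = 0 := by
  have hS (i j : Fin n) (hij : i ≠ j) : ∃ t : ℝ,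
      dirDeriv (b i) (dirDeriv (b j) N) x = t • N x := by
    refine hN.span x _ ?_ fun k => hN.christoffel i j k x
    rw [lorentz_comm, hN.lorentz_dirDeriv_dirDeriv, if_neg hij, neg_zero]
  obtain ⟨k, hki, hkj⟩ : ∃ k, k ≠ i ∧ k ≠ j := by
    obtain ⟨k, -, hk⟩ := Finset.exists_mem_notMem_of_card_lt_card
      (s := ({i, j} : Finset (Fin n))) (t := Finset.univ)
      (Finset.card_le_two.trans_lt (by simp; omega))
    exact ⟨k, by simpa [not_or] using hk⟩
  obtain ⟨t, ht⟩ := hS i j hij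
  obtain ⟨t₁, ht₁⟩ := hS k j hkj
  obtain ⟨t₂, ht₂⟩ := hS i k hki.symm
  have h := hN.gauss i j k k x
  rw [ht, ht₁, ht₂, lorentz_smul_left, lorentz_smul_left, lorentz_smul_right, hN.null,
    hN.lorentz_dirDeriv_dirDeriv, if_pos rfl] at h
  have : t = 0 := by linarith
  rw [ht, this, zero_smul]

theorem lorentz_pure_of_ne (hN : IsFlatLift b N) (hn : 3 ≤ n) {i j : Fin n} (hij : i ≠ j) (x : H) :
    lorentz (dirDeriv (b i) (dirDeriv (b i) N) x) (dirDeriv (b j) (dirDeriv (b j) N) x) = 0 := by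
  rw [hN.gauss, hN.dirDeriv_dirDeriv_of_ne hn hij.symm, lorentz_zero_left]

theorem exists_pure_sub_pure (hN : IsFlatLift b N) {i j : Fin n} (x : H) : ∃ t : ℝ,
    dirDeriv (b i) (dirDeriv (b i) N) x - dirDeriv (b j) (dirDeriv (b j) N) x = t • N x := by
  refine hN.span x _ ?_ fun k => ?_
  · rw [lorentz_comm, lorentz_sub_right, hN.lorentz_dirDeriv_dirDeriv,
      hN.lorentz_dirDeriv_dirDeriv, if_pos rfl, if_pos rfl, sub_self]
  · rw [lorentz_sub_left, hN.christoffel, hN.christoffel, sub_self]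

/-- The difference of two pure second derivatives is a multiple of N, hence null, and its cross
terms vanish. With three distinct indices these relations force every pure derivative to be null. -/
theorem lorentz_pure_add (hN : IsFlatLift b N) (hn : 3 ≤ n) {i j : Fin n} (hij : i ≠ j) (x : H) :
    lorentz (dirDeriv (b i) (dirDeriv (b i) N) x) (dirDeriv (b i) (dirDeriv (b i) N) x) +
    lorentz (dirDeriv (b j) (dirDeriv (b j) N) x) (dirDeriv (b j) (dirDeriv (b j) N) x) = 0 := by
  obtain ⟨t, ht⟩ := hN.exists_pure_sub_pure (i := i) (j := j) x
  have h : lorentz (t • N x) (t • N x) = 0 := by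
    rw [lorentz_smul_left, lorentz_smul_right, hN.null, mul_zero, mul_zero]
  rw [← ht, lorentz_sub_left, lorentz_sub_right, lorentz_sub_right,
    hN.lorentz_pure_of_ne hn hij, hN.lorentz_pure_of_ne hn hij.symm] at h
  linarith

theorem lorentz_pure_self (hN : IsFlatLift b N) (hn : 3 ≤ n) (i : Fin n) (x : H) :
    lorentz (dirDeriv (b i) (dirDeriv (b i) N) x) (dirDeriv (b i) (dirDeriv (b i) N) x) = 0 := by
  obtain ⟨j, k, hij, hik, hjk⟩ : ∃ j k : Fin n, i ≠ j ∧ i ≠ k ∧ j ≠ k := by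
    by_cases h0 : i.1 = 0
    · exact ⟨⟨1, by omega⟩, ⟨2, by omega⟩, by simp [Fin.ext_iff, h0], by simp [Fin.ext_iff, h0],
        by simp⟩
    · by_cases h1 : i.1 = 1
      · exact ⟨⟨0, by omega⟩, ⟨2, by omega⟩, by simp [Fin.ext_iff, h1], by simp [Fin.ext_iff, h1],
          by simp⟩
      · exact ⟨⟨0, by omega⟩, ⟨1, by omega⟩, by simp [Fin.ext_iff, h0], by simp [Fin.ext_iff, h1],
          by simp⟩
  have h1 := hN.lorentz_pure_add hn hij x
  have h2 := hN.lorentz_pure_add hn hik x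
  have h3 := hN.lorentz_pure_add hn hjk x
  linarith

/-- The difference tN is orthogonal to the i-th pure derivative, while N pairs with that derivative
to -1; so t = 0. -/
theorem pure_eq_pure (hN : IsFlatLift b N) (hn : 3 ≤ n) (i j : Fin n) (x : H) :
    dirDeriv (b i) (dirDeriv (b i) N) x = dirDeriv (b j) (dirDeriv (b j) N) x := by
  rcases eq_or_ne i j with rfl | hij
  · rfl
  obtain ⟨t, ht⟩ := hN.exists_pure_sub_pure (i := i) (j := j) x
  have h : lorentz (t • N x) (dirDeriv (b i) (dirDeriv (b i) N) x) = 0 := by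
    rw [← ht, lorentz_sub_left, hN.lorentz_pure_of_ne hn hij.symm, hN.lorentz_pure_self hn,
      sub_self]
  rw [lorentz_smul_left, hN.lorentz_dirDeriv_dirDeriv, if_pos rfl] at h
  have : t = 0 := by linarith
  rwa [this, zero_smul, sub_eq_zero] at ht

/-- To differentiate along k, replace i by some m ≠ k and commute: a vanishing mixed derivative
appears. -/
theorem pure_eq_const (hN : IsFlatLift b N) (hn : 3 ≤ n) (i : Fin n) (x : H) :
    dirDeriv (b i) (dirDeriv (b i) N) x = dirDeriv (b i) (dirDeriv (b i) N) 0 := by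
  have hs (j : Fin n) := contDiff_dirDeriv hN.smooth (b j)
  refine is_const_of_fderiv_eq_zero ((contDiff_dirDeriv (hs i) _).differentiable (by simp))
    (fun y => fderiv_eq_zero_of_dirDeriv b fun k => ?_) x 0
  obtain ⟨m, hm⟩ : ∃ m : Fin n, k ≠ m := by
    by_cases h0 : k.1 = 0
    · exact ⟨⟨1, by omega⟩, by simp [Fin.ext_iff, h0]⟩
    · exact ⟨⟨0, by omega⟩, by simp [Fin.ext_iff, h0]⟩
  rw [show dirDeriv (b i) (dirDeriv (b i) N) = dirDeriv (b m) (dirDeriv (b m) N) from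
    funext (hN.pure_eq_pure hn i m), dirDeriv_comm (hs m),
    show dirDeriv (b k) (dirDeriv (b m) N) = fun _ => 0 from
      funext (hN.dirDeriv_dirDeriv_of_ne hn hm), dirDeriv_const, Pi.zero_apply]

/-- The first component of a flat lift is a quadratic polynomial of discriminant `-1`. -/
theorem exists_quadratic (hN : IsFlatLift b N) (hn : 3 ≤ n) :
    ∃ (α γ : ℝ) (β : H), 4 * α * γ - ‖β‖ ^ 2 = 1 ∧ ∀ x, (N x).1 = α + inner ℝ β x + γ * ‖x‖ ^ 2 := by
  have hs (j : Fin n) := contDiff_dirDeriv hN.smooth (b j)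
  let i₀ : Fin n := ⟨0, by omega⟩
  set M := dirDeriv (b i₀) (dirDeriv (b i₀) N) 0 with hM
  set β : H := ∑ i, (dirDeriv (b i) N 0).1 • b i with hβ
  have hβi (i : Fin n) : inner ℝ β (b i) = (dirDeriv (b i) N 0).1 := by
    rw [real_inner_comm, hβ, inner_sum]
    simp [inner_smul_right, OrthonormalBasis.inner_eq_ite]
  have hfst : ContDiff ℝ ∞ fun x => (N x).1 := hN.smooth.fst
  have hdfst {f : H → ℝ × Ambient n} (hf : ContDiff ℝ ∞ f) (i : Fin n) :
      dirDeriv (b i) (fun x => (f x).1) = fun x => (dirDeriv (b i) f x).1 := by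
    ext x
    simp only [dirDeriv]
    rw [fderiv.fst (hf.differentiable (by simp) x)]
    rfl
  refine ⟨(N 0).1, M.1 / 2, β, ?_, fun x => ?_⟩
  -- v is (1, 0) minus its expansion in the frame N(0), ∂ᵢN(0), M, where ⟨N(0), M⟩ = -1. It is
  -- orthogonal to the whole frame, hence zero, and its first coordinate is the discriminant
  -- relation.
  · set v : ℝ × Ambient n := (1, 0) + ∑ i, (dirDeriv (b i) N 0).1 • dirDeriv (b i) N 0 -
      (N 0).1 • M - M.1 • N 0 with hv
    have hone (q : ℝ × Ambient n) : lorentz (1, 0) q = -q.1 := by simp [lorentz]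
    have hNM : lorentz (N 0) M = -1 := by
      rw [hM, hN.lorentz_dirDeriv_dirDeriv, if_pos rfl]
    have hMM : lorentz M M = 0 := hN.lorentz_pure_self hn i₀ 0
    obtain ⟨t, ht⟩ := hN.span 0 v (by
      rw [hv, lorentz_sub_left, lorentz_sub_left, lorentz_add_left, lorentz_sum_left, hone,
        lorentz_smul_left, lorentz_smul_left, hN.null, lorentz_comm M, hNM]
      simp only [lorentz_smul_left]
      simp only [lorentz_comm _ (N 0), hN.lorentz_dirDeriv]
      simp) (by
      intro j
      rw [hv, lorentz_sub_left, lorentz_sub_left, lorentz_add_left, lorentz_sum_left, hone,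
        lorentz_smul_left, lorentz_smul_left, hN.lorentz_dirDeriv, hM, hN.christoffel]
      simp [lorentz_smul_left, hN.flat])
    have hvM : lorentz v M = 0 := by
      rw [hv, lorentz_sub_left, lorentz_sub_left, lorentz_add_left, lorentz_sum_left, hone,
        lorentz_smul_left, lorentz_smul_left, hMM, hNM]
      have (i : Fin n) : lorentz (dirDeriv (b i) N 0) M = 0 := by
        rw [lorentz_comm]; exact hN.christoffel i₀ i₀ i 0
      simp [lorentz_smul_left, this]
    rw [ht, lorentz_smul_left, hNM] at hvM
    have ht0 : t = 0 := by linarith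
    rw [ht0, zero_smul] at ht
    have h1 := congrArg Prod.fst ht
    rw [hv] at h1
    simp only [Prod.fst_sub, Prod.fst_add, Prod.fst_sum, Prod.smul_fst, smul_eq_mul,
      Prod.fst_zero] at h1
    have h2 : ‖β‖ ^ 2 = ∑ i, (dirDeriv (b i) N 0).1 * (dirDeriv (b i) N 0).1 := by
      rw [← b.sum_sq_inner_right β]
      refine Finset.sum_congr rfl fun i _ => ?_
      rw [real_inner_comm, hβi, sq]
    linarith
  -- Subtracting the expected linear and quadratic terms leaves a function with zero second
  -- derivatives and zero first derivatives at 0.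
  · set f : H → ℝ := fun x => (N x).1 - inner ℝ β x - M.1 / 2 * ‖x‖ ^ 2 with hf
    have hfs : ContDiff ℝ ∞ f := by
      refine (hfst.sub (contDiff_const.inner ℝ contDiff_id)).sub
        (contDiff_const.mul (contDiff_id.norm_sq ℝ))
    have hd (i : Fin n) : dirDeriv (b i) f = fun x => (dirDeriv (b i) N x).1 -
        inner ℝ β (b i) - M.1 * inner ℝ x (b i) := by
      ext x
      have h1 := ((hN.smooth.differentiable (by simp) x).hasFDerivAt).fst
      have h2 := (innerSL ℝ β).hasFDerivAt (x := x)
      have h3 := ((hasStrictFDerivAt_norm_sq x).hasFDerivAt).const_mul (M.1 / 2)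
      have h4 := (h1.sub h2).sub h3
      have h5 : HasFDerivAt f _ x := h4
      rw [dirDeriv, h5.fderiv]
      simp [dirDeriv]
      ring
    have hdd (i j : Fin n) (x : H) : dirDeriv (b i) (dirDeriv (b j) f) x =
        (dirDeriv (b i) (dirDeriv (b j) N) x).1 - M.1 * inner ℝ (b i) (b j) := by
      have h1 := (((hs j).differentiable (by simp) x).hasFDerivAt).fst
      have h3 := ((innerSL ℝ (b j)).hasFDerivAt (x := x)).const_mul M.1
      have h4 := (h1.sub_const (inner ℝ β (b j))).sub h3
      have h5 : HasFDerivAt (dirDeriv (b j) f) _ x :=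
        h4.congr_of_eventuallyEq (.of_forall fun y => by
          rw [hd]; simp [dirDeriv, real_inner_comm])
      rw [dirDeriv, h5.fderiv]
      simp [dirDeriv, real_inner_comm]
    have hconst := eq_const_of_dirDeriv_dirDeriv_eq_zero b hfs (fun i j x => by
      rw [hdd, OrthonormalBasis.inner_eq_ite]
      rcases eq_or_ne i j with rfl | hij
      · rw [if_pos rfl, hN.pure_eq_pure hn i i₀, hN.pure_eq_const hn i₀, mul_one, sub_self]
      · rw [if_neg hij, hN.dirDeriv_dirDeriv_of_ne hn hij]; simp) (fun i => by
      rw [hd]; simp [hβi]) x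
    simp only [hf, inner_zero_right, norm_zero] at hconst
    linarith

end IsFlatLift

end LightConeLift

/-! ### From the quadratic lift to the conformal factor on the sphere. -/

section ConformalFactor

variable {n : ℕ}

/-- Since (1, F) is null and orthogonal to its derivatives, scaling it by κ^(-1/2) scales the
induced metric by κ⁻¹, without terms from the derivative of the scale. -/
theorem isFlatLift_of_conformal {H : Type*} [NormedAddCommGroup H] [InnerProductSpace ℝ H]
    (b : OrthonormalBasis (Fin n) ℝ H) (hn : 0 < n) {F : H → Ambient n} (hF : ContDiff ℝ ∞ F)
    (hF1 : ∀ x, ‖F x‖ = 1) {κ : H → ℝ} (hκ : ∀ x, 0 < κ x)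
    (hconf : ∀ x u v, inner ℝ (fderiv ℝ F x u) (fderiv ℝ F x v) = κ x * inner ℝ u v) :
    IsFlatLift b fun x => ((√(κ x))⁻¹, (√(κ x))⁻¹ • F x) := by
  have hκs : ContDiff ℝ ∞ κ := by
    let i₀ : Fin n := ⟨0, hn⟩
    have e : κ = fun x => inner ℝ (dirDeriv (b i₀) F x) (dirDeriv (b i₀) F x) := by
      ext x
      rw [dirDeriv, hconf, OrthonormalBasis.inner_eq_ite, if_pos rfl, mul_one]
    rw [e]
    exact (contDiff_dirDeriv hF _).inner ℝ (contDiff_dirDeriv hF _)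
  set w : H → ℝ := fun x => (√(κ x))⁻¹ with hw
  have hw0 (x : H) : 0 < w x := inv_pos.2 (Real.sqrt_pos.2 (hκ x))
  have hws : ContDiff ℝ ∞ w := by
    refine (hκs.sqrt fun x => (hκ x).ne').inv fun x => (Real.sqrt_pos.2 (hκ x)).ne'
  have hwκ (x : H) : w x ^ 2 * κ x = 1 := by
    rw [hw, inv_pow, Real.sq_sqrt (hκ x).le, inv_mul_cancel₀ (hκ x).ne']
  have hFF (x : H) : inner ℝ (F x) (F x) = (1 : ℝ) := by
    rw [real_inner_self_eq_norm_sq, hF1, one_pow]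
  have hFd (i : Fin n) (x : H) : inner ℝ (F x) (dirDeriv (b i) F x) = 0 := by
    have hd := (hF.differentiable (by simp) x).hasFDerivAt
    have h1 := (hd.inner ℝ hd).fderiv
    have e : (fun x => inner ℝ (F x) (F x)) = fun _ => (1 : ℝ) := funext hFF
    rw [e] at h1
    have h2 := congrArg (fun L => L (b i)) h1
    simp only [fderiv_fun_const, Pi.zero_apply, zero_apply,
      ContinuousLinearMap.comp_apply, ContinuousLinearMap.prod_apply,
      fderivInnerCLM_apply] at h2
    rw [real_inner_comm (F x) (fderiv ℝ F x (b i))] at h2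
    rw [dirDeriv]
    linarith
  have hdd (i j : Fin n) (x : H) : inner ℝ (dirDeriv (b i) F x) (dirDeriv (b j) F x) =
      κ x * if i = j then 1 else 0 := by
    rw [dirDeriv, dirDeriv, hconf, OrthonormalBasis.inner_eq_ite]
  have hdN (i : Fin n) (x : H) : dirDeriv (b i) (fun x => (w x, w x • F x)) x =
      (dirDeriv (b i) w x, dirDeriv (b i) w x • F x + w x • dirDeriv (b i) F x) := by
    have h1 := (hws.differentiable (by simp) x).hasFDerivAt
    have h2 := (hF.differentiable (by simp) x).hasFDerivAt
    have h3 : HasFDerivAt (fun x => (w x, w x • F x)) _ x := h1.prodMk (h1.smul h2)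
    rw [dirDeriv, h3.fderiv]
    simp [dirDeriv, add_comm]
  refine ⟨hws.prodMk (hws.smul hF), fun x => ?_, fun i j x => ?_, fun x v hv hvd => ?_⟩
  · simp only [lorentz, inner_smul_left, inner_smul_right, hFF, RCLike.conj_to_real]
    ring
  · rw [hdN, hdN]
    simp only [lorentz, inner_add_left, inner_add_right, inner_smul_left, inner_smul_right, hFF,
      hFd, hdd, real_inner_comm (F x) (dirDeriv (b i) F x), RCLike.conj_to_real]
    linear_combination (if i = j then (1 : ℝ) else 0) * hwκ x
  · refine ⟨v.1 / w x, ?_⟩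
    have hwx := (hw0 x).ne'
    have h0 : v.2 - v.1 • F x = 0 := by
      have huF : inner ℝ (v.2 - v.1 • F x) (F x) = 0 := by
        simp only [lorentz, inner_smul_right] at hv
        rw [inner_sub_left, inner_smul_left, hFF]
        apply mul_left_cancel₀ hwx
        simp only [RCLike.conj_to_real]
        linarith
      refine eq_zero_of_inner_eq_zero (f := F x) (d := fun i => dirDeriv (b i) F x) ?_ ?_
        (fun i => hFd i x) (fun i j hij => by rw [hdd, if_neg hij, mul_zero]) huF fun i => ?_
      · intro h; have := hF1 x; rw [h, norm_zero] at this; exact zero_ne_one this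
      · intro i h
        have := hdd i i x
        rw [h, inner_zero_left, if_pos rfl, mul_one] at this
        exact (hκ x).ne this
      · have h1 := hvd i
        rw [hdN] at h1
        simp only [lorentz, inner_add_right, inner_smul_right] at h1
        rw [inner_sub_left, inner_smul_left, hFF] at huF
        rw [inner_sub_left, inner_smul_left, hFd]
        apply mul_left_cancel₀ hwx
        simp only [RCLike.conj_to_real] at huF ⊢
        linear_combination h1 - dirDeriv (b i) w x * huF
    rw [sub_eq_zero] at h0
    ext1
    · exact (div_mul_cancel₀ _ hwx).symm
    · rw [Prod.smul_snd, smul_smul, div_mul_cancel₀ _ hwx, h0]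

/-- Inverse stereographic projection from `v`, where `ι` is an isometry onto the orthogonal
complement of `v`. -/
noncomputable def stereoParam (ι : EuclideanSpace ℝ (Fin n) →ₗᵢ[ℝ] Ambient n) (v : Ambient n)
    (x : EuclideanSpace ℝ (Fin n)) : Ambient n :=
  (4 / (‖x‖ ^ 2 + 4)) • (ι x + ((‖x‖ ^ 2 - 4) / 4) • v)

theorem exists_stereoParam (v : Sphere n) : ∃ ι : EuclideanSpace ℝ (Fin n) →ₗᵢ[ℝ] Ambient n,
    (∀ x, inner ℝ (ι x) (v : Ambient n) = 0) ∧
    ∀ p : Sphere n, p ≠ v → ∃ x, stereoParam ι v x = p := by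
  have := Fact.mk (finrank_euclideanSpace_fin (𝕜 := ℝ) (n := n + 1))
  let U : (ℝ ∙ (v : Ambient n))ᗮ ≃ₗᵢ[ℝ] EuclideanSpace ℝ (Fin n) :=
    (OrthonormalBasis.fromOrthogonalSpanSingleton n (ne_zero_of_mem_unit_sphere v)).repr
  let ι : EuclideanSpace ℝ (Fin n) →ₗᵢ[ℝ] Ambient n :=
    (ℝ ∙ (v : Ambient n))ᗮ.subtypeₗᵢ.comp U.symm.toLinearIsometry
  refine ⟨ι, fun x => ?_, fun p hp => ?_⟩
  · have : (ι x : Ambient n) ∈ (ℝ ∙ (v : Ambient n))ᗮ := (U.symm x).2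
    rw [real_inner_comm]
    exact Submodule.mem_orthogonal_singleton_iff_inner_right.1 this
  · refine ⟨stereographic' n v p, ?_⟩
    have h1 := (stereographic' n v).left_inv (x := p) (by simpa using hp)
    conv_rhs => rw [← h1]
    rw [stereographic'_symm_apply]
    have e (x : EuclideanSpace ℝ (Fin n)) : ((U.symm x : (ℝ ∙ (v : Ambient n))ᗮ) : Ambient n) =
        ι x :=
      rfl
    simp only [stereoParam]
    rw [e, ι.norm_map]
    generalize stereographic' n v p = x
    have : ‖x‖ ^ 2 + 4 ≠ 0 := by positivity
    rw [smul_add, smul_smul, smul_smul, smul_smul]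
    congr 2 <;> field_simp

variable {ι : EuclideanSpace ℝ (Fin n) →ₗᵢ[ℝ] Ambient n} {v : Ambient n}

theorem norm_stereoParam (hv : ‖v‖ = 1) (hι : ∀ x, inner ℝ (ι x) v = 0)
    (x : EuclideanSpace ℝ (Fin n)) : ‖stereoParam ι v x‖ = 1 := by
  have h2 : ‖stereoParam ι v x‖ ^ 2 = 1 := by
    rw [stereoParam, norm_smul, mul_pow, norm_add_sq_real, inner_smul_right, hι, norm_smul,
      mul_pow, hv, ι.norm_map, Real.norm_eq_abs, Real.norm_eq_abs, sq_abs, sq_abs]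
    have : ‖x‖ ^ 2 + 4 ≠ 0 := by positivity
    field_simp
    ring
  exact (pow_eq_one_iff_of_nonneg (norm_nonneg _) two_ne_zero).1 h2

theorem contDiff_stereoParam : ContDiff ℝ ∞ (stereoParam ι v) := by
  have h1 : ContDiff ℝ ∞ fun x : EuclideanSpace ℝ (Fin n) => ‖x‖ ^ 2 := contDiff_norm_sq ℝ
  refine ContDiff.smul (contDiff_const.div (h1.add contDiff_const) fun x => by positivity) ?_
  exact ι.contDiff.add (((h1.sub contDiff_const).div_const 4).smul contDiff_const)

theorem inner_fderiv_stereoParam (hv : ‖v‖ = 1) (hι : ∀ x, inner ℝ (ι x) v = 0)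
    (x u w : EuclideanSpace ℝ (Fin n)) :
    inner ℝ (fderiv ℝ (stereoParam ι v) x u) (fderiv ℝ (stereoParam ι v) x w) =
      (4 / (‖x‖ ^ 2 + 4)) ^ 2 * inner ℝ u w := by
  have hs := (hasStrictFDerivAt_norm_sq x).hasFDerivAt
  have h0 : ‖x‖ ^ 2 + 4 ≠ 0 := by positivity
  have h1 := ((hasDerivAt_inv h0).comp_hasFDerivAt x (hs.add_const 4)).const_mul 4
  have h2 := ι.toContinuousLinearMap.hasFDerivAt.add
    (((hs.sub_const 4).mul_const 4⁻¹).smul_const v)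
  have h3 : HasFDerivAt (stereoParam ι v) _ x := (h1.smul h2).congr_of_eventuallyEq
    (.of_forall fun y => by simp [stereoParam, div_eq_mul_inv])
  have hι' (y : EuclideanSpace ℝ (Fin n)) : inner ℝ v (ι y) = (0 : ℝ) := by
    rw [real_inner_comm]; exact hι y
  rw [h3.fderiv]
  simp [inner_add_left, inner_add_right, inner_smul_left, inner_smul_right, hι, hι', hv,
    real_inner_comm x, ι.inner_map_map]
  generalize ‖x‖ ^ 2 = D at h0
  field_simp
  ring

/-- The automorphism is composed with inverse stereographic projection from v, and the quadratic
polynomial of its light cone lift becomes an affine function on the sphere. The chart omits v, so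
only maps avoiding v are covered. -/
theorem IsConformalAut.exists_affine_factor {ψ : Sphere n ≃ₘ^∞⟮𝓡 n, 𝓡 n⟯ Sphere n}
    (hψ : IsConformalAut ψ) (hn : 3 ≤ n) (v : Sphere n) :
    ∃ (A : ℝ) (B : Ambient n), A ^ 2 - ‖B‖ ^ 2 = 1 ∧ ∀ g : ℂ → Sphere n,
      (ContDiff ℝ ∞ fun z => (g z : Ambient n)) → (∀ z, g z ≠ v) → ∀ z h k : ℂ,
      inner ℝ (fderiv ℝ (fun z => (ψ (g z) : Ambient n)) z h)
          (fderiv ℝ (fun z => (ψ (g z) : Ambient n)) z k) =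
        ((A + inner ℝ B (g z : Ambient n)) ^ 2)⁻¹ *
          inner ℝ (fderiv ℝ (fun z => (g z : Ambient n)) z h)
            (fderiv ℝ (fun z => (g z : Ambient n)) z k) := by
  obtain ⟨c, hc0, hc⟩ := hψ.exists_factor
  obtain ⟨ι, hι, hsurj⟩ := exists_stereoParam v
  have hv := mem_sphere_zero_iff_norm.1 v.2
  let σ : EuclideanSpace ℝ (Fin n) → Sphere n := fun x =>
    ⟨stereoParam ι v x, mem_sphere_zero_iff_norm.2 (norm_stereoParam hv hι x)⟩
  have hσ : ContDiff ℝ ∞ fun x => (σ x : Ambient n) := contDiff_stereoParam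
  have hκ (x : EuclideanSpace ℝ (Fin n)) : 0 < c (σ x) * (4 / (‖x‖ ^ 2 + 4)) ^ 2 :=
    mul_pos (hc0 _) (by positivity)
  have hlift := isFlatLift_of_conformal (EuclideanSpace.basisFun (Fin n) ℝ) (by omega)
    (F := fun x => (ψ (σ x) : Ambient n)) (contDiff_coe_diffeomorph_comp ψ hσ)
    (fun x => mem_sphere_zero_iff_norm.1 (ψ (σ x)).2) hκ (fun x u w => by
      rw [hc _ σ hσ x u w, mul_assoc, ← inner_fderiv_stereoParam hv hι])
  obtain ⟨α, γ, β, hdisc, hquad⟩ := hlift.exists_quadratic hn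
  have hvv : inner ℝ (v : Ambient n) (v : Ambient n) = (1 : ℝ) := by
    rw [real_inner_self_eq_norm_sq, hv, one_pow]
  have hι' (y : EuclideanSpace ℝ (Fin n)) : inner ℝ (v : Ambient n) (ι y) = (0 : ℝ) := by
    rw [real_inner_comm]; exact hι y
  -- A and B are read off by writing 4(α + ⟨β,x⟩ + γ|x|²)/(|x|² + 4) in terms of the point p = 4(ιx
  -- + ((|x|² - 4)/4)v)/(|x|² + 4); then A² - |B|² = 4αγ - |β|².
  refine ⟨α / 2 + 2 * γ, ι β + (2 * γ - α / 2) • (v : Ambient n), ?_, fun g hg hgv z h k => ?_⟩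
  · rw [norm_add_sq_real, inner_smul_right, hι, norm_smul, mul_pow, hv, ι.norm_map,
      Real.norm_eq_abs, sq_abs]
    linear_combination hdisc
  · rw [hc _ g hg z h k]
    congr 1
    obtain ⟨x, hx⟩ := hsurj _ (hgv z)
    have hσx : σ x = g z := Subtype.ext hx
    have hq := hquad x
    simp only at hq
    have h0 : ‖x‖ ^ 2 + 4 ≠ 0 := by positivity
    have e : α / 2 + 2 * γ + inner ℝ (ι β + (2 * γ - α / 2) • (v : Ambient n)) (g z : Ambient n) =
        4 / (‖x‖ ^ 2 + 4) * (α + inner ℝ β x + γ * ‖x‖ ^ 2) := by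
      rw [← hx, stereoParam]
      simp only [inner_add_left, inner_add_right, inner_smul_left, inner_smul_right, hι, hι', hvv,
        ι.inner_map_map, RCLike.conj_to_real]
      field_simp
      ring
    rw [e, ← hq, ← hσx, mul_pow, inv_pow, Real.sq_sqrt (hκ x).le]
    have := (hc0 (σ x)).ne'
    field_simp

end ConformalFactor

/-! ### Integration over the torus -/

section TorusIntegration

open MeasureTheory

variable {τ : ℂ}

/-- The real linear map `s + i t ↦ s + t τ`. -/
noncomputable def shear (τ : ℂ) : ℂ →L[ℝ] ℂ :=
  Complex.reCLM.smulRight 1 + Complex.imCLM.smulRight τ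

theorem shear_apply (τ z : ℂ) : shear τ z = z.re + z.im * τ := by
  simp [shear]

theorem det_shear (τ : ℂ) : (shear τ).det = τ.im := by
  rw [ContinuousLinearMap.det, ← LinearMap.det_toMatrix Complex.basisOneI, Matrix.det_fin_two]
  simp [LinearMap.toMatrix_apply, shear_apply]

theorem shear_injective (hy : 0 < τ.im) : Function.Injective (shear τ) := by
  intro z w h
  rw [shear_apply, shear_apply] at h
  have him := congrArg Complex.im h
  have hre := congrArg Complex.re h
  simp at him hre
  have h1 := him.resolve_right hy.ne'
  rw [h1] at hre
  exact Complex.ext (by linarith) h1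

theorem fundamentalParallelogram_eq_image (τ : ℂ) :
    fundamentalParallelogram τ =
      shear τ '' (Set.Ico (0 : ℝ) 1 ×ℂ Set.Ico (0 : ℝ) 1) := by
  ext z
  constructor
  · rintro ⟨s, hs, t, ht, rfl⟩
    exact ⟨⟨s, t⟩, ⟨hs, ht⟩, by rw [shear_apply]⟩
  · rintro ⟨w, ⟨hs, ht⟩, rfl⟩
    exact ⟨w.re, hs, w.im, ht, shear_apply _ _⟩

theorem setLIntegral_fundamentalParallelogram (hy : 0 < τ.im) {h : ℂ → ℝ≥0∞} (hm : Measurable h) :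
    ∫⁻ z in fundamentalParallelogram τ, h z = ENNReal.ofReal τ.im *
      ∫⁻ t in Set.Ioc (0 : ℝ) 1, ∫⁻ s in Set.Ioc (0 : ℝ) 1, h (s + t * τ) := by
  have hS : MeasurableSet (Set.Ico (0 : ℝ) 1 ×ℂ Set.Ico (0 : ℝ) 1) :=
    (measurableSet_Ico.preimage Complex.measurable_re).inter
      (measurableSet_Ico.preimage Complex.measurable_im)
  have hm1 : Measurable fun w => h (shear τ w) := hm.comp (shear τ).continuous.measurable
  rw [fundamentalParallelogram_eq_image, lintegral_image_eq_lintegral_abs_det_fderiv_mul volume hS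
    (fun z _ => (shear τ).hasFDerivAt.hasFDerivWithinAt) (shear_injective hy).injOn]
  rw [det_shear, abs_of_pos hy, lintegral_const_mul _ hm1]
  congr 1
  have hp := Complex.volume_preserving_equiv_real_prod.symm
  rw [← hp.setLIntegral_comp_preimage hS hm1]
  have hpre : Complex.measurableEquivRealProd.symm ⁻¹' (Set.Ico (0 : ℝ) 1 ×ℂ Set.Ico (0 : ℝ) 1) =
      Set.Ico (0 : ℝ) 1 ×ˢ Set.Ico (0 : ℝ) 1 := by
    ext p; rfl
  rw [hpre, Measure.volume_eq_prod, ← Measure.prod_restrict,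
    restrict_Ico_eq_restrict_Ioc, lintegral_prod_symm]
  · refine lintegral_congr fun t => lintegral_congr fun s => ?_
    rw [shear_apply]
    rfl
  · exact (hm1.comp Complex.measurableEquivRealProd.symm.measurable).aemeasurable

theorem lintegral_unitSquare_ofReal {h : ℝ → ℝ → ℝ} (hc : Continuous (Function.uncurry h))
    (h0 : ∀ s t, 0 ≤ h s t) :
    ∫⁻ t in Set.Ioc (0 : ℝ) 1, ∫⁻ s in Set.Ioc (0 : ℝ) 1, ENNReal.ofReal (h s t) =
      ENNReal.ofReal (∫ t in (0 : ℝ)..1, ∫ s in (0 : ℝ)..1, h s t) := by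
  have hone {k : ℝ → ℝ} (hk : Continuous k) (hk0 : ∀ s, 0 ≤ k s) :
      ∫⁻ s in Set.Ioc (0 : ℝ) 1, ENNReal.ofReal (k s) =
        ENNReal.ofReal (∫ s in (0 : ℝ)..1, k s) := by
    rw [intervalIntegral.integral_of_le zero_le_one,
      ofReal_integral_eq_lintegral_ofReal _ (.of_forall hk0)]
    exact (hk.integrableOn_Icc (a := 0) (b := 1)).mono_set Set.Ioc_subset_Icc_self
  have hin (t : ℝ) := hone (k := fun s => h s t)
    (hc.comp (continuous_id.prodMk continuous_const)) (h0 · t)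
  simp_rw [hin]
  apply hone
  · exact intervalIntegral.continuous_parametric_intervalIntegral_of_continuous'
      (f := fun t s => h s t) (hc.comp continuous_swap) _ _
  · exact fun t => intervalIntegral.integral_nonneg zero_le_one fun s _ => h0 s t

theorem enorm_sq_eq_ofReal {V : Type*} [NormedAddCommGroup V] (v : V) :
    ‖v‖ₑ ^ 2 = ENNReal.ofReal (‖v‖ ^ 2) := by
  rw [ENNReal.ofReal_pow (norm_nonneg _), ofReal_norm]

/-- The vector-valued Poincaré inequality for maps on `ℂ` with periods `1` and `τ`. -/
theorem poincare_of_periodic {n : ℕ} {G : ℂ → Ambient n} (hG : ContDiff ℝ ∞ G)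
    (h1 : ∀ z, G (z + 1) = G z) (hτ : ∀ z, G (z + τ) = G z)
    (hmean : ∀ i, ∫ t in (0 : ℝ)..1, ∫ s in (0 : ℝ)..1, G (s + t * τ) i = 0) :
    ENNReal.ofReal (8 * Real.pi ^ 2) *
        ∫⁻ t in Set.Ioc (0 : ℝ) 1, ∫⁻ s in Set.Ioc (0 : ℝ) 1, ‖G (s + t * τ)‖ₑ ^ 2 ≤
      ∫⁻ t in Set.Ioc (0 : ℝ) 1, ∫⁻ s in Set.Ioc (0 : ℝ) 1,
        (‖fderiv ℝ G (s + t * τ) 1‖ₑ ^ 2 + ‖fderiv ℝ G (s + t * τ) τ‖ₑ ^ 2 +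
          ‖fderiv ℝ G (s + t * τ) 1 - fderiv ℝ G (s + t * τ) τ‖ₑ ^ 2) := by
  have hnorm (v : Ambient n) : ‖v‖ₑ ^ 2 = ∑ i, ‖((v i : ℝ) : ℂ)‖ₑ ^ 2 := by
    simp only [enorm_sq_eq_ofReal]
    rw [EuclideanSpace.norm_sq_eq, ENNReal.ofReal_sum_of_nonneg fun i _ => by positivity]
    simp
  have hline : Continuous fun p : ℝ × ℝ => (p.1 : ℂ) + p.2 * τ := by fun_prop
  have hdG (v : ℂ) : Continuous fun z => fderiv ℝ G z v :=
    (hG.continuous_fderiv (by simp)).clm_apply continuous_const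
  have hcoord {K : ℂ → Ambient n} (hK : Continuous K) (i : Fin (n + 1)) :
      Continuous (Function.uncurry fun s t : ℝ => ((K (s + t * τ) i : ℝ) : ℂ)) := by
    have : Continuous fun p : ℝ × ℝ => K (p.1 + p.2 * τ) := hK.comp hline
    exact Complex.continuous_ofReal.comp
      ((EuclideanSpace.proj (𝕜 := ℝ) i).continuous.comp this)
  have hder (i : Fin (n + 1)) (z v : ℂ) (c : ℝ → ℂ) (x : ℝ) (hc : HasDerivAt c v x) (hz : c x = z) :
      HasDerivAt (fun x => ((G (c x) i : ℝ) : ℂ)) ((fderiv ℝ G z v i : ℝ) : ℂ) x := by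
    subst hz
    have a := (hG.differentiable (by simp) (c x)).hasFDerivAt.comp_hasDerivAt x hc
    have b := (EuclideanSpace.proj (𝕜 := ℝ) i : Ambient n →L[ℝ] ℝ).hasFDerivAt.comp_hasDerivAt
      x a
    exact b.ofReal_comp
  have hmeas {K : ℂ → Ambient n} (hK : Continuous K) (i : Fin (n + 1)) :
      Measurable fun p : ℝ × ℝ => ‖((K (p.2 + p.1 * τ) i : ℝ) : ℂ)‖ₑ ^ 2 :=
    ((hcoord hK i).comp continuous_swap).enorm.measurable.pow_const 2
  have hsum {w : Fin (n + 1) → ℝ → ℝ → ℝ≥0∞}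
      (hw : ∀ i, Measurable fun p : ℝ × ℝ => w i p.2 p.1) :
      ∫⁻ t in Set.Ioc (0 : ℝ) 1, ∫⁻ s in Set.Ioc (0 : ℝ) 1, ∑ i, w i s t =
      ∑ i, ∫⁻ t in Set.Ioc (0 : ℝ) 1, ∫⁻ s in Set.Ioc (0 : ℝ) 1, w i s t := by
    have (t : ℝ) : ∫⁻ s in Set.Ioc (0 : ℝ) 1, ∑ i, w i s t =
        ∑ i, ∫⁻ s in Set.Ioc (0 : ℝ) 1, w i s t :=
      lintegral_finsetSum _ fun i _ => (hw i).comp (measurable_const.prodMk measurable_id)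
    simp_rw [this]
    exact lintegral_finsetSum _ fun i _ => (hw i).lintegral_prod_right'
  simp only [hnorm, ← Finset.sum_add_distrib]
  rw [hsum (hmeas hG.continuous), Finset.mul_sum, hsum]
  · refine Finset.sum_le_sum fun i _ => ?_
    have key := hexagonal_poincare (g := fun s t : ℝ => ((G (s + t * τ) i : ℝ) : ℂ))
      (g₁ := fun s t : ℝ => ((fderiv ℝ G (s + t * τ) 1 i : ℝ) : ℂ))
      (g₂ := fun s t : ℝ => ((fderiv ℝ G (s + t * τ) τ i : ℝ) : ℂ))
      (hcoord hG.continuous i) (hcoord (hdG 1) i) (hcoord (hdG τ) i)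
      (fun s t => hder i _ 1 (fun s : ℝ => (s : ℂ) + t * τ) s
        ((Complex.ofRealCLM.hasDerivAt (x := s)).add_const _) rfl)
      (fun s t => hder i _ τ (fun t : ℝ => (s : ℂ) + t * τ) t
        (by
          simpa using ((Complex.ofRealCLM.hasDerivAt (x := t)).mul_const τ).const_add (s : ℂ))
        rfl)
      (fun t => by
        have := h1 (t * τ)
        rw [add_comm] at this
        simp [this])
      (fun s => by simp [hτ])
      (by
        simp only [intervalIntegral.integral_ofReal]
        rw [hmean i, Complex.ofReal_zero])
    simpa using key
  · intro i
    refine ((hmeas (hdG 1) i).add (hmeas (hdG τ) i)).add ?_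
    exact hmeas ((hdG 1).sub (hdG τ)) i

end TorusIntegration

/-! ### The lower bound for the conformal volume -/

section LowerBound

open MeasureTheory

variable {τ : ℂ} {n : ℕ}

theorem areaDensity_of_conformal {F : ℂ → Ambient n} {z : ℂ} {c : ℝ} (hc : 0 ≤ c)
    (h : ∀ v w : ℂ, inner ℝ (fderiv ℝ F z v) (fderiv ℝ F z w) = c * inner ℝ v w) :
    areaDensity F z = c := by
  have h1 : ‖fderiv ℝ F z 1‖ ^ 2 = c := by
    rw [← real_inner_self_eq_norm_sq, h]; simp
  have h2 : ‖fderiv ℝ F z Complex.I‖ ^ 2 = c := by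
    rw [← real_inner_self_eq_norm_sq, h]; simp
  have h3 : inner ℝ (fderiv ℝ F z 1) (fderiv ℝ F z Complex.I) = 0 := by
    rw [h]; simp [Complex.inner]
  rw [areaDensity, h1, h2, h3, ← sq, zero_pow two_ne_zero, sub_zero, Real.sqrt_sq hc]

theorem measurable_areaDensity {F : ℂ → Ambient n} (hF : ContDiff ℝ ∞ F) :
    Measurable fun z => ENNReal.ofReal (areaDensity F z) := by
  have h (v : ℂ) : Continuous fun z => fderiv ℝ F z v :=
    (hF.continuous_fderiv (by simp)).clm_apply continuous_const
  refine ENNReal.measurable_ofReal.comp (Continuous.measurable ?_)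
  exact ((((h 1).norm.pow 2).mul ((h Complex.I).norm.pow 2)).sub
    (((h 1).inner (h Complex.I)).pow 2)).sqrt

theorem periodicLift_add_one (f : Torus τ → Sphere n) (z : ℂ) :
    periodicLift f (z + 1) = periodicLift f z := by
  have h : (1 : ℂ) ∈ lattice τ := AddSubgroup.subset_closure (by simp)
  unfold periodicLift
  congr 2
  exact QuotientAddGroup.mk_add_of_mem z h

theorem periodicLift_add_self (f : Torus τ → Sphere n) (z : ℂ) :
    periodicLift f (z + τ) = periodicLift f z := by
  have h : τ ∈ lattice τ := AddSubgroup.subset_closure (by simp)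
  unfold periodicLift
  congr 2
  exact QuotientAddGroup.mk_add_of_mem z h

theorem norm_periodicLift (f : Torus τ → Sphere n) (z : ℂ) : ‖periodicLift f z‖ = 1 :=
  mem_sphere_zero_iff_norm.1 (f z).2

theorem countable_lattice (τ : ℂ) : (lattice τ : Set ℂ).Countable := by
  refine (Set.countable_range fun p : ℤ × ℤ => p.1 • (1 : ℂ) + p.2 • τ).mono fun z hz => ?_
  obtain ⟨m, k, h⟩ := AddSubgroup.mem_closure_pair.1 hz
  exact ⟨(m, k), h⟩

theorem countable_branchPoints {f : Torus τ → Sphere n} (hf : IsBranchedConformal f) :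
    {z : ℂ | ¬ Function.Injective (fderiv ℝ (periodicLift f) z)}.Countable := by
  have h : {z : ℂ | ¬ Function.Injective (fderiv ℝ (periodicLift f) z)} ⊆
      ⋃ p ∈ {p : Torus τ | ∃ z : ℂ, QuotientAddGroup.mk z = p ∧
        ¬ Function.Injective (fderiv ℝ (periodicLift f) z)},
        (QuotientAddGroup.mk ⁻¹' {p} : Set ℂ) := by
    intro z hz
    simp only [Set.mem_iUnion]
    exact ⟨_, ⟨z, rfl, hz⟩, rfl⟩
  refine Set.Countable.mono h (hf.branched.countable.biUnion fun p _ => ?_)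
  obtain ⟨w, rfl⟩ := QuotientAddGroup.mk_surjective p
  refine ((countable_lattice τ).image fun l => w + l).mono fun z hz => ?_
  exact ⟨-w + z, QuotientAddGroup.eq.1 (Eq.symm hz), by simp⟩

/-- Where the derivative is injective, points of a fibre are isolated in it. The other points form a
countable set. -/
theorem volume_fiber_eq_zero {E V : Type*} [NormedAddCommGroup E] [NormedSpace ℝ E]
    [FiniteDimensional ℝ E] [MeasureSpace E] [NullSingletonClass (volume : Measure E)]
    [NormedAddCommGroup V] [NormedSpace ℝ V]
    {G : E → V} (hG : Differentiable ℝ G)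
    (hB : {x | ¬ Function.Injective (fderiv ℝ G x)}.Countable) (q : V) :
    volume {x | G x = q} = 0 := by
  set B := {x | ¬ Function.Injective (fderiv ℝ G x)} with hBdef
  have hnull : volume ({x | G x = q} \ B) = 0 := by
    have := FiniteDimensional.proper_real E
    have : SecondCountableTopology E := secondCountable_of_proper
    refine measure_null_of_locally_null _ fun x hx => ⟨{x}, ?_, measure_singleton x⟩
    have hinj : Function.Injective (fderiv ℝ G x) := not_not.1 hx.2
    obtain ⟨K, -, hK⟩ := (fderiv ℝ G x : E →ₗ[ℝ] V).exists_antilipschitzWith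
      (LinearMap.ker_eq_bot.2 hinj)
    have h := (hG x).hasFDerivAt.eventually_ne (c := q) ⟨K, hK⟩
    rw [eventually_nhdsWithin_iff] at h
    rw [mem_nhdsWithin_iff_eventually]
    filter_upwards [h] with y hy hyS
    by_contra hne
    exact hy hne hyS.1
  refine measure_mono_null (t := ({x | G x = q} \ B) ∪ B) (fun x hx => ?_)
    (measure_union_null hnull (hB.measure_zero volume))
  by_cases hxB : x ∈ B
  exacts [Or.inr hxB, Or.inl ⟨hx, hxB⟩]

/-- Lebesgue measure on the unit square. -/
noncomputable def squareMeasure : Measure (ℝ × ℝ) :=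
  (volume.restrict (Set.Ioc (0 : ℝ) 1)).prod (volume.restrict (Set.Ioc (0 : ℝ) 1))

instance : IsProbabilityMeasure (volume.restrict (Set.Ioc (0 : ℝ) 1)) :=
  ⟨by simp⟩

instance : IsProbabilityMeasure squareMeasure := by
  unfold squareMeasure; infer_instance

theorem integral_squareMeasure {V : Type*} [NormedAddCommGroup V] [NormedSpace ℝ V]
    {K : ℝ × ℝ → V} (hK : Continuous K) :
    Integrable K squareMeasure ∧
    ∫ p, K p ∂squareMeasure = ∫ t in (0 : ℝ)..1, ∫ s in (0 : ℝ)..1, K (t, s) := by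
  have hint : Integrable K squareMeasure := by
    rw [squareMeasure, Measure.prod_restrict]
    exact (hK.continuousOn.integrableOn_compact (isCompact_Icc.prod isCompact_Icc)).mono_set
      (Set.prod_mono Set.Ioc_subset_Icc_self Set.Ioc_subset_Icc_self)
  refine ⟨hint, ?_⟩
  simp_rw [intervalIntegral.integral_of_le (zero_le_one (α := ℝ))]
  exact integral_prod K hint

/-- Finitely many branch points on the torus lift to countably many in ℂ, so the image of the
uniform measure has no atoms and can be balanced by a dilation. -/
theorem exists_balanced_conformalAut (hy : 0 < τ.im) {f : Torus τ → Sphere n}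
    (hf : IsBranchedConformal f) :
    ∃ ψ : Sphere n ≃ₘ^∞⟮𝓡 n, 𝓡 n⟯ Sphere n, IsConformalAut ψ ∧
      ∀ i, ∫ t in (0 : ℝ)..1, ∫ s in (0 : ℝ)..1,
        periodicLift (fun p => ψ (f p)) (s + t * τ) i = 0 := by
  let ℓ : ℝ × ℝ →L[ℝ] ℂ := (ContinuousLinearMap.fst ℝ ℝ ℝ).smulRight τ +
    (ContinuousLinearMap.snd ℝ ℝ ℝ).smulRight 1
  have hℓ (p : ℝ × ℝ) : ℓ p = p.2 + p.1 * τ := by simp [ℓ, add_comm]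
  have hℓinj : Function.Injective ℓ := by
    intro p q h
    rw [hℓ, hℓ] at h
    have him := congrArg Complex.im h
    have hre := congrArg Complex.re h
    simp at him hre
    have h1 := him.resolve_right hy.ne'
    rw [h1] at hre
    exact Prod.ext h1 (by linarith)
  let g : ℝ × ℝ → Ambient n := fun p => periodicLift f (ℓ p)
  have hFd : Differentiable ℝ (periodicLift f) := hf.smooth.differentiable (by simp)
  have hgd : Differentiable ℝ g := hFd.comp ℓ.differentiable
  have hB : {p | ¬ Function.Injective (fderiv ℝ g p)}.Countable := by
    refine Set.Countable.mono ?_ ((countable_branchPoints hf).preimage_of_injOn hℓinj.injOn)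
    intro p hp hinj
    apply hp
    have h := ((hFd (ℓ p)).hasFDerivAt.comp p ℓ.hasFDerivAt).fderiv
    have e : fderiv ℝ g p = (fderiv ℝ (periodicLift f) (ℓ p)).comp ℓ := h
    rw [e]
    exact hinj.comp hℓinj
  have hatom (q : Ambient n) : squareMeasure {p | g p = q} = 0 := by
    rw [squareMeasure, Measure.prod_restrict]
    exact measure_mono_null (le_refl _) (le_antisymm
      ((Measure.restrict_apply_le _ _).trans (volume_fiber_eq_zero hgd hB q).le) bot_le)
  obtain ⟨a, ha, hbal⟩ := exists_balancing_point (μ := squareMeasure) hgd.continuous.measurable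
    (fun p => norm_periodicLift f (ℓ p)) hatom
  refine ⟨dilation ha, isConformalAut_dilation ha, fun i => ?_⟩
  have hcont : Continuous fun p : ℝ × ℝ =>
      periodicLift (fun p => dilation ha (f p)) (p.2 + p.1 * τ) := by
    have : Continuous fun z => periodicLift (fun p => dilation ha (f p)) z :=
      (contDiff_coe_diffeomorph_comp (dilation ha) (g := fun z : ℂ => f z) hf.smooth).continuous
    exact this.comp (by fun_prop)
  have hI := integral_squareMeasure hcont
  have hzero : ∫ p, periodicLift (fun p => dilation ha (f p)) (p.2 + p.1 * τ) ∂squareMeasure =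
      0 := by
    refine Eq.trans ?_ hbal
    refine integral_congr_ae (.of_forall fun p => ?_)
    simp only [g, hℓ]
    rfl
  have hi := integral_squareMeasure
    ((EuclideanSpace.proj (𝕜 := ℝ) i : Ambient n →L[ℝ] ℝ).continuous.comp hcont)
  have h2 := (EuclideanSpace.proj (𝕜 := ℝ) i : Ambient n →L[ℝ] ℝ).integral_comp_comm hI.1
  rw [hzero, map_zero] at h2
  exact hi.2.symm.trans h2

/-- This links the hexagonal energy to area: |1|² + |τ|² + |1 - τ|² = 2(y² + x² - x + 1). -/
theorem enorm_sq_add_enorm_sq_of_conformal {V : Type*} [NormedAddCommGroup V]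
    [InnerProductSpace ℝ V] {L : ℂ →L[ℝ] V} {c : ℝ}
    (h : ∀ v w, inner ℝ (L v) (L w) = c * inner ℝ v w) (τ : ℂ) :
    ‖L 1‖ₑ ^ 2 + ‖L τ‖ₑ ^ 2 + ‖L 1 - L τ‖ₑ ^ 2 =
      ENNReal.ofReal (2 * (τ.im ^ 2 + τ.re ^ 2 - τ.re + 1)) * ENNReal.ofReal c := by
  have hn (v : ℂ) : ‖L v‖ ^ 2 = c * (v.re ^ 2 + v.im ^ 2) := by
    rw [← real_inner_self_eq_norm_sq, h, real_inner_self_eq_norm_sq, Complex.sq_norm,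
      Complex.normSq_apply]
    ring
  have hD : 0 ≤ τ.im ^ 2 + τ.re ^ 2 - τ.re + 1 := by nlinarith [sq_nonneg (τ.re - 1)]
  rw [← map_sub, enorm_sq_eq_ofReal, enorm_sq_eq_ofReal, enorm_sq_eq_ofReal,
    ← ENNReal.ofReal_add (sq_nonneg _) (sq_nonneg _),
    ← ENNReal.ofReal_add (add_nonneg (sq_nonneg _) (sq_nonneg _)) (sq_nonneg _),
    ← ENNReal.ofReal_mul (mul_nonneg zero_le_two hD), hn, hn, hn]
  congr 1
  simp only [Complex.one_re, Complex.one_im, Complex.sub_re, Complex.sub_im]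
  ring

theorem area_lower_bound (hy : 0 < τ.im) {f : Torus τ → Sphere n}
    (hs : ContDiff ℝ ∞ (periodicLift f))
    (hconf : ∀ z : ℂ, ∃ c : ℝ, 0 ≤ c ∧ ∀ v w : ℂ,
      inner ℝ (fderiv ℝ (periodicLift f) z v) (fderiv ℝ (periodicLift f) z w) = c * inner ℝ v w)
    (hmean : ∀ i, ∫ t in (0 : ℝ)..1, ∫ s in (0 : ℝ)..1, periodicLift f (s + t * τ) i = 0) :
    ENNReal.ofReal (4 * Real.pi ^ 2 * τ.im / (τ.im ^ 2 + τ.re ^ 2 - τ.re + 1)) ≤ area f := by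
  have hden : 0 < τ.im ^ 2 + τ.re ^ 2 - τ.re + 1 := by nlinarith [sq_nonneg (τ.re - 1)]
  have hpt (z : ℂ) : ‖fderiv ℝ (periodicLift f) z 1‖ₑ ^ 2 + ‖fderiv ℝ (periodicLift f) z τ‖ₑ ^ 2 +
      ‖fderiv ℝ (periodicLift f) z 1 - fderiv ℝ (periodicLift f) z τ‖ₑ ^ 2 =
      ENNReal.ofReal (2 * (τ.im ^ 2 + τ.re ^ 2 - τ.re + 1)) *
        ENNReal.ofReal (areaDensity (periodicLift f) z) := by
    obtain ⟨c, hc, h⟩ := hconf z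
    rw [areaDensity_of_conformal hc h, enorm_sq_add_enorm_sq_of_conformal h]
  have key := poincare_of_periodic hs (periodicLift_add_one f) (periodicLift_add_self f) hmean
  have hm : Measurable fun z => ENNReal.ofReal (areaDensity (periodicLift f) z) :=
    measurable_areaDensity hs
  rw [area, setLIntegral_fundamentalParallelogram hy hm]
  simp only [hpt] at key
  simp only [enorm_sq_eq_ofReal, norm_periodicLift] at key
  generalize hG : (fun z => ENNReal.ofReal (areaDensity (periodicLift f) z)) = G at hm
  have hG' (z : ℂ) : ENNReal.ofReal (areaDensity (periodicLift f) z) = G z := congrFun hG z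
  simp only [hG'] at key ⊢
  clear hpt hG hG' hmean hs hconf
  generalize τ.im ^ 2 + τ.re ^ 2 - τ.re + 1 = D at *
  have hline : Continuous fun p : ℝ × ℝ => (p.2 : ℂ) + p.1 * τ := by fun_prop
  have hm2 : Measurable fun p : ℝ × ℝ => G (p.2 + p.1 * τ) := hm.comp hline.measurable
  have hin (t : ℝ) : ∫⁻ s in Set.Ioc (0 : ℝ) 1, ENNReal.ofReal (2 * D) * G (s + t * τ) =
      ENNReal.ofReal (2 * D) * ∫⁻ s in Set.Ioc (0 : ℝ) 1, G (s + t * τ) :=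
    lintegral_const_mul _ (hm2.comp (measurable_const.prodMk measurable_id))
  simp only [hin] at key
  rw [lintegral_const_mul _ hm2.lintegral_prod_right'] at key
  generalize ∫⁻ t in Set.Ioc (0 : ℝ) 1, ∫⁻ s in Set.Ioc (0 : ℝ) 1, G (s + t * τ) = I at *
  have e : 4 * Real.pi ^ 2 * τ.im / D = τ.im * (1 / (2 * D) * (8 * Real.pi ^ 2)) := by
    field_simp; ring
  rw [e, ENNReal.ofReal_mul hy.le, ENNReal.ofReal_mul (by positivity)]
  gcongr
  calc _ ≤ ENNReal.ofReal (1 / (2 * D)) * (ENNReal.ofReal (2 * D) * I) := by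
        gcongr; simpa using key
    _ = I := by
      rw [← mul_assoc, ← ENNReal.ofReal_mul (by positivity), one_div_mul_cancel (by positivity),
        ENNReal.ofReal_one, one_mul]

theorem conformalVolume_lower_bound (hy : 0 < τ.im) {f : Torus τ → Sphere n}
    (hf : IsBranchedConformal f) :
    ENNReal.ofReal (4 * Real.pi ^ 2 * τ.im / (τ.im ^ 2 + τ.re ^ 2 - τ.re + 1)) ≤
      mapConformalVolume f := by
  obtain ⟨ψ, hψ, hmean⟩ := exists_balanced_conformalAut hy hf
  obtain ⟨c, hc0, hc⟩ := hψ.exists_factor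
  refine le_trans ?_ (le_iSup₂ (f := fun (ψ : Sphere n ≃ₘ^∞⟮𝓡 n, 𝓡 n⟯ Sphere n)
    (_ : IsConformalAut ψ) => area fun p => ψ (f p)) ψ hψ)
  refine area_lower_bound hy (contDiff_coe_diffeomorph_comp ψ (g := fun z : ℂ => f z) hf.smooth)
    (fun z => ?_) hmean
  obtain ⟨k, hk, h⟩ := hf.conformal z
  refine ⟨c (f z) * k, mul_nonneg (hc0 _).le hk, fun v w => ?_⟩
  rw [mul_assoc, ← h]
  exact hc ℂ (fun z : ℂ => f z) hf.smooth z v w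

end LowerBound

/-! ### Calculus of the fundamental homothetic immersion -/

section FundamentalImmersion

open MeasureTheory

variable {τ : ℂ} {n : ℕ}

theorem InFundamentalRegion.im_pos (h : InFundamentalRegion τ) : 0 < τ.im :=
  lt_of_le_of_ne ((Real.sqrt_nonneg _).trans h.le_im) h.im_ne_zero.symm

/-- In the region y² + x² - x ≥ 1/2, and m/(m + 1) ≥ 1/3 for m ≥ 1/2. -/
theorem InFundamentalRegion.r₁_ge (h : InFundamentalRegion τ) : 1 / 3 ≤ r₁ τ := by
  rw [r₁, le_div_iff₀ h.den_pos, den]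
  linarith [h.im_sq, h.re_le_half]

theorem InFundamentalRegion.r₂_nonneg (h : InFundamentalRegion τ) : 0 ≤ r₂ τ :=
  div_nonneg (by linarith [h.re_le_half]) h.den_pos.le

theorem InFundamentalRegion.r₃_nonneg (h : InFundamentalRegion τ) : 0 ≤ r₃ τ :=
  div_nonneg h.re_nonneg h.den_pos.le

theorem InFundamentalRegion.r_sum (h : InFundamentalRegion τ) : r₁ τ + r₂ τ + r₃ τ = 1 := by
  unfold r₁ r₂ r₃
  rw [← add_div, ← add_div, div_eq_one_iff_eq h.den_pos.ne']
  unfold den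
  ring

/-- Both sides say y² + x² - x ≤ 2. -/
theorem r₁_le_two_thirds_iff (h : InFundamentalRegion τ) :
    r₁ τ ≤ 2 / 3 ↔ ‖τ - 1 / 2‖ ≤ 3 / 2 := by
  have hn : ‖τ - 1 / 2‖ ^ 2 = (τ.re - 1 / 2) ^ 2 + τ.im ^ 2 := by
    rw [Complex.sq_norm, Complex.normSq_apply]
    simp
    ring
  rw [r₁, div_le_iff₀ h.den_pos, ← pow_le_pow_iff_left₀ (norm_nonneg _) (by norm_num) two_ne_zero,
    hn, den]
  constructor <;> intro h <;> linarith

theorem hasFDerivAt_mul_cos (a : ℝ) (ℓ : ℂ →L[ℝ] ℝ) (z : ℂ) :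
    HasFDerivAt (fun z => a * Real.cos (2 * Real.pi * ℓ z))
      ((-(a * (2 * Real.pi) * Real.sin (2 * Real.pi * ℓ z))) • ℓ) z := by
  have h := ((ℓ.hasFDerivAt (x := z)).const_mul (2 * Real.pi)).cos.const_mul a
  refine h.congr_fderiv ?_
  ext v
  simp
  ring

theorem hasFDerivAt_mul_sin (a : ℝ) (ℓ : ℂ →L[ℝ] ℝ) (z : ℂ) :
    HasFDerivAt (fun z => a * Real.sin (2 * Real.pi * ℓ z))
      ((a * (2 * Real.pi) * Real.cos (2 * Real.pi * ℓ z)) • ℓ) z := by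
  have h := ((ℓ.hasFDerivAt (x := z)).const_mul (2 * Real.pi)).sin.const_mul a
  refine h.congr_fderiv ?_
  ext v
  simp
  ring

/-- The three linear phases of the fundamental immersion, divided by `2π`. -/
noncomputable def phase (τ : ℂ) : Fin 3 → ℂ →L[ℝ] ℝ :=
  ![τ.im⁻¹ • Complex.imCLM, Complex.reCLM - (τ.re / τ.im) • Complex.imCLM,
    Complex.reCLM - ((τ.re - 1) / τ.im) • Complex.imCLM]

theorem fundamentalVector_eq (τ z : ℂ) : fundamentalVector τ z =
    !₂[√(r₁ τ) * Real.cos (2 * Real.pi * phase τ 0 z),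
     √(r₁ τ) * Real.sin (2 * Real.pi * phase τ 0 z),
     √(r₂ τ) * Real.cos (2 * Real.pi * phase τ 1 z),
     √(r₂ τ) * Real.sin (2 * Real.pi * phase τ 1 z),
     √(r₃ τ) * Real.cos (2 * Real.pi * phase τ 2 z),
     √(r₃ τ) * Real.sin (2 * Real.pi * phase τ 2 z)] := by
  have h0 : phase τ 0 z = z.im / τ.im := by simp [phase]; ring
  have h1 : phase τ 1 z = z.re - z.im * τ.re / τ.im := by simp [phase]; ring
  have h2 : phase τ 2 z = z.re - z.im * (τ.re - 1) / τ.im := by simp [phase]; ring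
  rw [h0, h1, h2, fundamentalVector]

theorem hasFDerivAt_fundamentalVector_apply (τ z : ℂ) :
    ∀ i, HasFDerivAt (fun z => fundamentalVector τ z i)
    ((![-(√(r₁ τ) * (2 * Real.pi) * Real.sin (2 * Real.pi * phase τ 0 z)),
     √(r₁ τ) * (2 * Real.pi) * Real.cos (2 * Real.pi * phase τ 0 z),
     -(√(r₂ τ) * (2 * Real.pi) * Real.sin (2 * Real.pi * phase τ 1 z)),
     √(r₂ τ) * (2 * Real.pi) * Real.cos (2 * Real.pi * phase τ 1 z),
     -(√(r₃ τ) * (2 * Real.pi) * Real.sin (2 * Real.pi * phase τ 2 z)),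
     √(r₃ τ) * (2 * Real.pi) * Real.cos (2 * Real.pi * phase τ 2 z)] i) •
      (![phase τ 0, phase τ 0, phase τ 1, phase τ 1, phase τ 2, phase τ 2] i)) z := by
  simp only [fundamentalVector_eq]
  intro i
  fin_cases i
  exacts [hasFDerivAt_mul_cos _ _ _, hasFDerivAt_mul_sin _ _ _, hasFDerivAt_mul_cos _ _ _,
    hasFDerivAt_mul_sin _ _ _, hasFDerivAt_mul_cos _ _ _, hasFDerivAt_mul_sin _ _ _]

theorem contDiff_fundamentalVector (τ : ℂ) : ContDiff ℝ ∞ (fundamentalVector τ) := by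
  rw [contDiff_euclidean]
  simp only [fundamentalVector_eq]
  have hc (a : ℝ) (ℓ : ℂ →L[ℝ] ℝ) :
      ContDiff ℝ ∞ fun z => a * Real.cos (2 * Real.pi * ℓ z) := by fun_prop
  have hs (a : ℝ) (ℓ : ℂ →L[ℝ] ℝ) :
      ContDiff ℝ ∞ fun z => a * Real.sin (2 * Real.pi * ℓ z) := by fun_prop
  intro i
  fin_cases i
  exacts [hc _ _, hs _ _, hc _ _, hs _ _, hc _ _, hs _ _]

theorem inner_fderiv_fundamentalVector (h : InFundamentalRegion τ) (z v w : ℂ) :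
    inner ℝ (fderiv ℝ (fundamentalVector τ) z v) (fderiv ℝ (fundamentalVector τ) z w) =
      4 * Real.pi ^ 2 / den τ * inner ℝ v w := by
  have hd : DifferentiableAt ℝ (fundamentalVector τ) z :=
    (contDiff_fundamentalVector τ).differentiable (by simp) z
  have hi (i : Fin 6) (v : ℂ) : fderiv ℝ (fundamentalVector τ) z v i = _ :=
    DFunLike.congr_fun ((((EuclideanSpace.proj (𝕜 := ℝ) i : Ambient 5 →L[ℝ] ℝ).hasFDerivAt.comp z
      hd.hasFDerivAt)).unique (hasFDerivAt_fundamentalVector_apply τ z i)) v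
  have h1 : 0 ≤ r₁ τ := by linarith [h.r₁_ge]
  rw [PiLp.inner_apply, Fin.sum_univ_six]
  simp only [hi]
  have e0 (v : ℂ) : phase τ 0 v = v.im / τ.im := by simp [phase]; ring
  have e1 (v : ℂ) : phase τ 1 v = v.re - τ.re / τ.im * v.im := by simp [phase]
  have e2 (v : ℂ) : phase τ 2 v = v.re - (τ.re - 1) / τ.im * v.im := by simp [phase]
  have s1 := Real.sq_sqrt h1
  have s2 := Real.sq_sqrt h.r₂_nonneg
  have s3 := Real.sq_sqrt h.r₃_nonneg
  have c1 := Real.sin_sq_add_cos_sq (2 * Real.pi * phase τ 0 z)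
  have c2 := Real.sin_sq_add_cos_sq (2 * Real.pi * phase τ 1 z)
  have c3 := Real.sin_sq_add_cos_sq (2 * Real.pi * phase τ 2 z)
  have hy := h.im_ne_zero
  have hD := h.den_pos.ne'
  -- The weights are precisely those for which the three squared phases add up to a multiple of the
  -- Euclidean form, so that the immersion is homothetic.
  have key : r₁ τ * (phase τ 0 v * phase τ 0 w) + r₂ τ * (phase τ 1 v * phase τ 1 w) +
      r₃ τ * (phase τ 2 v * phase τ 2 w) = inner ℝ v w / den τ := by
    have : inner ℝ v w = v.re * w.re + v.im * w.im := by
      rw [Complex.inner]; simp; ring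
    rw [this, r₁, r₂, r₃, e0, e0, e1, e1, e2, e2]
    field_simp
    ring
  generalize phase τ 0 z = x0 at *
  generalize phase τ 1 z = x1 at *
  generalize phase τ 2 z = x2 at *
  trans 4 * Real.pi ^ 2 * (r₁ τ * (phase τ 0 v * phase τ 0 w) + r₂ τ * (phase τ 1 v * phase τ 1 w) +
      r₃ τ * (phase τ 2 v * phase τ 2 w))
  · simp only [Matrix.cons_val, smul_apply, smul_eq_mul, RCLike.inner_apply, conj_trivial]
    linear_combination 4 * Real.pi ^ 2 *
      (√(r₁ τ) ^ 2 * (phase τ 0 v * phase τ 0 w) * c1 + phase τ 0 v * phase τ 0 w * s1 +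
      √(r₂ τ) ^ 2 * (phase τ 1 v * phase τ 1 w) * c2 + phase τ 1 v * phase τ 1 w * s2 +
      √(r₃ τ) ^ 2 * (phase τ 2 v * phase τ 2 w) * c3 + phase τ 2 v * phase τ 2 w * s3)
  · rw [key]; ring

end FundamentalImmersion

/-! ### The conformal volume of the fundamental homothetic immersion -/

section ConformalVolumeOfFundamentalImmersion

open MeasureTheory

variable {τ : ℂ} {n : ℕ}

theorem inner_fderiv_of_lift (h : InFundamentalRegion τ) {f : Torus τ → Sphere n}
    (j : Ambient 5 →ₗᵢ[ℝ] Ambient n) (hf : ∀ z, periodicLift f z = j (fundamentalVector τ z))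
    (z v w : ℂ) :
    inner ℝ (fderiv ℝ (periodicLift f) z v) (fderiv ℝ (periodicLift f) z w) =
      4 * Real.pi ^ 2 / den τ * inner ℝ v w := by
  have hd : DifferentiableAt ℝ (fundamentalVector τ) z :=
    (contDiff_fundamentalVector τ).differentiable (by simp) z
  have e : fderiv ℝ (periodicLift f) z =
      j.toContinuousLinearMap.comp (fderiv ℝ (fundamentalVector τ) z) := by
    rw [show periodicLift f = j.toContinuousLinearMap ∘ fundamentalVector τ from funext hf]
    exact (j.toContinuousLinearMap.hasFDerivAt.comp z hd.hasFDerivAt).fderiv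
  rw [e, ← inner_fderiv_fundamentalVector h z]
  exact j.inner_map_map _ _

theorem contDiff_periodicLift_of_lift {f : Torus τ → Sphere n}
    (j : Ambient 5 →ₗᵢ[ℝ] Ambient n) (hf : ∀ z, periodicLift f z = j (fundamentalVector τ z)) :
    ContDiff ℝ ∞ (periodicLift f) := by
  rw [show periodicLift f = j.toContinuousLinearMap ∘ fundamentalVector τ from funext hf]
  exact j.toContinuousLinearMap.contDiff.comp (contDiff_fundamentalVector τ)

theorem isBranchedConformal_of_lift (h : InFundamentalRegion τ) {f : Torus τ → Sphere n}
    (j : Ambient 5 →ₗᵢ[ℝ] Ambient n) (hf : ∀ z, periodicLift f z = j (fundamentalVector τ z)) :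
    IsBranchedConformal f where
  smooth := contDiff_periodicLift_of_lift j hf
  conformal z := ⟨_, (div_pos (by positivity) h.den_pos).le, inner_fderiv_of_lift h j hf z⟩
  branched := by
    refine Set.Finite.subset Set.finite_empty ?_
    rintro p ⟨z, -, hz⟩
    refine hz ((injective_iff_map_eq_zero _).2 fun v hv => ?_)
    have e := inner_fderiv_of_lift h j hf z v v
    rw [hv, inner_zero_left, eq_comm, mul_eq_zero] at e
    exact inner_self_eq_zero.1 (e.resolve_left (div_pos (by positivity) h.den_pos).ne')

theorem area_of_lift (h : InFundamentalRegion τ) {f : Torus τ → Sphere n}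
    (j : Ambient 5 →ₗᵢ[ℝ] Ambient n) (hf : ∀ z, periodicLift f z = j (fundamentalVector τ z)) :
    area f = ENNReal.ofReal
      (4 * Real.pi ^ 2 * τ.im / (τ.im ^ 2 + τ.re ^ 2 - τ.re + 1)) := by
  have hκ : 0 ≤ 4 * Real.pi ^ 2 / den τ := (div_pos (by positivity) h.den_pos).le
  have hd (z : ℂ) := areaDensity_of_conformal hκ (inner_fderiv_of_lift h j hf z)
  simp only [area, hd]
  rw [setLIntegral_fundamentalParallelogram h.im_pos measurable_const]
  simp only [lintegral_const, Measure.restrict_apply_univ, Real.volume_Ioc, sub_zero,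
    ENNReal.ofReal_one, mul_one]
  rw [← ENNReal.ofReal_mul h.im_pos.le, den]
  congr 1
  ring

/-- In lattice coordinates the three phases are t, s and s + t, the form required by
`three_angle_average_le`. -/
theorem inner_fundamentalVector (h : InFundamentalRegion τ) (b : Ambient 5) (s t : ℝ) :
    inner ℝ b (fundamentalVector τ (s + t * τ)) =
      √(r₁ τ) * (b 0 * Real.cos (2 * Real.pi * t) + b 1 * Real.sin (2 * Real.pi * t)) +
      √(r₂ τ) * (b 2 * Real.cos (2 * Real.pi * s) + b 3 * Real.sin (2 * Real.pi * s)) +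
      √(r₃ τ) * (b 4 * Real.cos (2 * Real.pi * (s + t)) +
        b 5 * Real.sin (2 * Real.pi * (s + t))) := by
  have hy := h.im_ne_zero
  have e0 : ((s : ℂ) + t * τ).im / τ.im = t := by simp; field_simp
  have e1 : ((s : ℂ) + t * τ).re - ((s : ℂ) + t * τ).im * τ.re / τ.im = s := by
    simp; field_simp; ring
  have e2 : ((s : ℂ) + t * τ).re - ((s : ℂ) + t * τ).im * (τ.re - 1) / τ.im = s + t := by
    simp; field_simp; ring
  rw [fundamentalVector, e0, e1, e2, PiLp.inner_apply, Fin.sum_univ_six]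
  simp only [Matrix.cons_val, RCLike.inner_apply, conj_trivial]
  ring

theorem norm_sq_ambient_five (b : Ambient 5) : ‖b‖ ^ 2 =
    (b 0 ^ 2 + b 1 ^ 2) + (b 2 ^ 2 + b 3 ^ 2 + b 4 ^ 2 + b 5 ^ 2) := by
  rw [EuclideanSpace.norm_sq_eq, Fin.sum_univ_six]
  simp only [Real.norm_eq_abs, sq_abs]
  ring

/-- Dividing by A reduces to A = 1; the sign of A does not matter because of the square. -/
theorem integral_affine_factor_le (h : InFundamentalRegion τ) (hr : r₁ τ ≤ 2 / 3)
    {A : ℝ} {b : Ambient 5} (hAb : 1 ≤ A ^ 2 - ‖b‖ ^ 2) :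
    ∫ t in (0 : ℝ)..1, ∫ s in (0 : ℝ)..1,
      ((A + inner ℝ b (fundamentalVector τ (s + t * τ))) ^ 2)⁻¹ ≤ 1 := by
  have hA2 : 0 < A ^ 2 := by nlinarith [sq_nonneg ‖b‖]
  have hA : A ≠ 0 := fun h0 => by simp [h0] at hA2
  have hS : ‖A⁻¹ • b‖ ^ 2 = ‖b‖ ^ 2 / A ^ 2 := by
    rw [norm_smul, mul_pow, norm_inv, inv_pow, Real.norm_eq_abs, sq_abs]
    ring
  have hS1 : ‖A⁻¹ • b‖ ^ 2 < 1 := by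
    rw [hS, div_lt_one hA2]; linarith
  have key := three_angle_average_le h.r₁_ge hr h.r₂_nonneg h.r₃_nonneg h.r_sum
    ((A⁻¹ • b) 0) ((A⁻¹ • b) 1) ((A⁻¹ • b) 2) ((A⁻¹ • b) 3) ((A⁻¹ • b) 4) ((A⁻¹ • b) 5)
    (by rwa [← norm_sq_ambient_five])
  rw [← norm_sq_ambient_five, hS] at key
  simp only [← inner_fundamentalVector h] at key
  have e (s t : ℝ) : ((A + inner ℝ b (fundamentalVector τ (s + t * τ))) ^ 2)⁻¹ =
      (A ^ 2)⁻¹ *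
        ((1 + inner ℝ (A⁻¹ • b) (fundamentalVector τ (s + t * τ))) ^ 2)⁻¹ := by
    rw [real_inner_smul_left, ← mul_inv, ← mul_pow, mul_add, mul_inv_cancel_left₀ hA, mul_one]
  simp only [e, intervalIntegral.integral_const_mul]
  calc _ ≤ (A ^ 2)⁻¹ * (1 - ‖b‖ ^ 2 / A ^ 2)⁻¹ := by gcongr
    _ = (A ^ 2 - ‖b‖ ^ 2)⁻¹ := by rw [← mul_inv, mul_sub, mul_div_cancel₀ _ hA2.ne', mul_one]
    _ ≤ 1 := inv_le_one_of_one_le₀ hAb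

theorem area_conformalAut_comp_le (h : InFundamentalRegion τ) (hr : r₁ τ ≤ 2 / 3) (hn : 5 ≤ n)
    {f : Torus τ → Sphere n} (j : Ambient 5 →ₗᵢ[ℝ] Ambient n)
    (hf : ∀ z, periodicLift f z = j (fundamentalVector τ z))
    {ψ : Sphere n ≃ₘ^∞⟮𝓡 n, 𝓡 n⟯ Sphere n} (hψ : IsConformalAut ψ) :
    area (fun p => ψ (f p)) ≤ ENNReal.ofReal
      (4 * Real.pi ^ 2 * τ.im / (τ.im ^ 2 + τ.re ^ 2 - τ.re + 1)) := by
  -- The projection centre must lie outside the image: the first coordinate of f_τ is at most √r₁ <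
  -- 1.
  let v : Sphere n := ⟨j (EuclideanSpace.single 0 1), by simp⟩
  obtain ⟨A, B, hAB, hfac⟩ := hψ.exists_affine_factor (by omega) v
  have hs := contDiff_periodicLift_of_lift j hf
  have hv (z : ℂ) : f (QuotientAddGroup.mk z) ≠ v := by
    intro hz
    have h1 : j (fundamentalVector τ z) = j (EuclideanSpace.single 0 1) := by
      rw [← hf]; exact congrArg Subtype.val hz
    have h2 : fundamentalVector τ z 0 = 1 := by rw [j.injective h1]; simp
    have h3 : √(r₁ τ) * Real.cos (2 * Real.pi * (z.im / τ.im)) = 1 := h2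
    have h4 : √(r₁ τ) < 1 := by rw [Real.sqrt_lt' one_pos]; linarith
    nlinarith [Real.cos_le_one (2 * Real.pi * (z.im / τ.im)), Real.sqrt_nonneg (r₁ τ)]
  -- Only the component of B along the embedded 𝔼⁶ is seen by the map. Passing to it can only
  -- increase A² - |B|², so an inequality replaces the equality.
  let b : Ambient 5 := j.toContinuousLinearMap.adjoint B
  have hb (w : Ambient 5) : inner ℝ B (j w) = inner ℝ b w :=
    (ContinuousLinearMap.adjoint_inner_left j.toContinuousLinearMap w B).symm
  have hbB : ‖b‖ ≤ ‖B‖ := by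
    by_contra! hlt
    have h1 : ‖b‖ ^ 2 ≤ ‖B‖ * ‖b‖ := by
      rw [← real_inner_self_eq_norm_sq, ← hb, ← j.norm_map b]
      exact real_inner_le_norm _ _
    nlinarith [norm_nonneg B, norm_nonneg b]
  have hAb : 1 ≤ A ^ 2 - ‖b‖ ^ 2 := by nlinarith [norm_nonneg B, norm_nonneg b]
  have hne (z : ℂ) : A + inner ℝ b (fundamentalVector τ z) ≠ 0 := by
    intro h0
    have h1 := abs_real_inner_le_norm b (fundamentalVector τ z)
    rw [mem_sphere_zero_iff_norm.1 (fundamentalVector_mem h z), mul_one] at h1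
    have h2 := sq_le_sq' (neg_le_of_abs_le h1) (le_of_abs_le h1)
    have h3 : inner ℝ b (fundamentalVector τ z) = -A := by linarith
    rw [h3] at h2
    nlinarith
  set κ := 4 * Real.pi ^ 2 / den τ with hκdef
  have hκ : 0 ≤ κ := (div_pos (by positivity) h.den_pos).le
  have hdens (z : ℂ) : areaDensity (periodicLift fun p => ψ (f p)) z =
      κ * ((A + inner ℝ b (fundamentalVector τ z)) ^ 2)⁻¹ := by
    refine areaDensity_of_conformal (mul_nonneg hκ (by positivity)) fun x y => ?_
    refine (hfac (fun z => f (QuotientAddGroup.mk z)) hs hv z x y).trans ?_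
    have e1 : inner ℝ B (f (QuotientAddGroup.mk z) : Ambient n) =
        inner ℝ b (fundamentalVector τ z) := by
      rw [← hb, ← hf]; rfl
    have e2 := inner_fderiv_of_lift h j hf z x y
    rw [e1, mul_comm κ, mul_assoc, ← e2]
    rfl
  have hcont : Continuous fun z => κ * ((A + inner ℝ b (fundamentalVector τ z)) ^ 2)⁻¹ := by
    refine continuous_const.mul (Continuous.inv₀ ?_ fun z => pow_ne_zero 2 (hne z))
    exact (continuous_const.add
      (continuous_const.inner (contDiff_fundamentalVector τ).continuous)).pow 2
  simp only [area, hdens]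
  rw [setLIntegral_fundamentalParallelogram h.im_pos hcont.measurable.ennreal_ofReal]
  have hI := lintegral_unitSquare_ofReal
    (h := fun s t => κ * ((A + inner ℝ b (fundamentalVector τ (s + t * τ))) ^ 2)⁻¹)
    (hcont.comp (by fun_prop : Continuous fun p : ℝ × ℝ => (p.1 : ℂ) + p.2 * τ))
    (fun s t => mul_nonneg hκ (by positivity))
  rw [hI, ← ENNReal.ofReal_mul h.im_pos.le]
  simp only [intervalIntegral.integral_const_mul]
  refine ENNReal.ofReal_le_ofReal ?_
  calc _ ≤ τ.im * (κ * 1) := by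
        gcongr
        exacts [h.im_pos.le, integral_affine_factor_le h hr hAb]
    _ = _ := by rw [hκdef, den]; ring

theorem isConformalAut_refl : IsConformalAut (Diffeomorph.refl (𝓡 n) (Sphere n) ∞) := by
  intro p
  refine ⟨1, one_pos, fun v w => ?_⟩
  have e : mfderiv (𝓡 n) (𝓡 n) (Diffeomorph.refl (𝓡 n) (Sphere n) ∞) p =
      ContinuousLinearMap.id ℝ (TangentSpace (𝓡 n) p) := mfderiv_id
  rw [e, one_mul]
  rfl

theorem mapConformalVolume_of_lift (h : InFundamentalRegion τ) (hr : r₁ τ ≤ 2 / 3) (hn : 5 ≤ n)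
    {f : Torus τ → Sphere n} (j : Ambient 5 →ₗᵢ[ℝ] Ambient n)
    (hf : ∀ z, periodicLift f z = j (fundamentalVector τ z)) :
    mapConformalVolume f = ENNReal.ofReal
      (4 * Real.pi ^ 2 * τ.im / (τ.im ^ 2 + τ.re ^ 2 - τ.re + 1)) := by
  refine le_antisymm (iSup₂_le fun ψ hψ => area_conformalAut_comp_le h hr hn j hf hψ) ?_
  rw [← area_of_lift h j hf]
  exact le_iSup₂ (f := fun (ψ : Sphere n ≃ₘ^∞⟮𝓡 n, 𝓡 n⟯ Sphere n)
    (_ : IsConformalAut ψ) => area fun p => ψ (f p)) (Diffeomorph.refl _ _ _) isConformalAut_refl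

theorem exists_linearIsometry_ambient (hn : 5 ≤ n) : Nonempty (Ambient 5 →ₗᵢ[ℝ] Ambient n) := by
  let e : Fin 6 → Ambient n := fun i => EuclideanSpace.single (Fin.castLE (by omega) i) 1
  have he : Orthonormal ℝ e := by
    have := (EuclideanSpace.orthonormal_single (𝕜 := ℝ) (ι := Fin (n + 1)))
    exact this.comp _ (Fin.castLE_injective _)
  let B := EuclideanSpace.basisFun (Fin 6) ℝ
  refine ⟨(B.toBasis.constr ℝ e).isometryOfOrthonormal (v := B.toBasis) ?_ ?_⟩
  · simp
  · convert he
    ext i : 1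
    simp

theorem exists_lift (h : InFundamentalRegion τ) (j : Ambient 5 →ₗᵢ[ℝ] Ambient n) :
    ∃ f : Torus τ → Sphere n, ∀ z, periodicLift f z = j (fundamentalVector τ z) :=
  ⟨fun p => ⟨j (fundamentalImmersion h p), by simp⟩, fun _ => rfl⟩

/-- The map f_τ, followed by an isometric inclusion of S⁵ into Sⁿ, attains the lower bound in every
dimension n ≥ 5. -/
theorem nConformalVolume_eq (h : InFundamentalRegion τ) (hr : r₁ τ ≤ 2 / 3) (hn : 5 ≤ n) :
    nConformalVolume τ n = ENNReal.ofReal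
      (4 * Real.pi ^ 2 * τ.im / (τ.im ^ 2 + τ.re ^ 2 - τ.re + 1)) := by
  obtain ⟨j⟩ := exists_linearIsometry_ambient hn
  obtain ⟨f, hf⟩ := exists_lift h j
  refine le_antisymm ?_ (le_iInf₂ fun f hf => conformalVolume_lower_bound h.im_pos hf)
  rw [← mapConformalVolume_of_lift h hr hn j hf]
  exact iInf₂_le f (isBranchedConformal_of_lift h j hf)

end ConformalVolumeOfFundamentalImmersion

end ConformalTorus

/-! ### The theorem. -/

theorem theorem2 (τ : ℂ) (hτ : InFundamentalRegion τ) :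
    (r₁ τ ≤ 2 / 3 ↔ ‖τ - 1 / 2‖ ≤ 3 / 2) ∧
    (r₁ τ ≤ 2 / 3 →
      mapConformalVolume (fundamentalImmersion hτ) = area (fundamentalImmersion hτ) ∧
      Tendsto (nConformalVolume τ) atTop (𝓝 (conformalVolume τ)) ∧
      conformalVolume τ = area (fundamentalImmersion hτ) ∧
      area (fundamentalImmersion hτ) =
        ENNReal.ofReal (4 * Real.pi ^ 2 * τ.im / (τ.im ^ 2 + τ.re ^ 2 - τ.re + 1))) := by
  refine ⟨r₁_le_two_thirds_iff hτ, fun hr => ?_⟩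
  have hlift (z : ℂ) : periodicLift (fundamentalImmersion hτ) z =
      (LinearIsometry.id : Ambient 5 →ₗᵢ[ℝ] Ambient 5) (fundamentalVector τ z) := rfl
  have harea := area_of_lift hτ _ hlift
  have hlim : Tendsto (nConformalVolume τ) atTop (𝓝 (area (fundamentalImmersion hτ))) := by
    rw [harea]
    refine tendsto_const_nhds.congr' ?_
    filter_upwards [eventually_ge_atTop 5] with n hn
    exact (nConformalVolume_eq hτ hr hn).symm
  -- `limUnder` is a chosen value; it is identified only because convergence is already established.
  have hvol : conformalVolume τ = area (fundamentalImmersion hτ) := hlim.limUnder_eq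
  refine ⟨?_, hvol.symm ▸ hlim, hvol, harea⟩
  rw [harea, mapConformalVolume_of_lift hτ hr le_rfl _ hlift]
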